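/- Let $G$ be a finitely generated torsion-free elementary amenable group of Hirsch length $h(G)=3$, and let $\sqrt{G}$ denote its Hirsch--Plotkin radical, that is, the unique maximal locally nilpotent normal subgroup of $G$. Then $G$ is a solvable minimax group: $G$ is solvable, and it has a finite subnormal series $1=H_0\trianglelefteq H_1\trianglelefteq\cdots\trianglelefteq H_n=G$ in which each section $H_{i+1}/H_i$ is either finite or isomorphic to the additive group $\mathbb{Z}[\frac1m]$ for some integer $m>0$ (depending on $i$). Moreover: (i) if $h(\sqrt{G})=1$, then $\sqrt{G}\cong\mathbb{Z}[\frac1D]$ (as a group) for some integer $D>0$; (ii) if $h(\sqrt{G})=2$, then $\sqrt{G}$ is isomorphic to a subgroup of the additive group $\mathbb{Z}[\frac1m]^2$ for some integer $m>0$. Here the elementary amenable groups form the smallest class of groups that contains all finite and all abelian groups and is closed under subgroups, quotients, extensions and directed unions. The Hirsch length $h$ is the function on this class with values in $\mathbb{N}\cup\{\infty\}$ that is $0$ on finite groups and $1$ on infinite cyclic groups, is additive on extensions, and takes on a directed union of subgroups the supremum of its values on them. -/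

import Mathlib

universe u

/-- The class of elementary amenable groups: the smallest class of groups which contains the finite
groups and the abelian groups and is closed under subgroups, quotients, extensions and directed
unions. -/
inductive IsElementaryAmenable : (G : Type u) → [Group G] → Prop
  | of_finite (G : Type u) [Group G] [Finite G] : IsElementaryAmenable G
  | of_comm (G : Type u) [Group G] (hcomm : ∀ a b : G, a * b = b * a) : IsElementaryAmenable G
  | of_injective {G H : Type u} [Group G] [Group H] (f : H →* G) (hf : Function.Injective f)
      (hG : IsElementaryAmenable G) : IsElementaryAmenable H
  | of_surjective {G Q : Type u} [Group G] [Group Q] (f : G →* Q) (hf : Function.Surjective f)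
      (hG : IsElementaryAmenable G) : IsElementaryAmenable Q
  | of_extension {G : Type u} [Group G] (N : Subgroup G) [N.Normal]
      (hN : IsElementaryAmenable N) (hQ : IsElementaryAmenable (G ⧸ N)) : IsElementaryAmenable G
  | of_directed_union {G : Type u} [Group G] (S : Set (Subgroup G)) (hne : S.Nonempty)
      (hdir : DirectedOn (· ≤ ·) S) (hsup : sSup S = ⊤)
      (hS : ∀ H ∈ S, IsElementaryAmenable H) : IsElementaryAmenable G

/-- `HasHirschLength G n`: the value `n` is computed for `G` by the rules defining the Hirsch length
of elementary amenable groups: it is `0` on finite groups and `1` on infinite cyclic groups, it is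
additive on extensions, and on a directed union it is the supremum of the values on the members.
Every elementary amenable group is obtained by these rules, and the value does not depend on the
way in which the group is obtained. -/
inductive HasHirschLength : (G : Type u) → [Group G] → ℕ∞ → Prop
  | of_finite (G : Type u) [Group G] [Finite G] : HasHirschLength G 0
  | of_infinite_cyclic (G : Type u) [Group G] [IsCyclic G] [Infinite G] : HasHirschLength G 1
  | of_extension {G : Type u} [Group G] (N : Subgroup G) [N.Normal] {p q : ℕ∞}
      (hN : HasHirschLength N p) (hQ : HasHirschLength (G ⧸ N) q) : HasHirschLength G (p + q)
  | of_directed_union {G : Type u} [Group G] (S : Set (Subgroup G)) (hne : S.Nonempty)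
      (hdir : DirectedOn (· ≤ ·) S) (hsup : sSup S = ⊤) (f : Subgroup G → ℕ∞)
      (hS : ∀ H ∈ S, HasHirschLength H (f H)) : HasHirschLength G (⨆ H ∈ S, f H)

/-- The Hirsch length `h(G)` of an elementary amenable group, with values in `ℕ ∪ {∞}`
(and the value `∞` on groups which are not elementary amenable). -/
noncomputable def hirschLength (G : Type u) [Group G] : ℕ∞ :=
  sInf {n : ℕ∞ | HasHirschLength G n}

/-- A group is locally nilpotent if all its finitely generated subgroups are nilpotent. -/
def IsLocallyNilpotentGroup (G : Type u) [Group G] : Prop :=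
  ∀ K : Subgroup G, K.FG → Group.IsNilpotent K

/-- The Hirsch–Plotkin radical `√G`: the subgroup generated by all locally nilpotent normal
subgroups, which is the unique maximal locally nilpotent normal subgroup of `G`. -/
def hirschPlotkinRadical (G : Type u) [Group G] : Subgroup G :=
  sSup {N : Subgroup G | N.Normal ∧ IsLocallyNilpotentGroup N}

/-- The ring `ℤ[1/m]`. -/
abbrev ZInv (m : ℕ) : Type := Localization.Away (m : ℤ)

/-- A solvable group is minimax if it has a finite subnormal series
`1 = H 0 ≤ H 1 ≤ ⋯ ≤ H n = G` each of whose sections is finite or isomorphic to the additive group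
of `ℤ[1/m]` for some `m > 0`. -/
def IsSolvableMinimax (G : Type u) [Group G] : Prop :=
  Group.IsSolvable G ∧
    ∃ (n : ℕ) (H : ℕ → Subgroup G), H 0 = ⊥ ∧ H n = ⊤ ∧
      ∀ i < n, H i ≤ H (i + 1) ∧
        ∃ _ : ((H i).subgroupOf (H (i + 1))).Normal,
          Finite (H (i + 1) ⧸ (H i).subgroupOf (H (i + 1))) ∨
          ∃ m : ℕ, 0 < m ∧
            Nonempty ((H (i + 1) ⧸ (H i).subgroupOf (H (i + 1))) ≃* Multiplicative (ZInv m))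

open scoped commutatorElement

/-! ### Hirsch length: monotonicity, additivity, independent elements. -/

section HirschLength

/-! Everything rests on one reduction: G has an abelian normal subgroup A with G/A virtually
polycyclic. Virtually polycyclic groups are `FinitelyRelated`, so A is the normal closure of a
finite set. As A has finite rank and G is finitely generated, one integer m bounds all denominators:
A has a finitely generated subgroup B such that every a in A has a power a^(m^k) in B
(`isFGUpToPowers_of_normalClosure`). A torsion-free abelian group of this kind is some ℤ[1/D] in
rank one, embeds in ℤ[1/m]² in rank at most two, and has a series with sections of the form ℤ[1/D]
in any finite rank. Together with a series of G/A this gives the minimax series of G.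

Since A lies in √G, the quotient G/√G is virtually polycyclic as well. If h(√G) ≤ 2, then √G is
abelian, because two elements whose commutator is nontrivial and commutes with both generate a group
of length at least 3 (`TorsionFreeGroup.three_le_hirschLength`). So (i) and (ii) follow from the
same argument applied to √G.

To find A, note that a finitely generated infinite group of finite Hirsch length has a quotient G/N
that is virtually ℤ^r with r > 0 (`exists_virtually_abelian_quotient`); hence h(N) ≤ 2. Finite
groups acting on a lattice of rank at most 3 are solvable of bounded derived length. With Schur's
theorem this shows that seven derived steps lower the Hirsch length of a finitely generated group by
at least one, so G is solvable (`TorsionFreeGroup.derivedSeries_eq_bot`). The derived series of G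
then supplies abelian normal subgroups of G inside N, and A is the centralizer in N of a suitable
one (`exists_abelian_normal_virtuallyPolycyclic`). Sections of Hirsch length 0 are only locally
finite; Schur's theorem and Minkowski's bound on finite linear groups make them harmless. -/

theorem HasHirschLength.hirschLength {G : Type u} [Group G] {n : ℕ∞} (h : HasHirschLength G n) :
    HasHirschLength G (hirschLength G) :=
  csInf_mem (s := {n : ℕ∞ | HasHirschLength G n}) ⟨n, h⟩

theorem HasHirschLength.hirschLength_le {G : Type u} [Group G] {n : ℕ∞}
    (h : HasHirschLength G n) : _root_.hirschLength G ≤ n :=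
  sInf_le h

/-- The infimum of the empty set is `⊤`; otherwise `ℕ∞` is well-ordered and the infimum is attained.
-/
theorem hasHirschLength_of_ne_top {G : Type u} [Group G] (h : hirschLength G ≠ ⊤) :
    HasHirschLength G (hirschLength G) := by
  by_cases hne : ∃ n, HasHirschLength G n
  · obtain ⟨n, hn⟩ := hne
    exact hn.hirschLength
  · exfalso
    apply h
    have : {n : ℕ∞ | HasHirschLength G n} = ∅ := by
      ext n
      simp only [Set.mem_ofPred_eq, Set.mem_empty_iff_false, iff_false]
      exact fun hn => hne ⟨n, hn⟩
    rw [hirschLength, this, sInf_empty]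

theorem le_hirschLength {G : Type u} [Group G] {m : ℕ∞}
    (h : ∀ n, HasHirschLength G n → m ≤ n) : m ≤ hirschLength G :=
  le_sInf h

theorem hirschLength_le_quotient_add {G : Type u} [Group G] (N : Subgroup G) [N.Normal] :
    hirschLength G ≤ hirschLength N + hirschLength (G ⧸ N) := by
  by_cases h1 : hirschLength N = ⊤
  · simp [h1]
  by_cases h2 : hirschLength (G ⧸ N) = ⊤
  · simp [h2]
  exact (HasHirschLength.of_extension N (hasHirschLength_of_ne_top h1)
    (hasHirschLength_of_ne_top h2)).hirschLength_le

theorem hirschLength_le_iSup {G : Type u} [Group G] (S : Set (Subgroup G)) (hne : S.Nonempty)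
    (hdir : DirectedOn (· ≤ ·) S) (hsup : sSup S = ⊤) :
    hirschLength G ≤ ⨆ H ∈ S, hirschLength H := by
  by_cases h : ∃ H ∈ S, hirschLength H = ⊤
  · obtain ⟨H, hH, h⟩ := h
    rw [show (⨆ H ∈ S, hirschLength H) = ⊤ from top_le_iff.mp
      (h ▸ le_iSup₂ (f := fun (H : Subgroup G) (_ : H ∈ S) => hirschLength H) H hH)]
    exact le_top
  · push Not at h
    exact (HasHirschLength.of_directed_union S hne hdir hsup (fun H => hirschLength H)
      fun H hH => hasHirschLength_of_ne_top (h H hH)).hirschLength_le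

/-- The members of a directed family with union `G` are cut down along a homomorphism `K →* G`. -/
theorem directed_comap {G K : Type u} [Group G] [Group K] (f : K →* G) {S : Set (Subgroup G)}
    (hne : S.Nonempty) (hdir : DirectedOn (· ≤ ·) S) (hsup : sSup S = ⊤) :
    (Subgroup.comap f '' S).Nonempty ∧ DirectedOn (· ≤ ·) (Subgroup.comap f '' S) ∧
      sSup (Subgroup.comap f '' S) = ⊤ := by
  refine ⟨hne.image _, ?_, ?_⟩
  · rintro _ ⟨A, hA, rfl⟩ _ ⟨B, hB, rfl⟩
    obtain ⟨C, hC, hAC, hBC⟩ := hdir A hA B hB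
    exact ⟨_, ⟨C, hC, rfl⟩, Subgroup.comap_mono hAC, Subgroup.comap_mono hBC⟩
  · rw [eq_top_iff]
    intro x _
    have hx : f x ∈ sSup S := hsup ▸ Subgroup.mem_top _
    rw [Subgroup.mem_sSup_of_directedOn hne hdir] at hx
    obtain ⟨A, hA, hx⟩ := hx
    exact le_sSup (Set.mem_image_of_mem (Subgroup.comap f) hA) hx

theorem directed_map {G Q : Type u} [Group G] [Group Q] (f : G →* Q)
    (hf : Function.Surjective f) {S : Set (Subgroup G)}
    (hne : S.Nonempty) (hdir : DirectedOn (· ≤ ·) S) (hsup : sSup S = ⊤) :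
    (Subgroup.map f '' S).Nonempty ∧ DirectedOn (· ≤ ·) (Subgroup.map f '' S) ∧
      sSup (Subgroup.map f '' S) = ⊤ := by
  refine ⟨hne.image _, ?_, ?_⟩
  · rintro _ ⟨A, hA, rfl⟩ _ ⟨B, hB, rfl⟩
    obtain ⟨C, hC, hAC, hBC⟩ := hdir A hA B hB
    exact ⟨_, ⟨C, hC, rfl⟩, Subgroup.map_mono hAC, Subgroup.map_mono hBC⟩
  · rw [eq_top_iff]
    intro y _
    obtain ⟨x, rfl⟩ := hf y
    have hx : x ∈ sSup S := hsup ▸ Subgroup.mem_top _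
    rw [Subgroup.mem_sSup_of_directedOn hne hdir] at hx
    obtain ⟨A, hA, hx⟩ := hx
    exact le_sSup (Set.mem_image_of_mem (Subgroup.map f) hA) ⟨x, hx, rfl⟩

theorem hirschLength_of_finite (G : Type u) [Group G] [Finite G] : hirschLength G = 0 :=
  le_antisymm (HasHirschLength.of_finite G).hirschLength_le bot_le

theorem hirschLength_le_one_of_isCyclic (G : Type u) [Group G] [IsCyclic G] :
    hirschLength G ≤ 1 := by
  rcases finite_or_infinite G with h | h
  · rw [hirschLength_of_finite]
    exact zero_le_one
  · exact (HasHirschLength.of_infinite_cyclic G).hirschLength_le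

/-- By induction on the derivation of `n`: each rule for `G` restricts to the same rule for `K`.
Bounding the infimum for `K` by every derivable `n` avoids having to know that the value is unique.
-/
theorem HasHirschLength.le_of_injective {G : Type u} [Group G] {n : ℕ∞} (h : HasHirschLength G n) :
    ∀ {K : Type u} [Group K] (f : K →* G), Function.Injective f → _root_.hirschLength K ≤ n := by
  induction h with
  | of_finite G =>
    intro K _ f hf
    have := Finite.of_injective f hf
    rw [hirschLength_of_finite]
  | of_infinite_cyclic G =>
    intro K _ f hf
    have : IsCyclic K := isCyclic_of_injective f hf
    exact hirschLength_le_one_of_isCyclic K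
  | @of_extension G _ N _ p q hN hQ ihN ihQ =>
    intro K _ f hf
    refine (hirschLength_le_quotient_add (N.comap f)).trans (add_le_add ?_ ?_)
    · refine ihN (f.subgroupComap N) fun x y hxy => Subtype.ext (hf (congrArg Subtype.val hxy))
    · refine ihQ (QuotientGroup.map (N.comap f) N f le_rfl) ?_
      rw [injective_iff_map_eq_one]
      intro x
      induction x using QuotientGroup.induction_on with
      | H x =>
        intro hx
        rw [QuotientGroup.map_mk, QuotientGroup.eq_one_iff] at hx
        rwa [QuotientGroup.eq_one_iff]
  | @of_directed_union G _ S hne hdir hsup F hS ih =>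
    intro K _ f hf
    obtain ⟨h1, h2, h3⟩ := directed_comap f hne hdir hsup
    refine (hirschLength_le_iSup _ h1 h2 h3).trans (iSup₂_le ?_)
    rintro _ ⟨A, hA, rfl⟩
    refine le_trans ?_ (le_iSup₂ (f := fun (H : Subgroup G) (_ : H ∈ S) => F H) A hA)
    exact ih A hA (f.subgroupComap A)
      fun x y hxy => Subtype.ext (hf (congrArg Subtype.val hxy))

theorem HasHirschLength.le_of_surjective {G : Type u} [Group G] {n : ℕ∞}
    (h : HasHirschLength G n) :
    ∀ {Q : Type u} [Group Q] (f : G →* Q), Function.Surjective f → _root_.hirschLength Q ≤ n := by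
  induction h with
  | of_finite G =>
    intro Q _ f hf
    have := Finite.of_surjective f hf
    rw [hirschLength_of_finite]
  | of_infinite_cyclic G =>
    intro Q _ f hf
    have : IsCyclic Q := isCyclic_of_surjective f hf
    exact hirschLength_le_one_of_isCyclic Q
  | @of_extension G _ N hNn p q hN hQ ihN ihQ =>
    intro Q _ f hf
    have : (N.map f).Normal := hNn.map f hf
    refine (hirschLength_le_quotient_add (N.map f)).trans (add_le_add ?_ ?_)
    · exact ihN (f.subgroupMap N) (f.subgroupMap_surjective N)
    · refine ihQ (QuotientGroup.map N (N.map f) f (Subgroup.le_comap_map f N)) ?_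
      exact QuotientGroup.map_surjective_of_surjective _ _ _
        ((QuotientGroup.mk'_surjective _).comp hf) _
  | @of_directed_union G _ S hne hdir hsup F hS ih =>
    intro Q _ f hf
    obtain ⟨h1, h2, h3⟩ := directed_map f hf hne hdir hsup
    refine (hirschLength_le_iSup _ h1 h2 h3).trans (iSup₂_le ?_)
    rintro _ ⟨A, hA, rfl⟩
    refine le_trans ?_ (le_iSup₂ (f := fun (H : Subgroup G) (_ : H ∈ S) => F H) A hA)
    exact ih A hA (f.subgroupMap A) (f.subgroupMap_surjective A)

theorem hirschLength_le_of_injective {G K : Type u} [Group G] [Group K] (f : K →* G)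
    (hf : Function.Injective f) : hirschLength K ≤ hirschLength G :=
  le_hirschLength fun _ h => h.le_of_injective f hf

theorem hirschLength_le_of_surjective {G Q : Type u} [Group G] [Group Q] (f : G →* Q)
    (hf : Function.Surjective f) : hirschLength Q ≤ hirschLength G :=
  le_hirschLength fun _ h => h.le_of_surjective f hf

theorem hirschLength_congr {G K : Type u} [Group G] [Group K] (e : G ≃* K) :
    hirschLength G = hirschLength K :=
  le_antisymm (hirschLength_le_of_injective e.toMonoidHom e.injective)
    (hirschLength_le_of_surjective e.toMonoidHom e.surjective)

theorem hirschLength_subgroup_le {G : Type u} [Group G] (H : Subgroup G) :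
    hirschLength H ≤ hirschLength G :=
  hirschLength_le_of_injective H.subtype H.subtype_injective

theorem hirschLength_mono {G : Type u} [Group G] {H K : Subgroup G} (h : H ≤ K) :
    hirschLength H ≤ hirschLength K :=
  hirschLength_le_of_injective (Subgroup.inclusion h) (Subgroup.inclusion_injective h)

/-- Subadditivity of the Hirsch length along a sequence `A → G → Q` which is exact at `G`. -/
theorem hirschLength_le_add_of_exact {A G Q : Type u} [Group A] [Group G] [Group Q] (f : A →* G)
    (g : G →* Q) (h : g.ker ≤ f.range) : hirschLength G ≤ hirschLength A + hirschLength Q := by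
  refine (hirschLength_le_quotient_add g.ker).trans (add_le_add ?_ ?_)
  · exact (hirschLength_mono h).trans
      (hirschLength_le_of_surjective f.rangeRestrict f.rangeRestrict_surjective)
  · exact hirschLength_le_of_injective (QuotientGroup.kerLift g) (QuotientGroup.kerLift_injective g)

theorem finite_quotient_of_isCyclic {G : Type u} [Group G] [IsCyclic G] (N : Subgroup G)
    (hN : N ≠ ⊥) : N.FiniteIndex := by
  obtain ⟨g, hg⟩ := IsCyclic.exists_zpow_surjective (G := G)
  obtain ⟨⟨x, hx⟩, hx1⟩ := Subgroup.ne_bot_iff_exists_ne_one.mp hN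
  obtain ⟨k, hk⟩ := hg x
  have hk : g ^ k = x := hk
  have hk0 : k ≠ 0 := by
    rintro rfl
    exact hx1 (Subtype.ext (hk.symm.trans (zpow_zero g)))
  have : Finite (G ⧸ N) := by
    have : Function.Surjective
        (fun i : Set.Ico (0 : ℤ) |k| => (QuotientGroup.mk (g ^ (i : ℤ)) : G ⧸ N)) := by
      intro y
      obtain ⟨y, rfl⟩ := QuotientGroup.mk_surjective y
      obtain ⟨j, hj⟩ := hg y
      have hj : g ^ j = y := hj
      refine ⟨⟨j % |k|, Int.emod_nonneg _ (abs_ne_zero.mpr hk0),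
        Int.emod_lt_of_pos _ (abs_pos.mpr hk0)⟩, ?_⟩
      rw [QuotientGroup.eq, ← hj, ← zpow_neg, ← zpow_add]
      have hd : k ∣ -(j % |k|) + j := by
        rw [← abs_dvd]
        exact ⟨j / |k|, by have := Int.emod_add_mul_ediv j |k|; linarith⟩
      obtain ⟨l, hl⟩ := hd
      rw [hl, zpow_mul, hk]
      exact N.zpow_mem hx l
    exact Finite.of_surjective _ this
  exact Subgroup.finiteIndex_of_finite_quotient

/-- This is the half of additivity that the infimum does not give for free. For an extension by `M`,
both `N` and `G ⧸ N` split along `M`, and the four pieces regroup into `M` and `G ⧸ M`. -/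
theorem HasHirschLength.add_quotient_le {G : Type u} [Group G] {n : ℕ∞} (h : HasHirschLength G n) :
    ∀ (N : Subgroup G) [N.Normal],
      _root_.hirschLength N + _root_.hirschLength (G ⧸ N) ≤ n := by
  induction h with
  | of_finite G =>
    intro N _
    rw [hirschLength_of_finite, hirschLength_of_finite, add_zero]
  | of_infinite_cyclic G =>
    intro N _
    by_cases hN : N = ⊥
    · subst hN
      rw [hirschLength_of_finite, zero_add]
      have : IsCyclic (G ⧸ (⊥ : Subgroup G)) :=
        isCyclic_of_surjective _ (QuotientGroup.mk'_surjective _)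
      exact hirschLength_le_one_of_isCyclic _
    · have := finite_quotient_of_isCyclic N hN
      rw [hirschLength_of_finite (G ⧸ N), add_zero]
      exact hirschLength_le_one_of_isCyclic _
  | @of_extension G _ M _ p q hM hQ ihM ihQ =>
    intro N hN
    have hN2 : (N.map (QuotientGroup.mk' M)).Normal := hN.map _ (QuotientGroup.mk'_surjective _)
    have h1 := ihM (N.subgroupOf M)
    have h2 := ihQ (N.map (QuotientGroup.mk' M))
    have h3 : _root_.hirschLength N ≤ _root_.hirschLength (N.subgroupOf M) +
        _root_.hirschLength (N.map (QuotientGroup.mk' M)) := by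
      refine hirschLength_le_add_of_exact
        ((M.subtype.comp (N.subgroupOf M).subtype).codRestrict N fun x => x.2)
        ((QuotientGroup.mk' M).subgroupMap N) ?_
      intro x hx
      have hx' : (x : G) ∈ M := by
        have := congrArg Subtype.val (MonoidHom.mem_ker.mp hx)
        exact (QuotientGroup.eq_one_iff _).mp this
      exact ⟨⟨⟨x, hx'⟩, x.2⟩, rfl⟩
    have h4 : _root_.hirschLength (G ⧸ N) ≤ _root_.hirschLength (M ⧸ N.subgroupOf M) +
        _root_.hirschLength ((G ⧸ M) ⧸ N.map (QuotientGroup.mk' M)) := by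
      refine hirschLength_le_add_of_exact
        (QuotientGroup.map (N.subgroupOf M) N M.subtype le_rfl)
        (QuotientGroup.map N (N.map (QuotientGroup.mk' M)) (QuotientGroup.mk' M)
          (Subgroup.le_comap_map _ _)) ?_
      intro x
      induction x using QuotientGroup.induction_on with
      | H x =>
        intro hx
        rw [MonoidHom.mem_ker, QuotientGroup.map_mk, QuotientGroup.eq_one_iff] at hx
        obtain ⟨y, hy, hyx⟩ := hx
        have hyx : y⁻¹ * x ∈ M := QuotientGroup.eq.mp hyx
        refine ⟨((⟨y⁻¹ * x, hyx⟩ : M) : M ⧸ N.subgroupOf M), ?_⟩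
        refine QuotientGroup.eq.mpr ?_
        have h := hN.conj_mem y hy x⁻¹
        simpa [mul_assoc] using h
    calc _ ≤ _ := add_le_add h3 h4
      _ = (_root_.hirschLength (N.subgroupOf M) + _root_.hirschLength (M ⧸ N.subgroupOf M)) +
        (_root_.hirschLength (N.map (QuotientGroup.mk' M)) +
          _root_.hirschLength ((G ⧸ M) ⧸ N.map (QuotientGroup.mk' M))) := by
        rw [add_add_add_comm]
      _ ≤ _ := add_le_add h1 h2
  | @of_directed_union G _ S hne hdir hsup F hS ih =>
    intro N hN
    obtain ⟨h1, h2, h3⟩ := directed_comap N.subtype hne hdir hsup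
    obtain ⟨k1, k2, k3⟩ := directed_map (QuotientGroup.mk' N) (QuotientGroup.mk'_surjective _)
      hne hdir hsup
    refine (add_le_add (hirschLength_le_iSup _ h1 h2 h3)
      (hirschLength_le_iSup _ k1 k2 k3)).trans ?_
    -- The two suprema run over different members `A` and `B`; directedness supplies one `C` above
    -- both, where the induction hypothesis applies.
    refine ENat.biSup_add_biSup_le h1 k1 ?_
    rintro _ ⟨A, hA, rfl⟩ _ ⟨B, hB, rfl⟩
    obtain ⟨C, hC, hAC, hBC⟩ := hdir A hA B hB
    refine le_trans ?_ (le_iSup₂ (f := fun (H : Subgroup G) (_ : H ∈ S) => F H) C hC)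
    refine le_trans (add_le_add ?_ ?_) (ih C hC (N.subgroupOf C))
    · refine hirschLength_le_of_injective
        (((N.subtype.comp (A.comap N.subtype).subtype).codRestrict C
          fun x => hAC x.2).codRestrict (N.subgroupOf C) fun x => (x : N).2) ?_
      intro x y hxy
      have h : (((x : N) : G)) = ((y : N) : G) :=
        congrArg (fun z : N.subgroupOf C => ((z : C) : G)) hxy
      exact Subtype.ext (Subtype.ext h)
    · refine (hirschLength_mono (Subgroup.map_mono hBC)).trans ?_
      refine (hirschLength_le_of_surjective (QuotientGroup.lift (N.subgroupOf C)
        ((QuotientGroup.mk' N).subgroupMap C) ?_) ?_)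
      · intro x hx
        exact Subtype.ext ((QuotientGroup.eq_one_iff _).mpr hx)
      · intro y
        obtain ⟨x, rfl⟩ := (QuotientGroup.mk' N).subgroupMap_surjective C y
        exact ⟨(x : C ⧸ N.subgroupOf C), rfl⟩

theorem hirschLength_eq_quotient_add {G : Type u} [Group G] (N : Subgroup G) [N.Normal] :
    hirschLength G = hirschLength N + hirschLength (G ⧸ N) :=
  le_antisymm (hirschLength_le_quotient_add N) (le_hirschLength fun _ h => h.add_quotient_le N)

theorem exists_mem_of_fg_of_directed {G K : Type u} [Group G] [Group K] [hK : Group.FG K]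
    (f : K →* G) {S : Set (Subgroup G)} (hne : S.Nonempty) (hdir : DirectedOn (· ≤ ·) S)
    (hsup : sSup S = ⊤) : ∃ A ∈ S, ∀ x, f x ∈ A := by
  classical
  obtain ⟨T, hT⟩ := Group.fg_def.mp hK
  have hA : ∃ A ∈ S, ∀ x ∈ T, f x ∈ A := by
    clear hT
    induction T using Finset.induction_on with
    | empty => exact hne.imp fun A hA => ⟨hA, by simp⟩
    | insert a T _ ihT =>
      obtain ⟨A, hA, hAT⟩ := ihT
      have ha : f a ∈ sSup S := hsup ▸ Subgroup.mem_top _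
      rw [Subgroup.mem_sSup_of_directedOn hne hdir] at ha
      obtain ⟨B, hB, ha⟩ := ha
      obtain ⟨C, hC, hAC, hBC⟩ := hdir A hA B hB
      refine ⟨C, hC, fun x hx => ?_⟩
      rcases Finset.mem_insert.mp hx with rfl | hx
      · exact hBC ha
      · exact hAC (hAT x hx)
  obtain ⟨A, hA, hAT⟩ := hA
  refine ⟨A, hA, fun x => ?_⟩
  have : (⊤ : Subgroup K) ≤ A.comap f := by
    rw [← hT, Subgroup.closure_le]
    exact hAT
  exact this (Subgroup.mem_top x)

/-- Length 0 means locally finite. Quantifying over all embedded `K` lets the induction pass through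
extensions: the image of `K` in the quotient is finite, so `K ∩ N` has finite index in `K` and is
again finitely generated. -/
theorem HasHirschLength.finite_of_fg {G : Type u} [Group G] {n : ℕ∞} (h : HasHirschLength G n) :
    n = 0 → ∀ {K : Type u} [Group K] (f : K →* G), Function.Injective f → Group.FG K →
      Finite K := by
  induction h with
  | of_finite G => exact fun _ K _ f hf _ => Finite.of_injective f hf
  | of_infinite_cyclic G => exact fun h => absurd h one_ne_zero
  | @of_extension G _ N _ p q hN hQ ihN ihQ =>
    intro hpq K _ f hf hK
    obtain ⟨hp, hq⟩ := add_eq_zero.mp hpq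
    have hinj : Function.Injective (QuotientGroup.map (N.comap f) N f le_rfl) := by
      rw [injective_iff_map_eq_one]
      intro x
      induction x using QuotientGroup.induction_on with
      | H x =>
        intro hx
        rw [QuotientGroup.map_mk, QuotientGroup.eq_one_iff] at hx
        rwa [QuotientGroup.eq_one_iff]
    have h1 : Finite (K ⧸ N.comap f) := ihQ hq _ hinj inferInstance
    have h2 : (N.comap f).FiniteIndex := Subgroup.finiteIndex_of_finite_quotient
    have h3 : Finite (N.comap f) := ihN hp (f.subgroupComap N)
      (fun x y hxy => Subtype.ext (hf (congrArg Subtype.val hxy))) inferInstance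
    exact Finite.of_equiv _ (Subgroup.groupEquivQuotientProdSubgroup (s := N.comap f)).symm
  | @of_directed_union G _ S hne hdir hsup F hS ih =>
    intro h0 K _ f hf hK
    obtain ⟨A, hA, hle⟩ := exists_mem_of_fg_of_directed f hne hdir hsup
    have hFA : F A = 0 := by
      have := le_iSup₂ (f := fun (H : Subgroup G) (_ : H ∈ S) => F H) A hA
      exact le_antisymm (this.trans h0.le) bot_le
    exact ih A hA hFA (f.codRestrict A hle)
      (fun x y hxy => hf (congrArg Subtype.val hxy)) hK

theorem finite_of_hirschLength_eq_zero {G : Type u} [Group G] (h : hirschLength G = 0)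
    [hfg : Group.FG G] : Finite G := by
  have h1 := hasHirschLength_of_ne_top (G := G) (by rw [h]; exact ENat.zero_ne_top)
  exact h1.finite_of_fg h (MonoidHom.id G) Function.injective_id hfg

theorem one_le_hirschLength_of_infinite {G : Type u} [Group G] [Group.FG G] [hi : Infinite G] :
    1 ≤ hirschLength G := by
  rw [Order.one_le_iff_ne_zero]
  intro h
  exact hi.not_finite (finite_of_hirschLength_eq_zero h)

theorem hirschLength_zpowers {G : Type u} [Group G] {g : G} (hg : ¬ IsOfFinOrder g) :
    hirschLength (Subgroup.zpowers g) = 1 := by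
  have : Infinite (Subgroup.zpowers g) := (infinite_zpowers.mpr hg).to_subtype
  refine le_antisymm (hirschLength_le_one_of_isCyclic _) ?_
  have : Group.FG (Subgroup.zpowers g) := by
    rw [Group.fg_iff_subgroup_fg]
    exact ⟨{g}, by rw [Finset.coe_singleton, Subgroup.zpowers_eq_closure]⟩
  exact one_le_hirschLength_of_infinite

theorem isOfFinOrder_of_hirschLength_eq_zero {G : Type u} [Group G] (h : hirschLength G = 0)
    (g : G) : IsOfFinOrder g := by
  by_contra hg
  have := hirschLength_subgroup_le (Subgroup.zpowers g)
  rw [h, hirschLength_zpowers hg] at this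
  exact absurd this (by decide)

/-- Multiplicatively written: `r` independent elements of an abelian group. -/
theorem le_hirschLength_of_independent (r : ℕ) : ∀ {A : Type u} [CommGroup A] (v : Fin r → A),
    (∀ c : Fin r → ℤ, ∏ i, v i ^ c i = 1 → c = 0) → (r : ℕ∞) ≤ hirschLength A := by
  induction r with
  | zero => intro A _ v _; simp
  | succ r ih =>
    intro A _ v hv
    have h0 : ¬ IsOfFinOrder (v 0) := by
      rw [isOfFinOrder_iff_pow_eq_one]
      rintro ⟨n, hn, h⟩
      have := congrFun (hv (fun i => if i = 0 then n else 0) (by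
        rw [Fin.prod_univ_succ]; simp [h])) 0
      simp at this
      omega
    rw [hirschLength_eq_quotient_add (Subgroup.zpowers (v 0)), hirschLength_zpowers h0]
    refine (show ((r + 1 : ℕ) : ℕ∞) = 1 + r by push_cast; rw [add_comm]).trans_le
      (add_le_add le_rfl ?_)
    refine ih (fun i => (v i.succ : A ⧸ Subgroup.zpowers (v 0))) fun c hc => ?_
    have hc' : ((∏ i, v i.succ ^ c i : A) : A ⧸ Subgroup.zpowers (v 0)) = 1 := by
      rw [← hc]
      exact map_prod (QuotientGroup.mk' (Subgroup.zpowers (v 0))) _ _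
    obtain ⟨k, hk⟩ := (QuotientGroup.eq_one_iff _).mp hc'
    have hk : v 0 ^ k = _ := hk
    -- A relation modulo `v 0` lifts to a relation in `A` in which `v 0` has exponent `-k`.
    have := hv (Fin.cons (-k) c) (by
      rw [Fin.prod_univ_succ]
      simp [← hk])
    funext i
    simpa using congrFun this i.succ

end HirschLength

/-! ### Virtual maps to ℤ and virtually abelian quotients. -/

section VirtuallyAbelianQuotient

/-- A group without nontrivial elements of finite order. -/
def TorsionFreeGroup (G : Type u) [Group G] : Prop :=
  ∀ g : G, g ≠ 1 → ¬ IsOfFinOrder g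

theorem TorsionFreeGroup.eq_one {G : Type u} [Group G] (h : TorsionFreeGroup G) {g : G} {n : ℕ}
    (hn : 0 < n) (hg : g ^ n = 1) : g = 1 := by
  by_contra h1
  exact h g h1 (isOfFinOrder_iff_pow_eq_one.mpr ⟨n, hn, hg⟩)

theorem TorsionFreeGroup.eq_zero_of_zpow {G : Type u} [Group G] (h : TorsionFreeGroup G) {g : G}
    (hg : g ≠ 1) {n : ℤ} (hn : g ^ n = 1) : n = 0 := by
  by_contra h0
  apply h g hg
  exact isOfFinOrder_iff_zpow_eq_one.mpr ⟨n, h0, hn⟩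

theorem TorsionFreeGroup.of_injective {G K : Type u} [Group G] [Group K] (h : TorsionFreeGroup G)
    (f : K →* G) (hf : Function.Injective f) : TorsionFreeGroup K := by
  intro g hg hfin
  refine h (f g) (fun h1 => hg (hf (h1.trans f.map_one.symm))) (f.isOfFinOrder hfin)

theorem TorsionFreeGroup.subgroup {G : Type u} [Group G] (h : TorsionFreeGroup G)
    (H : Subgroup G) : TorsionFreeGroup H :=
  h.of_injective H.subtype H.subtype_injective

theorem TorsionFreeGroup.subsingleton_of_hirschLength {G : Type u} [Group G]
    (h : TorsionFreeGroup G) (h0 : hirschLength G = 0) : Subsingleton G := by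
  refine subsingleton_of_forall_eq 1 fun g => ?_
  by_contra hg
  exact h g hg (isOfFinOrder_of_hirschLength_eq_zero h0 g)

theorem TorsionFreeGroup.one_le_hirschLength {G : Type u} [Group G]
    (h : TorsionFreeGroup G) {g : G} (hg : g ≠ 1) : 1 ≤ hirschLength G := by
  rw [← hirschLength_zpowers (h g hg)]
  exact hirschLength_subgroup_le _

/-- Some subgroup of finite index has a nontrivial homomorphism to `ℤ`. -/
def IsVirtuallyIndicable (G : Type u) [Group G] : Prop :=
  ∃ (H : Subgroup G) (_ : H.FiniteIndex) (φ : H →* Multiplicative ℤ), φ ≠ 1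

theorem IsVirtuallyIndicable.of_finiteIndex {G : Type u} [Group G] (N : Subgroup G)
    [N.FiniteIndex] (h : IsVirtuallyIndicable N) : IsVirtuallyIndicable G := by
  obtain ⟨H, hH, φ, hφ⟩ := h
  refine ⟨H.map N.subtype, ⟨?_⟩,
    φ.comp (H.equivMapOfInjective N.subtype N.subtype_injective).symm.toMonoidHom, ?_⟩
  · rw [Subgroup.index_map_subtype]
    exact mul_ne_zero Subgroup.FiniteIndex.index_ne_zero Subgroup.FiniteIndex.index_ne_zero
  · intro h
    apply hφ
    ext x
    have := DFunLike.congr_fun h (H.equivMapOfInjective N.subtype N.subtype_injective x)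
    simpa using this

theorem IsVirtuallyIndicable.of_surjective {G Q : Type u} [Group G] [Group Q] (f : G →* Q)
    (hf : Function.Surjective f) (h : IsVirtuallyIndicable Q) : IsVirtuallyIndicable G := by
  obtain ⟨H, hH, φ, hφ⟩ := h
  refine ⟨H.comap f, ⟨?_⟩, φ.comp (f.subgroupComap H), ?_⟩
  · rw [Subgroup.index_comap_of_surjective H hf]
    exact Subgroup.FiniteIndex.index_ne_zero
  · intro h
    apply hφ
    ext x
    obtain ⟨y, hy⟩ := hf x
    have := DFunLike.congr_fun h ⟨y, by rw [Subgroup.mem_comap, hy]; exact x.2⟩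
    have hx : f.subgroupComap H ⟨y, by rw [Subgroup.mem_comap, hy]; exact x.2⟩ = x :=
      Subtype.ext hy
    rw [MonoidHom.comp_apply, hx] at this
    rw [this]
    rfl

/-- In an extension, either the quotient is infinite and the map to ℤ is pulled back from it, or `N`
has finite index and is itself finitely generated and infinite. A finitely generated directed union
equals one of its members. -/
theorem HasHirschLength.isVirtuallyIndicable {G : Type u} [Group G] {n : ℕ∞}
    (h : HasHirschLength G n) : Group.FG G → Infinite G → IsVirtuallyIndicable G := by
  induction h with
  | of_finite G => exact fun _ hi => (hi.not_finite inferInstance).elim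
  | of_infinite_cyclic G =>
    intro _ _
    obtain ⟨g, hg⟩ := IsCyclic.exists_zpow_surjective (G := G)
    have hg0 : ¬ IsOfFinOrder g := by
      rw [← infinite_zpowers]
      have : (Subgroup.zpowers g : Set G) = Set.univ := Set.eq_univ_of_forall fun x => hg x
      rw [this]
      exact Set.infinite_univ
    have hinj : Function.Injective (zpowersHom G g) := by
      rw [injective_iff_map_eq_one]
      intro k hk
      by_contra h0
      exact hg0 (isOfFinOrder_iff_zpow_eq_one.mpr ⟨k.toAdd, h0, by simpa using hk⟩)
    let e : Multiplicative ℤ ≃* G := MulEquiv.ofBijective (zpowersHom G g)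
      ⟨hinj, fun x => (hg x).imp fun k hk => by rw [zpowersHom_apply]; exact hk⟩
    refine ⟨⊤, inferInstance, e.symm.toMonoidHom.comp (⊤ : Subgroup G).subtype, fun h => ?_⟩
    have := DFunLike.congr_fun h ⟨e (Multiplicative.ofAdd 1), Subgroup.mem_top _⟩
    simp at this
  | @of_extension G _ N _ p q hN hQ ihN ihQ =>
    intro hG hi
    rcases finite_or_infinite (G ⧸ N) with hf | hinf
    · have : N.FiniteIndex := Subgroup.finiteIndex_of_finite_quotient
      refine IsVirtuallyIndicable.of_finiteIndex N (ihN inferInstance ?_)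
      by_contra hfin
      rw [not_infinite_iff_finite] at hfin
      exact hi.not_finite
        (Finite.of_equiv _ (Subgroup.groupEquivQuotientProdSubgroup (s := N)).symm)
    · exact (ihQ inferInstance hinf).of_surjective _ (QuotientGroup.mk'_surjective N)
  | @of_directed_union G _ S hne hdir hsup F hS ih =>
    intro hG hi
    obtain ⟨A, hA, hle⟩ := exists_mem_of_fg_of_directed (MonoidHom.id G) hne hdir hsup
    obtain rfl : A = ⊤ := eq_top_iff.mpr fun x _ => hle x
    refine IsVirtuallyIndicable.of_finiteIndex ⊤ (ih ⊤ hA inferInstance ?_)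
    exact Infinite.of_surjective _ Subgroup.topEquiv.surjective

/-- The intersection of the kernels of all homomorphisms `H → ℤ`. -/
def integralKernel {G : Type u} [Group G] (H : Subgroup G) : Subgroup G where
  carrier := {x | ∃ hx : x ∈ H, ∀ φ : H →* Multiplicative ℤ, φ ⟨x, hx⟩ = 1}
  one_mem' := ⟨H.one_mem, fun φ => φ.map_one⟩
  mul_mem' := by
    rintro x y ⟨hx, hx'⟩ ⟨hy, hy'⟩
    refine ⟨H.mul_mem hx hy, fun φ => ?_⟩
    have := φ.map_mul ⟨x, hx⟩ ⟨y, hy⟩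
    rwa [hx', hy', one_mul] at this
  inv_mem' := by
    rintro x ⟨hx, hx'⟩
    refine ⟨H.inv_mem hx, fun φ => ?_⟩
    have := φ.map_inv ⟨x, hx⟩
    rwa [hx', inv_one] at this

/-- Conjugation by elements of `G` permutes the homomorphisms from `H` to ℤ. -/
theorem integralKernel_normal {G : Type u} [Group G] (H : Subgroup G) [hH : H.Normal] :
    (integralKernel H).Normal := by
  refine ⟨?_⟩
  rintro x ⟨hx, hx'⟩ g
  refine ⟨hH.conj_mem x hx g, fun φ => ?_⟩
  exact hx' (φ.comp (MulAut.conjNormal g).toMonoidHom)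

/-- Take a normal subgroup `H` of finite index inside the subgroup that maps to ℤ, and divide by its
integral kernel: the homomorphisms to ℤ separate the elements of what remains of `H`, which is
therefore abelian and torsion-free. -/
theorem exists_virtually_abelian_quotient {G : Type u} [Group G] [Group.FG G] [Infinite G]
    (h : hirschLength G ≠ ⊤) :
    ∃ N : Subgroup G, ∃ _ : N.Normal, ∃ V : Subgroup (G ⧸ N), V.Normal ∧ V.FiniteIndex ∧
      Group.FG V ∧ (∀ x ∈ V, ∀ y ∈ V, x * y = y * x) ∧ TorsionFreeGroup V ∧ V ≠ ⊥ := by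
  obtain ⟨H₁, hH₁, φ, hφ⟩ :=
    (hasHirschLength_of_ne_top h).isVirtuallyIndicable inferInstance inferInstance
  set H := H₁.normalCore with hH
  have hHn : H.Normal := H₁.normalCore_normal
  have hHi : H.FiniteIndex := inferInstance
  have hHle : H ≤ H₁ := H₁.normalCore_le
  have hN := integralKernel_normal H
  refine ⟨integralKernel H, hN, H.map (QuotientGroup.mk' _),
    hHn.map _ (QuotientGroup.mk'_surjective _), ?_, ?_, ?_, ?_, ?_⟩
  · have : Finite (G ⧸ H) := inferInstance
    refine ⟨?_⟩
    have h1 := Subgroup.index_map_dvd H (QuotientGroup.mk'_surjective (integralKernel H))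
    exact fun h0 => hHi.index_ne_zero (Nat.eq_zero_of_zero_dvd (h0 ▸ h1))
  · have : Group.FG H := inferInstance
    exact Group.fg_of_surjective ((QuotientGroup.mk' (integralKernel H)).subgroupMap_surjective H)
  · rintro _ ⟨x, hx, rfl⟩ _ ⟨y, hy, rfl⟩
    rw [← map_mul, ← map_mul]
    refine QuotientGroup.eq.mpr ⟨H.mul_mem (H.inv_mem (H.mul_mem hx hy)) (H.mul_mem hy hx), ?_⟩
    intro ψ
    have : ψ ((⟨x, hx⟩ * ⟨y, hy⟩)⁻¹ * (⟨y, hy⟩ * ⟨x, hx⟩)) = 1 := by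
      rw [map_mul, map_inv, map_mul, map_mul, mul_comm (ψ ⟨y, hy⟩)]
      exact inv_mul_cancel _
    exact this
  · rintro ⟨_, ⟨x, hx, rfl⟩⟩ hx1 hfin
    obtain ⟨n, hn, hxn⟩ := isOfFinOrder_iff_pow_eq_one.mp hfin
    apply hx1
    have hxn : QuotientGroup.mk' (integralKernel H) (x ^ n) = 1 := by
      rw [map_pow]
      exact congrArg Subtype.val hxn
    obtain ⟨hxn', h1⟩ := (QuotientGroup.eq_one_iff _).mp hxn
    refine Subtype.ext ((QuotientGroup.eq_one_iff _).mpr ⟨hx, fun ψ => ?_⟩)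
    have h2 := h1 ψ
    have h3 : (⟨x ^ n, hxn'⟩ : H) = ⟨x, hx⟩ ^ n := rfl
    rw [h3, map_pow] at h2
    exact (pow_eq_one_iff_left hn.ne').mp h2
  -- If `H` became trivial, `φ` would kill a positive power of every `x`, and hence `x`, because ℤ
  -- is torsion-free.
  · intro hbot
    apply hφ
    ext x
    obtain ⟨n, hn, -, hxn⟩ := Subgroup.exists_pow_mem_of_index_ne_zero hHi.index_ne_zero (x : G)
    have h1 : QuotientGroup.mk' (integralKernel H) ((x : G) ^ n) = 1 := by
      rw [← Subgroup.mem_bot, ← hbot]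
      exact ⟨_, hxn, rfl⟩
    obtain ⟨h2, h3⟩ := (QuotientGroup.eq_one_iff _).mp h1
    have h4 := h3 (φ.comp (Subgroup.inclusion hHle))
    have h5 : φ (x ^ n) = 1 := h4
    rw [map_pow] at h5
    rw [(pow_eq_one_iff_left hn.ne').mp h5]
    rfl

end VirtuallyAbelianQuotient

/-! ### Heisenberg subgroups and abelian radicals. -/

section Heisenberg

/-- In the subgroup generated by `x` and `y` the commutator is central of infinite order. If `a ^ i
* b ^ j` is central, conjugating with `b` and `a` gives `⁅a, b⁆ ^ i = 1` and `⁅a, b⁆ ^ j = 1`, so `i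
= j = 0`. Thus the centre contributes 1 and the quotient 2. -/
theorem TorsionFreeGroup.three_le_hirschLength {G : Type u} [Group G] (htf : TorsionFreeGroup G)
    {x y : G} (hz : ⁅x, y⁆ ≠ 1) (hzx : Commute ⁅x, y⁆ x) (hzy : Commute ⁅x, y⁆ y) :
    3 ≤ hirschLength G := by
  set K := Subgroup.closure {x, y} with hK
  have hxK : x ∈ K := Subgroup.subset_closure (by simp)
  have hyK : y ∈ K := Subgroup.subset_closure (by simp)
  set a : K := ⟨x, hxK⟩
  set b : K := ⟨y, hyK⟩
  have key : ∀ k : K, (∀ g : K, (g = a ∨ g = b) → k * g = g * k) → k ∈ Subgroup.center K := by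
    intro k hk
    rw [Subgroup.mem_center_iff]
    rintro ⟨g, hg⟩
    have : g ∈ Subgroup.centralizer {(k : G)} := by
      refine (Subgroup.closure_le _).mpr ?_ hg
      intro g hg'
      rw [SetLike.mem_coe, Subgroup.mem_centralizer_singleton_iff]
      rcases hg' with rfl | rfl
      · exact (congrArg Subtype.val (hk a (Or.inl rfl))).symm
      · exact (congrArg Subtype.val (hk b (Or.inr rfl))).symm
    exact Subtype.ext (Subgroup.mem_centralizer_singleton_iff.mp this)
  have hzc : ⁅a, b⁆ ∈ Subgroup.center K := by
    refine key _ ?_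
    rintro g (rfl | rfl)
    · exact Subtype.ext hzx
    · exact Subtype.ext hzy
  have hz1 : ⁅a, b⁆ ≠ 1 := fun h => hz (congrArg Subtype.val h)
  have htK : TorsionFreeGroup K := htf.subgroup K
  have hc1 : 1 ≤ hirschLength (Subgroup.center K) :=
    (htK.subgroup _).one_le_hirschLength (g := ⟨_, hzc⟩) fun h => hz1 (congrArg Subtype.val h)
  have hab : a * b = ⁅a, b⁆ * (b * a) := by rw [commutatorElement_def]; group
  have hcomm : ∀ p q : K ⧸ Subgroup.center K, p * q = q * p := by
    have hgen : ∀ w : K, ((w = a ∨ w = b) → ∀ q : K, (q = a ∨ q = b) →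
        (w : K ⧸ Subgroup.center K) * q = q * w) := by
      have : (a : K ⧸ Subgroup.center K) * b = b * a := by
        rw [← QuotientGroup.mk_mul, ← QuotientGroup.mk_mul, hab, QuotientGroup.mk_mul,
          (QuotientGroup.eq_one_iff _).mpr hzc, one_mul]
      rintro w (rfl | rfl) q (rfl | rfl)
      · rfl
      · exact this
      · exact this.symm
      · rfl
    have hcl : Subgroup.closure {a, b} = (⊤ : Subgroup K) := by
      rw [eq_top_iff, ← Subgroup.map_subtype_le_map_subtype]
      rw [MonoidHom.map_closure]
      rintro _ ⟨⟨g, hg⟩, -, rfl⟩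
      refine (Subgroup.closure_mono ?_ : K ≤ _) hg
      rintro g (rfl | rfl)
      · exact ⟨a, by simp, rfl⟩
      · exact ⟨b, by simp, rfl⟩
    have h1 : ∀ w : K, ∀ q : K, (q = a ∨ q = b) → (w : K ⧸ Subgroup.center K) * q = q * w := by
      intro w q hq
      have hw : w ∈ Subgroup.closure {a, b} := hcl ▸ Subgroup.mem_top w
      induction hw using Subgroup.closure_induction with
      | mem w hw => exact hgen w hw q hq
      | one => simp
      | mul u v _ _ hu hv =>
        exact Commute.mul_left (a := (u : K ⧸ Subgroup.center K)) hu hv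
      | inv u _ hu => exact Commute.inv_left (a := (u : K ⧸ Subgroup.center K)) hu
    intro p q
    obtain ⟨p, rfl⟩ := QuotientGroup.mk_surjective p
    obtain ⟨w, rfl⟩ := QuotientGroup.mk_surjective q
    have hw : w ∈ Subgroup.closure {a, b} := hcl ▸ Subgroup.mem_top w
    induction hw using Subgroup.closure_induction with
    | mem w hw => exact h1 p w hw
    | one => simp
    | mul u v _ _ hu hv =>
      exact Commute.mul_right (a := (p : K ⧸ Subgroup.center K)) hu hv
    | inv u _ hu => exact Commute.inv_right (a := (p : K ⧸ Subgroup.center K)) hu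
  let _ : CommGroup (K ⧸ Subgroup.center K) := { mul_comm := hcomm }
  have hconj : ∀ i : ℤ, b * a ^ i * b⁻¹ = (⁅a, b⁆ ^ i)⁻¹ * a ^ i := by
    intro i
    have h1 : b * a * b⁻¹ = ⁅a, b⁆⁻¹ * a := by
      rw [commutatorElement_def]; group
    rw [← conj_zpow, h1]
    have hcz : Commute ⁅a, b⁆⁻¹ a :=
      (Commute.inv_left ((Subgroup.mem_center_iff.mp hzc a).symm : ⁅a, b⁆ * a = a * ⁅a, b⁆))
    rw [hcz.mul_zpow, inv_zpow]
  have hconj' : ∀ j : ℤ, a * b ^ j * a⁻¹ = ⁅a, b⁆ ^ j * b ^ j := by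
    intro i
    have h1 : a * b * a⁻¹ = ⁅a, b⁆ * b := by
      rw [commutatorElement_def]; group
    rw [← conj_zpow, h1]
    have hcz : Commute ⁅a, b⁆ b := (Subgroup.mem_center_iff.mp hzc b).symm
    rw [hcz.mul_zpow]
  have h2 : 2 ≤ hirschLength (K ⧸ Subgroup.center K) := by
    refine le_hirschLength_of_independent 2 ![(a : K ⧸ Subgroup.center K), b] fun c hc => ?_
    rw [Fin.prod_univ_two] at hc
    have hmem : a ^ c 0 * b ^ c 1 ∈ Subgroup.center K := (QuotientGroup.eq_one_iff _).mp hc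
    have e1 := Subgroup.mem_center_iff.mp hmem b
    have e2 := Subgroup.mem_center_iff.mp hmem a
    have f1 : ⁅a, b⁆ ^ c 0 = 1 := by
      have h3 : b * a ^ c 0 * b⁻¹ = a ^ c 0 := by
        have : b * a ^ c 0 * b⁻¹ = b * (a ^ c 0 * b ^ c 1) * (b ^ c 1)⁻¹ * b⁻¹ := by group
        rw [this, e1]
        group
      rw [hconj] at h3
      simpa using h3
    have f2 : ⁅a, b⁆ ^ c 1 = 1 := by
      have h3 : a * b ^ c 1 * a⁻¹ = b ^ c 1 := by
        have : a * b ^ c 1 * a⁻¹ = (a ^ c 0)⁻¹ * (a * (a ^ c 0 * b ^ c 1)) * a⁻¹ := by group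
        rw [this, e2]
        group
      rw [hconj'] at h3
      simpa using h3
    funext i
    fin_cases i
    · exact htK.eq_zero_of_zpow hz1 f1
    · exact htK.eq_zero_of_zpow hz1 f2
  calc (3 : ℕ∞) = 1 + 2 := by norm_num
    _ ≤ hirschLength (Subgroup.center K) + hirschLength (K ⧸ Subgroup.center K) :=
      add_le_add hc1 h2
    _ = hirschLength K := (hirschLength_eq_quotient_add _).symm
    _ ≤ _ := hirschLength_subgroup_le K

theorem commute_of_isNilpotent {G : Type u} [Group G] [Group.IsNilpotent G]
    (htf : TorsionFreeGroup G) (hh : hirschLength G ≤ 2) (a b : G) : a * b = b * a := by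
  -- A noncentral element of the second centre would have a nontrivial central commutator with some
  -- `y`, forcing length 3. So the upper central series is already stationary at the centre.
  have h21 : Subgroup.upperCentralSeries G 2 ≤ Subgroup.upperCentralSeries G 1 := by
    intro x hx
    rw [Subgroup.upperCentralSeries_one, Subgroup.mem_center_iff]
    intro y
    by_contra hne
    have hz := (Subgroup.mem_upperCentralSeries_succ_iff (n := 1)).mp hx y
    rw [Subgroup.upperCentralSeries_one, Subgroup.mem_center_iff] at hz
    have : 3 ≤ hirschLength G := htf.three_le_hirschLength (x := x) (y := y)
      (fun h => hne (commutatorElement_eq_one_iff_mul_comm.mp h).symm) (hz x).symm (hz y).symm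
    exact absurd (this.trans hh) (by decide)
  have hall : ∀ n, Subgroup.upperCentralSeries G (n + 1) ≤ Subgroup.upperCentralSeries G 1 := by
    intro n
    induction n with
    | zero => exact le_rfl
    | succ n ih =>
      refine le_trans ?_ h21
      intro x hx
      rw [Subgroup.mem_upperCentralSeries_succ_iff] at hx ⊢
      exact fun y => ih (hx y)
  obtain ⟨n, hn⟩ := Group.IsNilpotent.nilpotent G
  have : b ∈ Subgroup.upperCentralSeries G 1 := by
    refine hall n (Subgroup.upperCentralSeries_mono (G := G) (Nat.le_succ n) ?_)
    rw [hn]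
    exact Subgroup.mem_top _
  rw [Subgroup.upperCentralSeries_one, Subgroup.mem_center_iff] at this
  exact this a

theorem commute_of_isLocallyNilpotentGroup {G : Type u} [Group G] (h : IsLocallyNilpotentGroup G)
    (htf : TorsionFreeGroup G) (hh : hirschLength G ≤ 2) (a b : G) : a * b = b * a := by
  have hn := h (Subgroup.closure {a, b}) (by
    classical exact ⟨{a, b}, by simp⟩)
  have := commute_of_isNilpotent (htf.subgroup _) ((hirschLength_subgroup_le _).trans hh)
    (⟨a, Subgroup.subset_closure (by simp)⟩ : Subgroup.closure {a, b})
    ⟨b, Subgroup.subset_closure (by simp)⟩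
  exact congrArg Subtype.val this

instance hirschPlotkinRadical_normal (G : Type u) [Group G] : (hirschPlotkinRadical G).Normal :=
  Subgroup.sSup_normal _ fun _ h => h.1

/-- Local nilpotency of the join is not needed. The generating normal subgroups are abelian, and for
`x ∈ M`, `y ∈ N` the commutator lies in `M ∩ N`, so it commutes with both; a nontrivial one would
force length 3. -/
theorem commute_hirschPlotkinRadical {G : Type u} [Group G] (htf : TorsionFreeGroup G)
    (hh : hirschLength (hirschPlotkinRadical G) ≤ 2) :
    ∀ x ∈ hirschPlotkinRadical G, ∀ y ∈ hirschPlotkinRadical G, x * y = y * x := by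
  set 𝒩 := {N : Subgroup G | N.Normal ∧ IsLocallyNilpotentGroup N} with h𝒩
  have hle : ∀ N ∈ 𝒩, N ≤ hirschPlotkinRadical G := fun N hN => le_sSup hN
  have hab : ∀ N ∈ 𝒩, ∀ x ∈ N, ∀ y ∈ N, x * y = y * x := by
    intro N hN x hx y hy
    exact congrArg Subtype.val (commute_of_isLocallyNilpotentGroup hN.2 (htf.subgroup N)
      ((hirschLength_mono (hle N hN)).trans hh) ⟨x, hx⟩ ⟨y, hy⟩)
  have hcomm : ∀ M ∈ 𝒩, ∀ N ∈ 𝒩, ∀ x ∈ M, ∀ y ∈ N, x * y = y * x := by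
    intro M hM N hN x hx y hy
    have hzM : ⁅x, y⁆ ∈ M := by
      have := M.mul_mem hx (hM.1.conj_mem _ (M.inv_mem hx) y)
      simpa [commutatorElement_def, mul_assoc] using this
    have hzN : ⁅x, y⁆ ∈ N := by
      have := N.mul_mem (hN.1.conj_mem _ hy x) (N.inv_mem hy)
      simpa [commutatorElement_def, mul_assoc] using this
    by_contra hne
    have := (htf.subgroup (hirschPlotkinRadical G)).three_le_hirschLength
      (x := ⟨x, hle M hM hx⟩) (y := ⟨y, hle N hN hy⟩)
      (fun h => hne (commutatorElement_eq_one_iff_mul_comm.mp (congrArg Subtype.val h)))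
      (Subtype.ext (hab M hM _ hzM _ hx)) (Subtype.ext (hab N hN _ hzN _ hy))
    exact absurd (this.trans hh) (by decide)
  have hcl : hirschPlotkinRadical G = Subgroup.closure (⋃ N ∈ 𝒩, (N : Set G)) := by
    rw [hirschPlotkinRadical, sSup_eq_iSup]
    simp_rw [Subgroup.closure_iUnion, Subgroup.closure_eq]
    rfl
  intro x hx y hy
  rw [hcl] at hx hy
  have h1 : ∀ N ∈ 𝒩, ∀ n ∈ N, n * y = y * n := by
    intro N hN n hn
    induction hy using Subgroup.closure_induction with
    | mem y hy =>
      obtain ⟨M, hM, hy⟩ := Set.mem_iUnion₂.mp hy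
      exact hcomm N hN M hM n hn y hy
    | one => simp
    | mul u v _ _ hu hv => exact Commute.mul_right (a := n) hu hv
    | inv u _ hu => exact Commute.inv_right (a := n) hu
  induction hx using Subgroup.closure_induction with
  | mem x hx =>
    obtain ⟨M, hM, hx⟩ := Set.mem_iUnion₂.mp hx
    exact h1 M hM x hx
  | one => simp
  | mul u v _ _ hu hv => exact Commute.mul_left (a := u) hu hv
  | inv u _ hu => exact Commute.inv_left (a := u) hu

end Heisenberg

/-! ### Automorphisms of finite order of a lattice. -/

section FiniteLinearGroups

variable {M : Type*} [AddCommGroup M]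

/-- The endomorphism `δ` takes values in `m M`. -/
def DividesEnd (m : ℤ) (δ : Module.End ℤ M) : Prop := ∀ v, ∃ w, δ v = m • w

theorem eq_zero_of_forall_two_pow_dvd [Module.Finite ℤ M] [Module.Free ℤ M] {x : M}
    (h : ∀ k : ℕ, ∃ w : M, x = (2 ^ k : ℤ) • w) : x = 0 := by
  let b := Module.Free.chooseBasis ℤ M
  apply b.repr.injective
  ext i
  rw [map_zero, Finsupp.zero_apply]
  by_contra h0
  obtain ⟨k, hk⟩ := (Int.finiteMultiplicity_iff (a := 2) (b := b.repr x i)).mpr ⟨by decide, h0⟩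
  obtain ⟨w, hw⟩ := h (k + 1)
  apply hk
  rw [hw, map_smul, Finsupp.smul_apply]
  exact ⟨_, rfl⟩

theorem exists_one_add_pow_eq (δ : Module.End ℤ M) (n : ℕ) :
    ∃ E : Module.End ℤ M, (1 + δ) ^ n = 1 + n • δ + δ * δ * E := by
  induction n with
  | zero => exact ⟨0, by simp⟩
  | succ n ih =>
    obtain ⟨E, hE⟩ := ih
    refine ⟨n • 1 + E + E * δ, ?_⟩
    rw [pow_succ, hE, add_smul, one_smul]
    simp only [mul_add, add_mul, mul_one, one_mul, mul_smul_comm, smul_mul_assoc, mul_assoc]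
    abel

/-- Minkowski's argument: for `ψ = 1 + δ` the equation `ψ ^ p = 1` makes `p • δ` a multiple of `δ *
δ`. So if `2 ^ s` divides `δ`, then `2 ^ (2 * s)` divides `p • δ`, and for `s ≥ 2` this improves the
divisibility of `δ`. The modulus 2 would not do, as `-1` shows. -/
theorem eq_one_of_prime_pow_eq_one [Module.Finite ℤ M] [Module.Free ℤ M] {ψ : Module.End ℤ M}
    {p : ℕ} (hp : p.Prime) (hψ : ψ ^ p = 1) (h4 : DividesEnd 4 (ψ - 1)) : ψ = 1 := by
  set δ := ψ - 1 with hδ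
  have hψδ : ψ = 1 + δ := by rw [hδ]; abel
  obtain ⟨E, hE⟩ := exists_one_add_pow_eq δ p
  rw [← hψδ, hψ] at hE
  have hpδ : ∀ v, p • δ v = -(δ (δ (E v))) := by
    intro v
    have h1 : p • δ + δ * δ * E = 0 := by
      have h2 : (1 : Module.End ℤ M) + (p • δ + δ * δ * E) = 1 + 0 := by
        rw [← add_assoc, ← hE, add_zero]
      exact add_left_cancel h2
    have := LinearMap.congr_fun h1 v
    exact eq_neg_of_add_eq_zero_left this
  have hk : ∀ k : ℕ, DividesEnd (2 ^ (k + 2)) δ := by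
    intro k
    induction k with
    | zero => simpa using h4
    | succ k ih =>
      intro v
      obtain ⟨w, hw⟩ := ih (E v)
      obtain ⟨u, hu⟩ := ih w
      have h1 : (p : ℤ) • δ v = (2 ^ (k + 2) * 2 ^ (k + 2) : ℤ) • (-u) := by
        rw [natCast_zsmul, hpδ v, hw, map_smul, hu, mul_smul, smul_neg, smul_neg]
      rcases hp.eq_two_or_odd' with rfl | hodd
      -- For `p = 2` one factor is lost, leaving the exponent `2 * (k + 2) - 1 = (k + 3) + k`.
      · refine ⟨(2 ^ k : ℤ) • (-u), ?_⟩
        have h2 : (2 : ℤ) • δ v = (2 : ℤ) • ((2 ^ (k + 1 + 2) : ℤ) • (2 ^ k : ℤ) • (-u)) := by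
          rw [smul_smul, smul_smul, show (2 * 2 ^ (k + 1 + 2) * 2 ^ k : ℤ) =
            2 ^ (k + 2) * 2 ^ (k + 2) by ring]
          exact h1
        exact smul_right_injective M (two_ne_zero (α := ℤ)) h2
      · have hcop : IsCoprime (p : ℤ) (2 ^ (k + 2) * 2 ^ (k + 2)) := by
          have : IsCoprime (p : ℤ) 2 := by
            rw [show (2 : ℤ) = (2 : ℕ) from rfl, Nat.isCoprime_iff_coprime]
            exact hodd.coprime_two_right
          exact (this.pow_right).mul_right this.pow_right
        obtain ⟨a, b, hab⟩ := hcop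
        refine ⟨(2 ^ (k + 1) : ℤ) • (a • (-u) + b • δ v), ?_⟩
        calc δ v = (a * p + b * (2 ^ (k + 2) * 2 ^ (k + 2)) : ℤ) • δ v := by
              rw [hab, one_smul]
          _ = a • (p : ℤ) • δ v + (b * (2 ^ (k + 2) * 2 ^ (k + 2)) : ℤ) • δ v := by
              rw [add_smul, mul_smul]
          _ = _ := by
              rw [h1, smul_smul, smul_smul, smul_add, smul_smul, smul_smul]
              congr 2 <;> ring
  have : δ = 0 := by
    ext v
    refine eq_zero_of_forall_two_pow_dvd fun k => ?_
    obtain ⟨w, hw⟩ := hk k v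
    exact ⟨(4 : ℤ) • w, by rw [hw, smul_smul, pow_add]; norm_num⟩
  rw [hψδ, this, add_zero]

theorem DividesEnd.pow_sub_one {m : ℤ} {φ : Module.End ℤ M} (h : DividesEnd m (φ - 1)) (n : ℕ) :
    DividesEnd m (φ ^ n - 1) := by
  induction n with
  | zero => exact fun v => ⟨0, by simp⟩
  | succ n ih =>
    intro v
    obtain ⟨w, hw⟩ := ih (φ v)
    obtain ⟨u, hu⟩ := h v
    refine ⟨w + u, ?_⟩
    have : φ ^ (n + 1) - 1 = (φ ^ n - 1) * φ + (φ - 1) := by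
      rw [pow_succ, sub_mul, one_mul]; abel
    rw [this, LinearMap.add_apply, Module.End.mul_apply, hw, hu, smul_add]

/-- An automorphism of finite order of a lattice which is trivial modulo `4` is trivial. -/
theorem eq_one_of_pow_eq_one_of_dividesEnd_four [Module.Finite ℤ M] [Module.Free ℤ M]
    {φ : Module.End ℤ M} {n : ℕ} (hn : 0 < n) (hφ : φ ^ n = 1) (h4 : DividesEnd 4 (φ - 1)) :
    φ = 1 := by
  induction n using Nat.recOnMul generalizing φ with
  | zero => exact absurd hn (lt_irrefl 0)
  | one => simpa using hφ
  | prime p hp => exact eq_one_of_prime_pow_eq_one hp hφ h4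
  | mul a b iha ihb =>
    have ha : 0 < a := Nat.pos_of_mul_pos_right hn
    have hb : 0 < b := Nat.pos_of_mul_pos_left hn
    rw [pow_mul] at hφ
    exact iha ha (ihb hb hφ (h4.pow_sub_one a)) h4

/-- Since `φ ^ 2 - 1 = (φ - 1) ^ 2 + 2 (φ - 1)`, the square is trivial modulo 4. -/
theorem sq_eq_one_of_dividesEnd_two [Module.Finite ℤ M] [Module.Free ℤ M]
    {φ : Module.End ℤ M} {n : ℕ} (hn : 0 < n) (hφ : φ ^ n = 1) (h2 : DividesEnd 2 (φ - 1)) :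
    φ ^ 2 = 1 := by
  refine eq_one_of_pow_eq_one_of_dividesEnd_four hn (by rw [← pow_mul, mul_comm, pow_mul, hφ, one_pow]) ?_
  intro v
  obtain ⟨w, hw⟩ := h2 v
  obtain ⟨u, hu⟩ := h2 w
  refine ⟨w + u, ?_⟩
  have e : φ ^ 2 - 1 = (φ - 1) * (φ - 1) + (φ - 1) + (φ - 1) := by
    rw [sq, sub_mul, mul_sub]; simp only [one_mul, mul_one]; abel
  rw [e, LinearMap.add_apply, LinearMap.add_apply, Module.End.mul_apply, hw, map_smul, hu]
  module

open Polynomial in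
/-- A lattice of rank at most `3` has no automorphism of order `7`. -/
theorem eq_one_of_pow_seven_eq_one [Module.Finite ℤ M] [Module.Free ℤ M]
    (hr : Module.finrank ℤ M ≤ 3) {φ : Module.End ℤ M} (hφ : φ ^ 7 = 1) : φ = 1 := by
  let b := Module.finBasis ℤ M
  set A := LinearMap.toMatrixAlgEquiv b φ with hA
  set B := A.map (Int.castRingHom ℚ) with hB
  have hB7 : B ^ 7 = 1 := by
    have h1 : A ^ 7 = 1 := by rw [hA, ← map_pow, hφ, map_one]
    rw [hB, ← RingHom.mapMatrix_apply, ← map_pow, h1, map_one]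
  -- The seventh cyclotomic polynomial is irreducible of degree 6, too large to divide a minimal
  -- polynomial of degree at most 3; only the factor `X - 1` survives.
  have hmin : minpoly ℚ B ∣ (X - 1) * cyclotomic 7 ℚ := by
    have : Fact (Nat.Prime 7) := ⟨by norm_num⟩
    rw [mul_comm, cyclotomic_prime_mul_X_sub_one ℚ 7]
    exact minpoly.dvd _ _ (by simp [hB7])
  have hdeg : (minpoly ℚ B).natDegree ≤ 3 := by
    refine (natDegree_le_of_dvd (Matrix.minpoly_dvd_charpoly B) (Matrix.charpoly_monic B).ne_zero).trans ?_
    rw [Matrix.charpoly_natDegree_eq_dim, Fintype.card_fin]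
    exact hr
  have hirr : Irreducible (cyclotomic 7 ℚ) := cyclotomic.irreducible_rat (by norm_num)
  have hmin0 : minpoly ℚ B ≠ 0 := minpoly.ne_zero (Matrix.isIntegral B)
  have hcop : IsCoprime (cyclotomic 7 ℚ) (minpoly ℚ B) := by
    rw [hirr.coprime_iff_not_dvd]
    intro hd
    have := natDegree_le_of_dvd hd hmin0
    rw [natDegree_cyclotomic, Nat.totient_prime (by norm_num)] at this
    omega
  have h1 : minpoly ℚ B ∣ X - 1 := hcop.symm.dvd_of_dvd_mul_right hmin
  have hB1 : B = 1 := by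
    have := (minpoly.dvd_iff (A := ℚ)).mp h1
    simpa [sub_eq_zero] using this
  have hA1 : A = 1 := by
    have hinj : Function.Injective (fun C : Matrix (Fin (Module.finrank ℤ M)) (Fin (Module.finrank ℤ M)) ℤ =>
         C.map (Int.castRingHom ℚ)) :=
      Matrix.map_injective (RingHom.injective_int (Int.castRingHom ℚ))
    apply hinj
    change B = (1 : Matrix _ _ ℤ).map (Int.castRingHom ℚ)
    rw [hB1, Matrix.map_one _ (map_zero _) (map_one _)]
  exact (LinearMap.toMatrixAlgEquiv b).injective (hA1.trans (map_one _).symm)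

theorem card_quotient_le [Module.Finite ℤ M] [Module.Free ℤ M] (m : ℕ) (hm : 0 < m)
    (P : Submodule ℤ M) (hP : ∀ v, (m : ℤ) • v ∈ P) :
    Finite (M ⧸ P) ∧ Nat.card (M ⧸ P) ≤ m ^ Module.finrank ℤ M := by
  have : NeZero m := ⟨hm.ne'⟩
  let b := Module.finBasis ℤ M
  let f : (Fin (Module.finrank ℤ M) → Fin m) → M ⧸ P := fun c =>
    Submodule.Quotient.mk (∑ i, ((c i : ℕ) : ℤ) • b i)
  have hf : Function.Surjective f := by
    intro x
    obtain ⟨x, rfl⟩ := Submodule.Quotient.mk_surjective P x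
    refine ⟨fun i => ⟨(b.repr x i % m).toNat, ?_⟩, ?_⟩
    · have h1 := Int.emod_nonneg (b.repr x i) (Int.natCast_ne_zero.mpr hm.ne')
      have h2 := Int.emod_lt_of_pos (b.repr x i) (Int.natCast_pos.mpr hm)
      omega
    · refine (Submodule.Quotient.eq P).mpr ?_
      have hx : ∀ c : Fin (Module.finrank ℤ M) → ℤ,
          ∑ i, c i • b i - x = ∑ i, (c i • b i - b.repr x i • b i) := fun c => by
        rw [Finset.sum_sub_distrib, b.sum_repr]
      rw [hx]
      refine Submodule.sum_mem _ fun i _ => ?_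
      have h1 := Int.emod_nonneg (b.repr x i) (Int.natCast_ne_zero.mpr hm.ne')
      have h3 : (((b.repr x i % m).toNat : ℕ) : ℤ) = b.repr x i % m := Int.toNat_of_nonneg h1
      dsimp only
      rw [h3, ← sub_smul]
      have h2 : b.repr x i % m - b.repr x i = m * (-(b.repr x i / m)) := by
        have := Int.emod_add_mul_ediv (b.repr x i) m
        linarith
      rw [h2, mul_smul]
      exact hP _
  refine ⟨Finite.of_surjective f hf, (Nat.card_le_card_of_surjective f hf).trans ?_⟩
  simp

/-- The order of a finite group acting faithfully on a lattice is bounded in terms of the rank. -/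
theorem card_le_of_injective_end [Module.Finite ℤ M] [Module.Free ℤ M] {F : Type*} [Group F]
    [Finite F] (φ : F →* Module.End ℤ M) (hφ : Function.Injective φ) :
    Nat.card F ≤ (4 ^ Module.finrank ℤ M) ^ (4 ^ Module.finrank ℤ M) := by
  -- The action on `M / 4M` stays faithful, so the group embeds in the self-maps of a set with at
  -- most `4 ^ rank` elements.
  let P : Submodule ℤ M := LinearMap.range ((4 : ℤ) • (LinearMap.id : M →ₗ[ℤ] M))
  have hP : ∀ v, ((4 : ℕ) : ℤ) • v ∈ P := fun v => ⟨v, rfl⟩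
  obtain ⟨h1, h2⟩ := card_quotient_le 4 (by norm_num) P hP
  have hle : ∀ g, P ≤ P.comap (φ g) := by
    rintro g _ ⟨v, rfl⟩
    exact ⟨φ g v, by simp⟩
  let f : F → (M ⧸ P → M ⧸ P) := fun g => P.mapQ P (φ g) (hle g)
  have hf : Function.Injective f := by
    intro g g' hgg
    have hdiv : DividesEnd 4 (φ (g'⁻¹ * g) - 1) := by
      intro v
      have h3 := congrFun hgg (Submodule.Quotient.mk v)
      have h4 : φ g v - φ g' v ∈ P := (Submodule.Quotient.eq P).mp h3
      have h5 := hle g'⁻¹ h4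
      obtain ⟨w, hw⟩ := h5
      refine ⟨w, ?_⟩
      have h6 : φ g'⁻¹ (φ g' v) = v := by
        rw [← Module.End.mul_apply, ← map_mul, inv_mul_cancel, map_one, Module.End.one_apply]
      have h7 : φ (g'⁻¹ * g) v - v = (4 : ℤ) • w := by
        have hw : (4 : ℤ) • w = φ g'⁻¹ (φ g v - φ g' v) := hw
        rw [hw, map_mul, Module.End.mul_apply, map_sub, h6]
      exact h7
    have h8 : φ (g'⁻¹ * g) = 1 := by
      refine eq_one_of_pow_eq_one_of_dividesEnd_four (n := Nat.card F) Nat.card_pos ?_ hdiv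
      rw [← map_pow, pow_card_eq_one', map_one]
    have h9 := hφ (h8.trans (map_one φ).symm)
    exact (inv_mul_eq_one.mp h9).symm
  calc Nat.card F ≤ Nat.card (M ⧸ P → M ⧸ P) := Nat.card_le_card_of_injective f hf
    _ = Nat.card (M ⧸ P) ^ Nat.card (M ⧸ P) := by rw [Nat.card_fun]
    _ ≤ (4 ^ Module.finrank ℤ M) ^ Nat.card (M ⧸ P) := Nat.pow_le_pow_left h2 _
    _ ≤ _ := Nat.pow_le_pow_right (by positivity) h2

end FiniteLinearGroups

/-! ### Actions on at most three points. -/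

section SmallActions

/-- The permutations embed in `S₃`, whose derived subgroup lies in the abelian group `A₃`. -/
theorem derivedSeries_two_perm_eq_bot {X : Type*} [Finite X] (hX : Nat.card X ≤ 3) :
    derivedSeries (Equiv.Perm X) 2 = ⊥ := by
  have h3 : derivedSeries (Equiv.Perm (Fin 3)) 2 = ⊥ := by
    have h1 : derivedSeries (Equiv.Perm (Fin 3)) 1 ≤ alternatingGroup (Fin 3) := by
      rw [derivedSeries_one]
      exact Abelianization.commutator_subset_ker Equiv.Perm.sign
    rw [derivedSeries_succ, eq_bot_iff, Subgroup.commutator_le]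
    intro g hg k hk
    have hc : ∀ g k : Equiv.Perm (Fin 3), Equiv.Perm.sign g = 1 → Equiv.Perm.sign k = 1 →
        g * k = k * g := by decide
    rw [Subgroup.mem_bot, commutatorElement_eq_one_iff_mul_comm]
    exact hc g k (Equiv.Perm.mem_alternatingGroup.mp (h1 hg))
      (Equiv.Perm.mem_alternatingGroup.mp (h1 hk))
  have := Fintype.ofFinite X
  have e : Nonempty (X ↪ Fin 3) := by
    rw [Function.Embedding.nonempty_iff_card_le, Fintype.card_fin, ← Nat.card_eq_fintype_card]
    exact hX
  obtain ⟨e⟩ := e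
  rw [eq_bot_iff]
  intro g hg
  have h4 := map_derivedSeries_le_derivedSeries (Equiv.Perm.viaEmbeddingHom e) 2 ⟨g, hg, rfl⟩
  rw [h3, Subgroup.mem_bot] at h4
  exact Equiv.Perm.viaEmbeddingHom_injective e (h4.trans (map_one _).symm)

theorem smul_eq_of_mem_derivedSeries_two {F α : Type*} [Group F] [MulAction F α] (O : Set α)
    (hO : ∀ g : F, ∀ x ∈ O, g • x ∈ O) (hfin : O.Finite) (hcard : O.ncard ≤ 3) {g : F}
    (hg : g ∈ derivedSeries F 2) {x : α} (hx : x ∈ O) : g • x = x := by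
  let S : SubMulAction F α := ⟨O, fun g {x} hx => hO g x hx⟩
  have : Finite S := hfin.to_subtype
  have hS : Nat.card S ≤ 3 := hcard
  have h1 := map_derivedSeries_le_derivedSeries (MulAction.toPermHom F S) 2 ⟨g, hg, rfl⟩
  rw [derivedSeries_two_perm_eq_bot hS, Subgroup.mem_bot] at h1
  exact congrArg Subtype.val (Equiv.congr_fun h1 (⟨x, hx⟩ : S))

theorem derivedSeries_add {G : Type*} [Group G] (m n : ℕ) :
    derivedSeries G (m + n) = (derivedSeries (derivedSeries G m) n).map
      (derivedSeries G m).subtype := by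
  induction n with
  | zero => rw [add_zero, derivedSeries_zero, ← MonoidHom.range_eq_map, Subgroup.range_subtype]
  | succ n ih =>
    rw [← add_assoc, derivedSeries_succ, ih, derivedSeries_succ, Subgroup.map_commutator]

end SmallActions

/-! ### Finite groups acting on lattices of rank at most three. -/

section SmallLinearGroups

/-- An action on a nontrivial elementary abelian `2`-group with at most `8` elements, without
orbits of length `7`, has an invariant set of at most `3` nonzero elements. -/
theorem exists_small_invariant_set {F W : Type*} [Group F] [AddCommGroup W] [Finite W]
    [DistribMulAction F W] (h2 : ∀ w : W, w + w = 0) (hW : Nat.card W ≤ 8)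
    (h7 : ∀ w : W, Nat.card (MulAction.orbit F w) ≠ 7) {w₀ : W} (hw₀ : w₀ ≠ 0) :
    ∃ O : Set W, (∀ g : F, ∀ x ∈ O, g • x ∈ O) ∧ O.ncard ≤ 3 ∧ ∃ v ∈ O, v ≠ 0 := by
  have horb : ∀ w : W, ∀ g : F, ∀ x ∈ MulAction.orbit F w, g • x ∈ MulAction.orbit F w :=
    fun w g x hx => by
      obtain ⟨k, rfl⟩ := hx
      exact ⟨g * k, mul_smul g k w⟩
  have hnz : ∀ w : W, w ≠ 0 → MulAction.orbit F w ⊆ {0}ᶜ := by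
    rintro w hw _ ⟨g, rfl⟩ h0
    exact hw ((smul_eq_zero_iff_eq g).mp h0)
  have hcompl : ({0}ᶜ : Set W).ncard + 1 = Nat.card W := by
    rw [← Set.ncard_singleton (0 : W), add_comm]
    exact Set.ncard_add_ncard_compl _
  by_cases h3 : (MulAction.orbit F w₀).ncard ≤ 3
  · exact ⟨_, horb w₀, h3, w₀, MulAction.mem_orbit_self w₀, hw₀⟩
  -- There are at most 7 nonzero vectors, and the orbit of `w₀` has at least 4; any other orbit of
  -- nonzero vectors has at most 3.
  by_cases hne : ∃ w : W, w ≠ 0 ∧ w ∉ MulAction.orbit F w₀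
  · obtain ⟨w, hw, hww⟩ := hne
    refine ⟨_, horb w, ?_, w, MulAction.mem_orbit_self w, hw⟩
    have hdisj : Disjoint (MulAction.orbit F w₀) (MulAction.orbit F w) := by
      rw [Set.disjoint_left]
      intro x hx hx'
      exact hww ((MulAction.orbit_eq_iff.mpr hx) ▸ (MulAction.orbit_eq_iff.mpr hx') ▸
        MulAction.mem_orbit_self w)
    have h4 := Set.ncard_union_eq hdisj
    have h5 := Set.ncard_le_ncard (Set.union_subset (hnz w₀ hw₀) (hnz w hw))
    omega
  · push Not at hne
    have heq : MulAction.orbit F w₀ = {0}ᶜ :=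
      Set.Subset.antisymm (hnz w₀ hw₀) fun w hw => hne w hw
    have h6 := h7 w₀
    rw [Nat.card_coe_set_eq, heq] at h6
    rw [heq] at h3
    -- A single orbit of nonzero vectors has `2 ^ k - 1` elements with `k ≤ 3`; being larger than 3,
    -- it would have 7.
    have hp : IsPGroup 2 (Multiplicative W) := fun w => ⟨1, by
      rw [pow_one, pow_two]
      exact h2 w.toAdd⟩
    obtain ⟨k, hk⟩ := IsPGroup.iff_card.mp hp
    have hk : Nat.card W = 2 ^ k := hk
    have hk3 : k ≤ 3 := by
      by_contra hk3
      have := Nat.pow_le_pow_right (n := 2) (by norm_num) (not_le.mp hk3)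
      omega
    interval_cases k <;> omega

/-- The second derived subgroup fixes some `v ≠ 0`, hence permutes the at most three pairs `{w, w +
v}` away from `0` and `v`. The fourth fixes each pair, so it moves every `w` by `0` or `v`; such
maps fixing `v` commute. -/
theorem smul_eq_of_mem_derivedSeries_five {F W : Type*} [Group F] [AddCommGroup W] [Finite W]
    [DistribMulAction F W] (h2 : ∀ w : W, w + w = 0) (hW : Nat.card W ≤ 8)
    (h7 : ∀ w : W, Nat.card (MulAction.orbit F w) ≠ 7) {g : F} (hg : g ∈ derivedSeries F 5)
    (w : W) : g • w = w := by
  classical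
  by_cases htriv : ∀ w : W, w = 0
  · rw [htriv w, smul_zero]
  push Not at htriv
  obtain ⟨w₀, hw₀⟩ := htriv
  obtain ⟨O, hO, hO3, v, hvO, hv0⟩ := exists_small_invariant_set h2 hW h7 hw₀
  have hfix : ∀ k ∈ derivedSeries F 2, k • v = v := fun k hk =>
    smul_eq_of_mem_derivedSeries_two O hO O.toFinite hO3 hk hvO
  have := Fintype.ofFinite W
  let Y : Finset W := {w | w ≠ 0 ∧ w ≠ v}
  let f : W → Finset W := fun w => {w, w + v}
  have hf : ∀ x w, f x = f w → x = w ∨ x = w + v := by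
    intro x w h
    have : x ∈ f w := h ▸ Finset.mem_insert_self _ _
    simpa [f] using this
  have hfv : ∀ w, f (w + v) = f w := by
    intro w
    simp only [f, add_assoc, h2, add_zero]
    exact Finset.pair_comm _ _
  have hY6 : Y.card ≤ 6 := by
    have h1 : Y ⊆ (Finset.univ.erase 0).erase v := by
      intro w hw
      simp only [Y, Finset.mem_filter, Finset.mem_univ, true_and] at hw
      simp [hw.1, hw.2]
    refine (Finset.card_le_card h1).trans ?_
    rw [Finset.card_erase_of_mem (by simp [hv0]), Finset.card_erase_of_mem (by simp),
      Finset.card_univ, ← Nat.card_eq_fintype_card]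
    omega
  have hYv : ∀ w ∈ Y, w + v ∈ Y := by
    intro w hw
    simp only [Y, Finset.mem_filter, Finset.mem_univ, true_and] at hw ⊢
    refine ⟨fun h => hw.2 ?_, fun h => hw.1 (by simpa using h)⟩
    calc w = w + v + v := by rw [add_assoc, h2, add_zero]
      _ = v := by rw [h, zero_add]
  have hX3 : (Y.image f).card ≤ 3 := by
    have := Finset.mul_card_image_le_card (f := f) Y 2 (by
      intro a ha
      obtain ⟨w, hw, rfl⟩ := Finset.mem_image.mp ha
      have hne : w ≠ w + v := fun h => hv0 (by simpa using h.symm)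
      rw [← Finset.card_pair hne]
      refine Finset.card_le_card ?_
      intro x hx
      rcases Finset.mem_insert.mp hx with rfl | hx
      · simp [hw]
      · rw [Finset.mem_singleton] at hx
        subst hx
        simp [hYv w hw, hfv])
    omega
  let K := derivedSeries F 2
  let _ : MulAction K (Finset W) :=
    { smul := fun k s => s.image fun w => k • w
      one_smul := fun s => by
        change s.image (fun w => (1 : K) • w) = s
        simp
      mul_smul := fun k l s => by
        change s.image (fun w => (k * l) • w) = (s.image fun w => l • w).image fun w => k • w
        rw [Finset.image_image]
        congr 1
        funext w
        exact mul_smul k l w }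
  have hsmul : ∀ (k : K) (w : W), k • f w = f (k • w) := by
    intro k w
    change (f w).image (fun w => k • w) = f (k • w)
    have : k • v = v := hfix k k.2
    simp [f, Finset.image_insert, smul_add, this]
  have hKY : ∀ (k : K), ∀ w ∈ Y, k • w ∈ Y := by
    intro k w hw
    simp only [Y, Finset.mem_filter, Finset.mem_univ, true_and] at hw ⊢
    refine ⟨fun h => hw.1 ((smul_eq_zero_iff_eq k).mp h), fun h => hw.2 ?_⟩
    have hkv : k • v = v := hfix k k.2
    exact smul_left_cancel k (h.trans hkv.symm)
  have hL : ∀ l ∈ derivedSeries F 4, ∀ w : W, l • w = w ∨ l • w = w + v := by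
    intro l hl w
    rw [show 4 = 2 + 2 from rfl, derivedSeries_add] at hl
    obtain ⟨k, hk, rfl⟩ := hl
    have hkv : k • v = v := hfix k k.2
    change k • w = w ∨ k • w = w + v
    by_cases hw0 : w = 0
    · left
      rw [hw0, smul_zero]
    by_cases hwv : w = v
    · left
      rw [hwv, hkv]
    have hwY : w ∈ Y := by simp [Y, hw0, hwv]
    have h1 : k • f w = f w := by
      refine smul_eq_of_mem_derivedSeries_two (F := K) (O := (Y.image f : Set (Finset W))) ?_
        (Set.toFinite _) ?_ hk ?_
      · rintro g _ hx
        obtain ⟨y, hy, rfl⟩ := Finset.mem_image.mp hx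
        rw [hsmul]
        exact Finset.mem_image_of_mem f (hKY g y hy)
      · rw [Set.ncard_coe_finset]
        exact hX3
      · exact Finset.mem_image_of_mem f hwY
    rw [hsmul] at h1
    exact hf _ _ h1
  have hLv : ∀ l ∈ derivedSeries F 4, l • v = v := fun l hl =>
    hfix l (derivedSeries_antitone F (by norm_num) hl)
  have hle : derivedSeries F 5 ≤ (MulAction.toPermHom F W).ker := by
    rw [derivedSeries_succ, Subgroup.commutator_le]
    intro g hg h hh
    rw [MonoidHom.mem_ker, map_commutatorElement, commutatorElement_eq_one_iff_mul_comm]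
    ext w
    change g • h • w = h • g • w
    rcases hL g hg w with h1 | h1 <;> rcases hL h hh w with h3 | h3 <;>
      simp only [h1, h3, smul_add, hLv g hg, hLv h hh]
  have := hle hg
  exact Equiv.congr_fun (MonoidHom.mem_ker.mp this) w

/-- A group which acts on a lattice of rank at most `3` through a finite group acts through a
solvable group of derived length at most `6`. -/
theorem derivedSeries_six_le_ker {M Q : Type*} [AddCommGroup M] [Module.Finite ℤ M]
    [Module.Free ℤ M] (hr : Module.finrank ℤ M ≤ 3) [Group Q] (φ : Q →* Module.End ℤ M)
    (D : Subgroup Q) [hDn : D.Normal] [hDi : D.FiniteIndex] (hD : ∀ g, g ∈ D ↔ φ g = 1) :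
    derivedSeries Q 6 ≤ D := by
  let P : Submodule ℤ M := LinearMap.range ((2 : ℤ) • (LinearMap.id : M →ₗ[ℤ] M))
  have hP : ∀ v, ((2 : ℕ) : ℤ) • v ∈ P := fun v => ⟨v, rfl⟩
  obtain ⟨h1, h2⟩ := card_quotient_le 2 (by norm_num) P hP
  have h8 : Nat.card (M ⧸ P) ≤ 8 :=
    h2.trans (Nat.pow_le_pow_right (n := 2) (by norm_num) hr)
  have hle : ∀ g, P ≤ P.comap (φ g) := by
    rintro g _ ⟨v, rfl⟩
    exact ⟨φ g v, by simp⟩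
  let ψ : Q →* Module.End ℤ (M ⧸ P) :=
    { toFun := fun g => P.mapQ P (φ g) (hle g)
      map_one' := by
        ext x
        simp
      map_mul' := fun g h => by
        ext x
        simp }
  let _ : DistribMulAction Q (M ⧸ P) := DistribMulAction.compHom _ ψ
  have hsm : ∀ (g : Q) (v : M), g • (Submodule.Quotient.mk v : M ⧸ P) =
      Submodule.Quotient.mk (φ g v) := fun g v => rfl
  have h2w : ∀ w : M ⧸ P, w + w = 0 := by
    intro w
    obtain ⟨v, rfl⟩ := Submodule.Quotient.mk_surjective P w
    rw [← Submodule.Quotient.mk_add, Submodule.Quotient.mk_eq_zero]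
    exact ⟨v, by simp [two_smul]⟩
  -- An orbit of length 7 would make 7 divide the order of `Q ⧸ D`; by Cauchy some element outside
  -- `D` would act on `M` with seventh power 1, which the rank forbids.
  have h7 : ∀ w : M ⧸ P, Nat.card (MulAction.orbit Q w) ≠ 7 := by
    intro w h
    have hstab : D ≤ MulAction.stabilizer Q w := by
      intro g hg
      obtain ⟨v, rfl⟩ := Submodule.Quotient.mk_surjective P w
      rw [MulAction.mem_stabilizer_iff, hsm, (hD g).mp hg]
      rfl
    have hidx := Subgroup.index_dvd_of_le hstab
    rw [MulAction.index_stabilizer, ← Nat.card_coe_set_eq, h] at hidx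
    have hfact : Fact (Nat.Prime 7) := ⟨by norm_num⟩
    obtain ⟨q, hq⟩ := exists_prime_orderOf_dvd_card' (G := Q ⧸ D) 7 hidx
    obtain ⟨g, rfl⟩ := QuotientGroup.mk_surjective q
    have hg7 : g ^ 7 ∈ D := by
      rw [← QuotientGroup.eq_one_iff, QuotientGroup.mk_pow, ← hq]
      exact pow_orderOf_eq_one _
    have hφ7 : φ g ^ 7 = 1 := by
      rw [← map_pow]
      exact (hD _).mp hg7
    have := (hD g).mpr (eq_one_of_pow_seven_eq_one hr hφ7)
    rw [(QuotientGroup.eq_one_iff g).mpr this, orderOf_one] at hq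
    exact absurd hq (by norm_num)
  let D₂ : Subgroup Q :=
    (MulAction.toPermHom Q (M ⧸ P)).ker
  have h5 : derivedSeries Q 5 ≤ D₂ := by
    intro g hg
    rw [MonoidHom.mem_ker]
    ext w
    exact smul_eq_of_mem_derivedSeries_five h2w h8 h7 hg w
  -- Elements acting trivially on `M / 2M` have squares in `D`. So the image of `D₂` in `Q ⧸ D` has
  -- exponent 2 and is abelian, which costs one derived step after the five spent on `M / 2M`.
  have hsq : ∀ g ∈ D₂, g ^ 2 ∈ D := by
    intro g hg
    rw [hD, map_pow]
    refine sq_eq_one_of_dividesEnd_two (n := D.index)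
      (Nat.pos_of_ne_zero hDi.index_ne_zero) ?_ ?_
    · rw [← map_pow, ← hD]
      exact D.pow_index_mem g
    · intro v
      have h9 : g • (Submodule.Quotient.mk v : M ⧸ P) = Submodule.Quotient.mk v :=
        Equiv.congr_fun (MonoidHom.mem_ker.mp hg) _
      rw [hsm, Submodule.Quotient.eq] at h9
      obtain ⟨w, hw⟩ := h9
      exact ⟨w, hw.symm⟩
  have hsq' : ∀ g ∈ D₂, (g : Q ⧸ D) * g = 1 := by
    intro g hg
    rw [← QuotientGroup.mk_mul, QuotientGroup.eq_one_iff, ← sq]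
    exact hsq g hg
  rw [derivedSeries_succ, Subgroup.commutator_le]
  intro g hg h hh
  have e1 := hsq' g (h5 hg)
  have e2 := hsq' h (h5 hh)
  have e3 := hsq' (g * h) (D₂.mul_mem (h5 hg) (h5 hh))
  rw [← QuotientGroup.eq_one_iff]
  change (g : Q ⧸ D) * h * (g : Q ⧸ D)⁻¹ * (h : Q ⧸ D)⁻¹ = 1
  rw [inv_eq_of_mul_eq_one_left e1, inv_eq_of_mul_eq_one_left e2, mul_assoc]
  rw [QuotientGroup.mk_mul] at e3
  exact e3

end SmallLinearGroups

/-! ### Solvability in Hirsch length at most three. -/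

section Solvability

/-- Schur's theorem: a commutator depends only on the classes of its entries modulo the centre, so
there are finitely many commutators, and then the subgroup they generate is finite. -/
theorem finite_commutator_of_finiteIndex_center (D : Type*) [Group D]
    [(Subgroup.center D).FiniteIndex] : Finite (commutator D) := by
  have : Finite (commutatorSet D) := by
    let f : (D ⧸ Subgroup.center D) × (D ⧸ Subgroup.center D) → D :=
      fun p => ⁅p.1.out, p.2.out⁆
    refine ((Set.finite_range f).subset ?_).to_subtype
    rintro _ ⟨a, b, rfl⟩
    refine ⟨((a : D ⧸ Subgroup.center D), (b : D ⧸ Subgroup.center D)), ?_⟩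
    obtain ⟨⟨z, hz⟩, hz'⟩ := QuotientGroup.mk_out_eq_mul (Subgroup.center D) a
    obtain ⟨⟨w, hw⟩, hw'⟩ := QuotientGroup.mk_out_eq_mul (Subgroup.center D) b
    simp only [f]
    rw [hz', hw']
    rw [Subgroup.mem_center_iff] at hz hw
    simp only [commutatorElement_def, mul_inv_rev]
    calc a * z * (b * w) * (z⁻¹ * a⁻¹) * (w⁻¹ * b⁻¹)
        = a * (z * (b * w)) * z⁻¹ * a⁻¹ * w⁻¹ * b⁻¹ := by group
      _ = a * b * (w * a⁻¹) * w⁻¹ * b⁻¹ := by rw [← hz]; group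
      _ = a * b * a⁻¹ * b⁻¹ := by rw [← hw]; group
  infer_instance

/-- A torsion-free group with centre of finite index is abelian. -/
theorem TorsionFreeGroup.mul_comm_of_finiteIndex_center {G : Type u} [Group G]
    (h : TorsionFreeGroup G) [(Subgroup.center G).FiniteIndex] (a b : G) : a * b = b * a := by
  have := finite_commutator_of_finiteIndex_center G
  rw [← commutatorElement_eq_one_iff_mul_comm]
  by_contra hne
  have hmem : ⁅a, b⁆ ∈ commutator G :=
    Subgroup.commutator_mem_commutator (Subgroup.mem_top a) (Subgroup.mem_top b)
  exact h _ hne ((commutator G).subtype.isOfFinOrder (isOfFinOrder_of_finite (⟨_, hmem⟩ : commutator G)))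

theorem TorsionFreeGroup.lattice {A : Type u} [CommGroup A] (h : TorsionFreeGroup A)
    [Group.FG A] : Module.Finite ℤ (Additive A) ∧ Module.Free ℤ (Additive A) ∧
      (Module.finrank ℤ (Additive A) : ℕ∞) ≤ hirschLength A := by
  have h1 : Module.Finite ℤ (Additive A) := Module.Finite.iff_addGroup_fg.mpr inferInstance
  have h2 : IsMulTorsionFree A := by
    refine ⟨fun n hn a b hab => ?_⟩
    have hab : a ^ n = b ^ n := hab
    have : (a * b⁻¹) ^ n = 1 := by rw [mul_pow, inv_pow, hab, mul_inv_cancel]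
    exact mul_inv_eq_one.mp (h.eq_one (Nat.pos_of_ne_zero hn) this)
  have h3 : Module.Free ℤ (Additive A) := inferInstance
  refine ⟨h1, h3, ?_⟩
  let b := Module.finBasis ℤ (Additive A)
  refine le_hirschLength_of_independent _ (fun i => (b i).toMul) fun c hc => ?_
  have := Fintype.linearIndependent_iff.mp b.linearIndependent c hc
  exact funext this

/-- The action of a group by conjugation on an abelian normal subgroup. -/
def conjEnd {Q : Type u} [Group Q] (V : Type u) [CommGroup V] (ρ : Q →* MulAut V) :
    Q →* Module.End ℤ (Additive V) where
  toFun g := (MonoidHom.toAdditive (ρ g).toMonoidHom).toIntLinearMap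
  map_one' := by
    ext x
    simp
  map_mul' g h := by
    ext x
    simp

theorem conjEnd_eq_one_iff {Q : Type u} [Group Q] (V : Type u) [CommGroup V] (ρ : Q →* MulAut V)
    (g : Q) : conjEnd V ρ g = 1 ↔ ρ g = 1 := by
  constructor
  · intro h
    ext v
    exact congrArg Additive.toMul (LinearMap.congr_fun h (Additive.ofMul v))
  · intro h
    ext v
    change Additive.ofMul (ρ g v.toMul) = v
    rw [h]
    rfl

/-- Let `D` be the centralizer of the lattice `V`. The finite group `Q ⧸ D` acts faithfully on `V`,
so six derived steps lead into `D`; there `V` is central of finite index, and Schur's theorem makes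
the seventh finite. -/
theorem finite_derivedSeries_seven {Q : Type u} [Group Q] (V : Subgroup Q) [V.Normal]
    [V.FiniteIndex] [Group.FG V] (hc : ∀ x ∈ V, ∀ y ∈ V, x * y = y * x) (htf : TorsionFreeGroup V)
    (hh : hirschLength V ≤ 3) : Finite (derivedSeries Q 7) := by
  let _ : CommGroup V := { mul_comm := fun x y => Subtype.ext (hc x x.2 y y.2) }
  obtain ⟨h1, h2, h3⟩ := htf.lattice
  have hr : Module.finrank ℤ (Additive V) ≤ 3 := by exact_mod_cast h3.trans hh
  let ρ : Q →* MulAut V := MulAut.conjNormal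
  let D := ρ.ker
  have hVD : V ≤ D := by
    intro x hx
    rw [MonoidHom.mem_ker]
    ext v
    change x * v * x⁻¹ = v
    rw [hc x hx v v.2, mul_inv_cancel_right]
  have hDi : D.FiniteIndex := Subgroup.finiteIndex_of_le hVD
  have h6 : derivedSeries Q 6 ≤ D :=
    derivedSeries_six_le_ker hr (conjEnd V ρ) D fun g => by
      rw [conjEnd_eq_one_iff, MonoidHom.mem_ker]
  have hcent : V.subgroupOf D ≤ Subgroup.center D := by
    intro x hx
    rw [Subgroup.mem_center_iff]
    intro g
    have h := congrArg Subtype.val (MulEquiv.congr_fun (MonoidHom.mem_ker.mp g.2) ⟨x, hx⟩)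
    have h : (g : Q) * x * (g : Q)⁻¹ = x := h
    exact Subtype.ext (mul_inv_eq_iff_eq_mul.mp h)
  have hci : (Subgroup.center D).FiniteIndex := Subgroup.finiteIndex_of_le hcent
  have hfin := finite_commutator_of_finiteIndex_center D
  have hle : derivedSeries Q 7 ≤ (commutator D).map D.subtype := by
    rw [derivedSeries_succ, commutator_def, Subgroup.map_commutator, ← MonoidHom.range_eq_map,
      Subgroup.range_subtype]
    exact Subgroup.commutator_mono h6 h6
  have hfin2 : Finite ((commutator D).map D.subtype) :=
    Finite.of_surjective _ (D.subtype.subgroupMap_surjective (commutator D))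
  exact Finite.of_injective _ (Subgroup.inclusion_injective hle)

/-- Writing an element as an iterated product of commutators uses only finitely many elements. -/
theorem exists_fg_mem_map_derivedSeries {G : Type u} [Group G] (n : ℕ) :
    ∀ x ∈ derivedSeries G n, ∃ K : Subgroup G, Group.FG K ∧
      x ∈ (derivedSeries K n).map K.subtype := by
  have hmono : ∀ (n : ℕ) {K L : Subgroup G}, K ≤ L →
      (derivedSeries K n).map K.subtype ≤ (derivedSeries L n).map L.subtype := by
    intro n K L h
    have := Subgroup.map_mono (f := L.subtype)
      (map_derivedSeries_le_derivedSeries (Subgroup.inclusion h) n)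
    rwa [Subgroup.map_map, Subgroup.subtype_comp_inclusion] at this
  have hsup : ∀ K L : Subgroup G, Group.FG K → Group.FG L → Group.FG (K ⊔ L : Subgroup G) := by
    intro K L hK hL
    rw [Group.fg_iff_subgroup_fg] at *
    exact hK.sup hL
  induction n with
  | zero =>
    intro x _
    refine ⟨Subgroup.zpowers x, ?_, ?_⟩
    · rw [Group.fg_iff_subgroup_fg]
      exact ⟨{x}, by rw [Finset.coe_singleton, Subgroup.zpowers_eq_closure]⟩
    · exact ⟨⟨x, Subgroup.mem_zpowers x⟩, Subgroup.mem_top _, rfl⟩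
  | succ n ih =>
    intro x hx
    rw [derivedSeries_succ, Subgroup.commutator_def] at hx
    induction hx using Subgroup.closure_induction with
    | mem x hx =>
      obtain ⟨a, ha, b, hb, rfl⟩ := hx
      obtain ⟨K, hK, hKa⟩ := ih a ha
      obtain ⟨L, hL, hLb⟩ := ih b hb
      refine ⟨K ⊔ L, hsup K L hK hL, ?_⟩
      rw [derivedSeries_succ, Subgroup.map_commutator]
      exact Subgroup.commutator_mem_commutator (hmono n le_sup_left hKa) (hmono n le_sup_right hLb)
    | one =>
      refine ⟨⊥, ?_, Subgroup.one_mem _⟩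
      rw [Group.fg_iff_subgroup_fg]
      exact ⟨∅, by simp⟩
    | mul x y _ _ hx hy =>
      obtain ⟨K, hK, hKa⟩ := hx
      obtain ⟨L, hL, hLb⟩ := hy
      exact ⟨K ⊔ L, hsup K L hK hL,
        Subgroup.mul_mem _ (hmono _ le_sup_left hKa) (hmono _ le_sup_right hLb)⟩
    | inv x _ hx =>
      obtain ⟨K, hK, hKa⟩ := hx
      exact ⟨K, hK, Subgroup.inv_mem _ hKa⟩

theorem derivedSeries_eq_bot_of_fg {G : Type u} [Group G] (n : ℕ)
    (h : ∀ K : Subgroup G, Group.FG K → derivedSeries K n = ⊥) : derivedSeries G n = ⊥ := by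
  rw [eq_bot_iff]
  intro x hx
  obtain ⟨K, hK, hxK⟩ := exists_fg_mem_map_derivedSeries n x hx
  rwa [h K hK, Subgroup.map_bot] at hxK

theorem TorsionFreeGroup.subsingleton_of_finite {G : Type u} [Group G] [Finite G]
    (h : TorsionFreeGroup G) : Subsingleton G :=
  h.subsingleton_of_hirschLength (hirschLength_of_finite G)

/-- Torsion-free elementary amenable groups of Hirsch length at most `3` are solvable. -/
theorem TorsionFreeGroup.derivedSeries_eq_bot (n : ℕ) (hn : n ≤ 3) : ∀ {K : Type u} [Group K],
    TorsionFreeGroup K → hirschLength K ≤ n → derivedSeries K (7 * n) = ⊥ := by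
  induction n with
  | zero =>
    intro K _ htf hh
    have := htf.subsingleton_of_hirschLength (le_antisymm hh bot_le)
    exact Subsingleton.elim _ _
  | succ n ih =>
    intro K _ htf hh
    -- Passing to finitely generated subgroups is possible because the bound `7 * n` is uniform; it
    -- also lets the induction hypothesis apply to a derived subgroup that need not be finitely
    -- generated.
    refine derivedSeries_eq_bot_of_fg _ fun L hL => ?_
    have htL := htf.subgroup L
    have hhL : hirschLength L ≤ (n + 1 : ℕ) := (hirschLength_subgroup_le L).trans hh
    rcases finite_or_infinite L with hfin | hinf
    · have := htL.subsingleton_of_finite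
      exact Subsingleton.elim _ _
    obtain ⟨N, hN, V, hV, hVi, hVfg, hVc, hVt, hV1⟩ := exists_virtually_abelian_quotient (G := L)
      (ne_top_of_le_ne_top (ENat.natCast_ne_top _) hhL)
    have hVle : hirschLength V ≤ 3 := by
      refine (hirschLength_subgroup_le V).trans ((hirschLength_le_of_surjective _
        (QuotientGroup.mk'_surjective N)).trans (hhL.trans ?_))
      exact_mod_cast hn
    have hVone : 1 ≤ hirschLength (L ⧸ N) := by
      obtain ⟨v, hv⟩ := Subgroup.ne_bot_iff_exists_ne_one.mp hV1
      exact (hVt.one_le_hirschLength hv).trans (hirschLength_subgroup_le V)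
    have hNle : hirschLength N ≤ n := by
      have h1 := hirschLength_eq_quotient_add N
      rw [h1] at hhL
      have h2 := (add_le_add (le_refl (hirschLength N)) hVone).trans hhL
      push_cast at h2
      exact (ENat.add_le_add_iff_right ENat.one_ne_top).mp h2
    have hfin := finite_derivedSeries_seven V hVc hVt hVle
    set E := derivedSeries L 7 with hE
    -- `E` has finite image in `L ⧸ N`, so its length is that of `N ∩ E`, which is at most `n`.
    have hEle : hirschLength E ≤ n := by
      have hmap : ∀ x : E, QuotientGroup.mk' N (x : L) ∈ derivedSeries (L ⧸ N) 7 := fun x =>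
        map_derivedSeries_le_derivedSeries (QuotientGroup.mk' N) 7 ⟨x, x.2, rfl⟩
      have h1 := hirschLength_le_add_of_exact (N.subgroupOf E).subtype
        (((QuotientGroup.mk' N).comp E.subtype).codRestrict (derivedSeries (L ⧸ N) 7) hmap) (by
          intro x hx
          rw [Subgroup.range_subtype]
          have h2 := congrArg Subtype.val (MonoidHom.mem_ker.mp hx)
          exact (QuotientGroup.eq_one_iff (x : L)).mp h2)
      rw [hirschLength_of_finite (derivedSeries (L ⧸ N) 7), add_zero] at h1
      refine h1.trans (le_trans ?_ hNle)
      refine hirschLength_le_of_injective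
        ((E.subtype.comp (N.subgroupOf E).subtype).codRestrict N fun x => x.2) ?_
      intro x y hxy
      have h : ((x : E) : L) = ((y : E) : L) := congrArg (fun z : N => (z : L)) hxy
      exact Subtype.ext (Subtype.ext h)
    have h1 := ih (by omega) (htL.subgroup E) hEle
    rw [show 7 * (n + 1) = 7 + 7 * n by ring, derivedSeries_add, ← hE, h1, Subgroup.map_bot]

end Solvability

/-! ### Virtually polycyclic groups and finiteness of relations. -/

section VirtuallyPolycyclic

/-- The smallest class of groups which contains the finite and the cyclic groups and is closed
under extensions. -/
inductive IsVirtuallyPolycyclic : (G : Type u) → [Group G] → Prop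
  | of_finite (G : Type u) [Group G] [Finite G] : IsVirtuallyPolycyclic G
  | of_isCyclic (G : Type u) [Group G] [IsCyclic G] : IsVirtuallyPolycyclic G
  | of_extension {G : Type u} [Group G] (N : Subgroup G) [N.Normal]
      (hN : IsVirtuallyPolycyclic N) (hQ : IsVirtuallyPolycyclic (G ⧸ N)) : IsVirtuallyPolycyclic G

theorem IsVirtuallyPolycyclic.of_surjective {G : Type u} [Group G] (h : IsVirtuallyPolycyclic G) :
    ∀ {Q : Type u} [Group Q] (f : G →* Q), Function.Surjective f → IsVirtuallyPolycyclic Q := by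
  induction h with
  | of_finite G =>
    intro Q _ f hf
    have := Finite.of_surjective f hf
    exact .of_finite Q
  | of_isCyclic G =>
    intro Q _ f hf
    have : IsCyclic Q := isCyclic_of_surjective f hf
    exact .of_isCyclic Q
  | @of_extension G _ N hNn hN hQ ihN ihQ =>
    intro Q _ f hf
    have : (N.map f).Normal := hNn.map f hf
    refine .of_extension (N.map f) (ihN (f.subgroupMap N) (f.subgroupMap_surjective N)) ?_
    exact ihQ (QuotientGroup.map N (N.map f) f (Subgroup.le_comap_map f N))
      (QuotientGroup.map_surjective_of_surjective _ _ _
        ((QuotientGroup.mk'_surjective _).comp hf) _)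

theorem group_fg_of_extension {G : Type u} [Group G] (N : Subgroup G) [N.Normal]
    (hN : Group.FG N) (hQ : Group.FG (G ⧸ N)) : Group.FG G := by
  classical
  obtain ⟨S, hS⟩ := Group.fg_def.mp hN
  obtain ⟨T, hT⟩ := Group.fg_def.mp hQ
  rw [Group.fg_def]
  refine ⟨S.image N.subtype ∪ T.image Quotient.out, ?_⟩
  set K := Subgroup.closure ((S.image N.subtype ∪ T.image Quotient.out : Finset G) : Set G) with hK
  have hNK : N ≤ K := by
    have h1 : (Subgroup.closure (S : Set N)).map N.subtype ≤ K := by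
      rw [MonoidHom.map_closure, Subgroup.closure_le]
      rintro _ ⟨x, hx, rfl⟩
      exact Subgroup.subset_closure (by simp [Finset.mem_coe.mp hx])
    rwa [hS, ← MonoidHom.range_eq_map, Subgroup.range_subtype] at h1
  have hQK : K.map (QuotientGroup.mk' N) = ⊤ := by
    rw [eq_top_iff, ← hT, Subgroup.closure_le]
    intro x hx
    refine ⟨Quotient.out x, Subgroup.subset_closure ?_, QuotientGroup.out_eq' x⟩
    rw [Finset.coe_union, Finset.coe_image, Finset.coe_image]
    exact Or.inr ⟨x, hx, rfl⟩
  rw [eq_top_iff]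
  intro g _
  have : QuotientGroup.mk' N g ∈ K.map (QuotientGroup.mk' N) := hQK ▸ Subgroup.mem_top _
  obtain ⟨k, hk, hkg⟩ := this
  have h2 : k⁻¹ * g ∈ N := QuotientGroup.eq.mp hkg
  have := K.mul_mem hk (hNK h2)
  rwa [mul_inv_cancel_left] at this

theorem IsVirtuallyPolycyclic.fg {G : Type u} [Group G] (h : IsVirtuallyPolycyclic G) :
    Group.FG G := by
  induction h with
  | of_finite G => infer_instance
  | of_isCyclic G =>
    obtain ⟨g, hg⟩ := IsCyclic.exists_zpow_surjective (G := G)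
    refine Group.fg_def.mpr ⟨{g}, ?_⟩
    rw [Finset.coe_singleton, ← Subgroup.zpowers_eq_closure, eq_top_iff]
    exact fun x _ => hg x
  | of_extension N _ _ hN hQ => exact group_fg_of_extension N hN hQ

theorem isVirtuallyPolycyclic_of_closure_range_eq_top (n : ℕ) : ∀ {A : Type u} [CommGroup A]
    (v : Fin n → A), Subgroup.closure (Set.range v) = ⊤ → IsVirtuallyPolycyclic A := by
  induction n with
  | zero =>
    intro A _ v hcl
    rw [Set.range_eq_empty, Subgroup.closure_empty] at hcl
    have : Subsingleton A := Subgroup.subsingleton_iff.mp (subsingleton_iff_bot_eq_top.mp hcl)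
    exact .of_finite A
  | succ n ih =>
    intro A _ v hcl
    refine .of_extension (Subgroup.zpowers (v 0)) (.of_isCyclic _)
      (ih (fun i => (v i.succ : A ⧸ Subgroup.zpowers (v 0))) ?_)
    rw [eq_top_iff, ← Subgroup.map_top_of_surjective _
      (QuotientGroup.mk'_surjective (Subgroup.zpowers (v 0))), ← hcl, MonoidHom.map_closure,
      Subgroup.closure_le]
    rintro _ ⟨_, ⟨i, rfl⟩, rfl⟩
    refine Fin.cases ?_ (fun i => ?_) i
    · rw [SetLike.mem_coe, QuotientGroup.mk'_apply,
        (QuotientGroup.eq_one_iff (N := Subgroup.zpowers (v 0)) _).mpr (Subgroup.mem_zpowers _)]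
      exact Subgroup.one_mem _
    · exact Subgroup.subset_closure ⟨i, rfl⟩

theorem isVirtuallyPolycyclic_of_fg_of_comm {A : Type u} [Group A] (hA : Group.FG A)
    (hc : ∀ a b : A, a * b = b * a) : IsVirtuallyPolycyclic A := by
  let _ : CommGroup A := { mul_comm := hc }
  obtain ⟨S, hS⟩ := Group.fg_def.mp hA
  refine isVirtuallyPolycyclic_of_closure_range_eq_top S.card (fun i => (S.equivFin.symm i : A)) ?_
  rw [← hS]
  congr 1
  ext x
  constructor
  · rintro ⟨i, rfl⟩
    exact (S.equivFin.symm i).2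
  · exact fun hx => ⟨S.equivFin ⟨x, hx⟩, by simp⟩

/-- The kernel of every epimorphism from a finitely generated group to `Q` is finitely generated as
a normal subgroup. -/
def FinitelyRelated (Q : Type u) [Group Q] : Prop :=
  ∀ (G : Type u) [Group G] [Group.FG G] (π : G →* Q), Function.Surjective π →
    ∃ S : Set G, S.Finite ∧ Subgroup.normalClosure S = π.ker

theorem finitelyRelated_of_finite (Q : Type u) [Group Q] [Finite Q] : FinitelyRelated Q := by
  intro G _ _ π hπ
  have : Finite (G ⧸ π.ker) :=
    Finite.of_equiv Q (QuotientGroup.quotientKerEquivOfSurjective π hπ).symm.toEquiv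
  have : π.ker.FiniteIndex := Subgroup.finiteIndex_of_finite_quotient
  have : Group.FG π.ker := inferInstance
  exact Subgroup.IsFinitelyNormallyGenerated.of_FG π.ker

/-- For infinite `Q`, lift a generator to `t` and impose `x = t ^ a x` on the finitely many
generators `x` of `G`. The quotient is generated by `t`, whose image in `Q` has infinite order, so
nothing is left of the kernel. -/
theorem finitelyRelated_of_isCyclic (Q : Type u) [Group Q] [IsCyclic Q] : FinitelyRelated Q := by
  rcases finite_or_infinite Q with hf | hi
  · exact finitelyRelated_of_finite Q
  intro G _ hG π hπ
  obtain ⟨X, hX⟩ := Group.fg_def.mp hG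
  obtain ⟨g, hg⟩ := IsCyclic.exists_zpow_surjective (G := Q)
  have hg0 : ¬ IsOfFinOrder g := by
    rw [← infinite_zpowers]
    have : (Subgroup.zpowers g : Set Q) = Set.univ := Set.eq_univ_of_forall fun x => hg x
    rw [this]
    exact Set.infinite_univ
  obtain ⟨t, ht⟩ := hπ g
  choose a ha using fun x : G => hg (π x)
  have ha : ∀ x, g ^ a x = π x := ha
  refine ⟨(fun x => x * (t ^ a x)⁻¹) '' (X : Set G), X.finite_toSet.image _, ?_⟩
  set W := Subgroup.normalClosure ((fun x => x * (t ^ a x)⁻¹) '' (X : Set G)) with hW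
  refine le_antisymm (Subgroup.normalClosure_le_normal ?_) ?_
  · rintro _ ⟨x, -, rfl⟩
    change π (x * (t ^ a x)⁻¹) = 1
    rw [map_mul, map_inv, map_zpow, ht, ha, mul_inv_cancel]
  · intro k hk
    have h1 : (⊤ : Subgroup G) ≤
        (Subgroup.zpowers (QuotientGroup.mk' W t)).comap (QuotientGroup.mk' W) := by
      rw [← hX, Subgroup.closure_le]
      intro x hx
      refine ⟨a x, ?_⟩
      change (QuotientGroup.mk' W t) ^ a x = QuotientGroup.mk' W x
      rw [← map_zpow]
      refine (QuotientGroup.eq_iff_div_mem.mpr ?_).symm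
      rw [div_eq_mul_inv]
      exact Subgroup.subset_normalClosure ⟨x, hx, rfl⟩
    obtain ⟨j, hj⟩ := h1 (Subgroup.mem_top k)
    have hj : (QuotientGroup.mk' W t) ^ j = QuotientGroup.mk' W k := hj
    rw [← map_zpow] at hj
    have h2 : (t ^ j)⁻¹ * k ∈ W := QuotientGroup.eq.mp hj
    have h3 : W ≤ π.ker := by
      refine Subgroup.normalClosure_le_normal ?_
      rintro _ ⟨x, -, rfl⟩
      change π (x * (t ^ a x)⁻¹) = 1
      rw [map_mul, map_inv, map_zpow, ht, ha, mul_inv_cancel]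
    have h4 : π ((t ^ j)⁻¹ * k) = 1 := h3 h2
    rw [map_mul, MonoidHom.mem_ker.mp hk, mul_one, map_inv, map_zpow, ht, inv_eq_one] at h4
    have hj0 : j = 0 := by
      by_contra h0
      exact hg0 (isOfFinOrder_iff_zpow_eq_one.mpr ⟨j, h0, h4⟩)
    simpa [hj0] using h2

/-- Inverses of generators are included because a conjugation may map a subgroup properly into
itself. -/
theorem closure_normal_of_generators {G : Type u} [Group G] {X T : Set G}
    (hX : Subgroup.closure X = ⊤)
    (h : ∀ x, (x ∈ X ∨ x⁻¹ ∈ X) → ∀ t ∈ T, x * t * x⁻¹ ∈ Subgroup.closure T) :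
    (Subgroup.closure T).Normal := by
  have hle : ∀ x, (x ∈ X ∨ x⁻¹ ∈ X) → ∀ p ∈ Subgroup.closure T,
      x * p * x⁻¹ ∈ Subgroup.closure T := by
    intro x hx
    have : Subgroup.closure T ≤ (Subgroup.closure T).comap (MulAut.conj x).toMonoidHom := by
      rw [Subgroup.closure_le]
      exact h x hx
    exact this
  rw [← Subgroup.normalizer_eq_top_iff, eq_top_iff, ← hX, Subgroup.closure_le]
  intro x hx
  rw [SetLike.mem_coe, Subgroup.mem_normalizer_iff]
  refine fun p => ⟨hle x (Or.inl hx) p, fun hp => ?_⟩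
  have := hle x⁻¹ (Or.inr (by rwa [inv_inv])) _ hp
  simpa [mul_assoc] using this

/-- Finitely many relators `R₀` suffice to make the image of a finitely generated lift `P` of `M`
normal and equal to the image of the whole preimage of `M`. What remains of the kernel is then the
kernel of a map from a finitely generated group onto `M`, where the hypothesis on `M` applies. -/
theorem finitelyRelated_of_extension {Q : Type u} [Group Q] (M : Subgroup Q) [hMn : M.Normal]
    (hMfg : Group.FG M) (hM : FinitelyRelated M) (hQ : FinitelyRelated (Q ⧸ M)) :
    FinitelyRelated Q := by
  intro G _ hG π hπ
  obtain ⟨S₁, hS₁, hS₁'⟩ := hQ G ((QuotientGroup.mk' M).comp π)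
    ((QuotientGroup.mk'_surjective M).comp hπ)
  obtain ⟨T, hT⟩ : M.FG := (Group.fg_iff_subgroup_fg M).mp hMfg
  obtain ⟨X, hX⟩ := Group.fg_def.mp hG
  set T' : Set G := Function.surjInv hπ '' (T : Set Q) with hT'
  set P := Subgroup.closure T' with hP
  have hPM : P.map π = M := by
    rw [hP, MonoidHom.map_closure, hT', Set.image_image]
    simp only [Function.surjInv_eq hπ, Set.image_id']
    exact hT
  have hc : ∀ g, π g ∈ M → ∃ p ∈ P, π p = π g := by
    intro g hg
    rw [← hPM] at hg
    exact hg
  choose! c hcP hcπ using hc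
  set X' : Set G := (X : Set G) ∪ (X : Set G)⁻¹ with hX'
  have hX'fin : X'.Finite := X.finite_toSet.union X.finite_toSet.inv
  -- `Y` lists what must fall into `P` modulo `R`: the normal generators of the preimage of `M`, and
  -- the conjugates that decide normality of `P`.
  set Y : Set G := S₁ ∪ Set.image2 (fun x t => x * t * x⁻¹) X' T' with hY
  have hYfin : Y.Finite := hS₁.union (hX'fin.image2 _ (T.finite_toSet.image _))
  have hYM : ∀ y ∈ Y, π y ∈ M := by
    rintro y (hy | ⟨x, -, t, ht, rfl⟩)
    · have : y ∈ ((QuotientGroup.mk' M).comp π).ker := hS₁' ▸ Subgroup.subset_normalClosure hy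
      exact (QuotientGroup.eq_one_iff _).mp this
    · rw [map_mul, map_mul, map_inv]
      refine hMn.conj_mem _ ?_ _
      rw [← hPM]
      exact ⟨t, Subgroup.subset_closure ht, rfl⟩
  set R₀ : Set G := (fun g => g * (c g)⁻¹) '' Y with hR₀
  set R := Subgroup.normalClosure R₀ with hR
  have hRπ : R ≤ π.ker := by
    refine Subgroup.normalClosure_le_normal ?_
    rintro _ ⟨y, hy, rfl⟩
    change π (y * (c y)⁻¹) = 1
    rw [map_mul, map_inv, hcπ y (hYM y hy), mul_inv_cancel]
  set q := QuotientGroup.mk' R with hq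
  have hqY : ∀ y ∈ Y, q y ∈ P.map q := by
    intro y hy
    refine ⟨c y, hcP y (hYM y hy), ?_⟩
    refine (QuotientGroup.eq_iff_div_mem.mpr ?_).symm
    rw [div_eq_mul_inv]
    exact Subgroup.subset_normalClosure ⟨y, hy, rfl⟩
  have hPq : P.map q = Subgroup.closure (q '' T') := by rw [hP, MonoidHom.map_closure]
  have hPn : (P.map q).Normal := by
    rw [hPq]
    refine closure_normal_of_generators (X := q '' (X : Set G)) ?_ ?_
    · rw [← MonoidHom.map_closure, hX]
      exact Subgroup.map_top_of_surjective _ (QuotientGroup.mk'_surjective R)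
    · rintro x hx _ ⟨t, ht, rfl⟩
      rw [← hPq]
      obtain ⟨x', hx', rfl⟩ : ∃ x' ∈ X', q x' = x := by
        rcases hx with ⟨x', hx', rfl⟩ | ⟨x', hx', hxx⟩
        · exact ⟨x', Or.inl hx', rfl⟩
        · exact ⟨x'⁻¹, Or.inr (by simpa using hx'), by rw [map_inv, hxx, inv_inv]⟩
      rw [← map_mul, ← map_inv, ← map_mul]
      exact hqY _ (Or.inr ⟨x', hx', t, ht, rfl⟩)
  have hLP : M.comap π ≤ (P.map q).comap q := by
    have h1 : M.comap π = Subgroup.normalClosure S₁ := by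
      rw [hS₁', ← MonoidHom.comap_ker, QuotientGroup.ker_mk']
    rw [h1]
    exact Subgroup.normalClosure_le_normal fun s hs => hqY s (Or.inl hs)
  let π' : G ⧸ R →* Q := QuotientGroup.lift R π hRπ
  have hπ'q : ∀ g, π' (q g) = π g := fun g => rfl
  have hPM' : ∀ x : P.map q, π' x ∈ M := by
    rintro ⟨_, p, hp, rfl⟩
    rw [← hPM]
    exact ⟨p, hp, rfl⟩
  let ρ : P.map q →* M := (π'.comp (P.map q).subtype).codRestrict M hPM'
  have hρ : Function.Surjective ρ := by
    rintro ⟨m, hm⟩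
    rw [← hPM] at hm
    obtain ⟨p, hp, rfl⟩ := hm
    exact ⟨⟨q p, p, hp, rfl⟩, rfl⟩
  have hPfg : Group.FG (P.map q) := by
    rw [Group.fg_iff_subgroup_fg, hPq, Subgroup.fg_iff]
    exact ⟨_, rfl, (T.finite_toSet.image _).image _⟩
  obtain ⟨S₂, hS₂, hS₂'⟩ := hM (P.map q) ρ hρ
  set S₃ : Set G := (fun p : P.map q => Quotient.out (p : G ⧸ R)) '' S₂ with hS₃
  have hout : ∀ p : G ⧸ R, q (Quotient.out p) = p := fun p => QuotientGroup.out_eq' p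
  refine ⟨R₀ ∪ S₃, (hYfin.image _).union (hS₂.image _), le_antisymm ?_ ?_⟩
  · refine Subgroup.normalClosure_le_normal (Set.union_subset
      (Subgroup.subset_normalClosure.trans hRπ) ?_)
    rintro _ ⟨p, hp, rfl⟩
    have h1 : p ∈ ρ.ker := hS₂' ▸ Subgroup.subset_normalClosure hp
    have h2 : π' p = 1 := congrArg Subtype.val (MonoidHom.mem_ker.mp h1)
    rw [← hout p, hπ'q] at h2
    exact h2
  · set W := Subgroup.normalClosure (R₀ ∪ S₃) with hW
    have hRW : R ≤ W := Subgroup.normalClosure_mono Set.subset_union_left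
    have hWn : (W.map q).Normal :=
      Subgroup.Normal.map inferInstance q (QuotientGroup.mk'_surjective R)
    have h1 : Subgroup.normalClosure S₂ ≤ (W.map q).comap (P.map q).subtype := by
      refine Subgroup.normalClosure_le_normal fun p hp => ?_
      refine ⟨Quotient.out (p : G ⧸ R), Subgroup.subset_normalClosure (Or.inr ⟨p, hp, rfl⟩), ?_⟩
      exact hout p
    intro k hk
    have hkP : q k ∈ P.map q := hLP (by
      rw [Subgroup.mem_comap, MonoidHom.mem_ker.mp hk]
      exact M.one_mem)
    have h2 : (⟨q k, hkP⟩ : P.map q) ∈ Subgroup.normalClosure S₂ := by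
      rw [hS₂', MonoidHom.mem_ker]
      exact Subtype.ext (MonoidHom.mem_ker.mp hk)
    obtain ⟨w, hw, hwk⟩ := h1 h2
    have h3 : w⁻¹ * k ∈ R := QuotientGroup.eq.mp hwk
    have := W.mul_mem hw (hRW h3)
    rwa [mul_inv_cancel_left] at this

theorem IsVirtuallyPolycyclic.finitelyRelated {Q : Type u} [Group Q]
    (h : IsVirtuallyPolycyclic Q) : FinitelyRelated Q := by
  induction h with
  | of_finite G => exact finitelyRelated_of_finite G
  | of_isCyclic G => exact finitelyRelated_of_isCyclic G
  | of_extension N hN hQ ihN ihQ => exact finitelyRelated_of_extension N hN.fg ihN ihQ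

end VirtuallyPolycyclic

/-! ### Minimax series. -/

section Minimax

/-- The groups which are allowed as sections of a minimax series. -/
def IsMinimaxSection (S : Type u) [Group S] : Prop :=
  Finite S ∨ ∃ m : ℕ, 0 < m ∧ Nonempty (S ≃* Multiplicative (ZInv m))

theorem IsMinimaxSection.congr {S T : Type u} [Group S] [Group T] (h : IsMinimaxSection S)
    (e : S ≃* T) : IsMinimaxSection T := by
  rcases h with h | ⟨m, hm, ⟨f⟩⟩
  · exact Or.inl (Finite.of_equiv S e.toEquiv)
  · exact Or.inr ⟨m, hm, ⟨e.symm.trans f⟩⟩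

/-- `H` is normal in `K` and the quotient is a section of a minimax series. -/
def MinimaxStep {G : Type u} [Group G] (H K : Subgroup G) : Prop :=
  H ≤ K ∧ ∃ (S : Type u) (_ : Group S) (φ : K →* S), Function.Surjective φ ∧
    φ.ker = H.subgroupOf K ∧ IsMinimaxSection S

/-- A group with a finite subnormal series whose sections are finite or isomorphic to `ℤ[1/m]`. -/
def HasMinimaxSeries (G : Type u) [Group G] : Prop :=
  Relation.ReflTransGen (MinimaxStep (G := G)) ⊥ ⊤

theorem MinimaxStep.map {G K : Type u} [Group G] [Group K] (f : K →* G)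
    (hf : Function.Injective f) {A B : Subgroup K} (h : MinimaxStep A B) :
    MinimaxStep (A.map f) (B.map f) := by
  obtain ⟨hAB, S, _, φ, hφ, hker, hS⟩ := h
  refine ⟨Subgroup.map_mono hAB, S, inferInstance,
    φ.comp (B.equivMapOfInjective f hf).symm.toMonoidHom,
    hφ.comp (B.equivMapOfInjective f hf).symm.surjective, ?_, hS⟩
  ext x
  obtain ⟨b, rfl⟩ := (B.equivMapOfInjective f hf).surjective x
  have h1 : b ∈ φ.ker ↔ (b : K) ∈ A := by rw [hker]; rfl
  rw [MonoidHom.mem_ker] at h1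
  rw [MonoidHom.mem_ker, Subgroup.mem_subgroupOf]
  simp only [MonoidHom.comp_apply, MulEquiv.toMonoidHom_eq_coe, MonoidHom.coe_coe,
    MulEquiv.symm_apply_apply, h1, Subgroup.coe_equivMapOfInjective_apply]
  exact (Subgroup.mem_map_iff_mem hf).symm

theorem MinimaxStep.comap {G Q : Type u} [Group G] [Group Q] (f : G →* Q)
    (hf : Function.Surjective f) {A B : Subgroup Q} (h : MinimaxStep A B) :
    MinimaxStep (A.comap f) (B.comap f) := by
  obtain ⟨hAB, S, _, φ, hφ, hker, hS⟩ := h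
  refine ⟨Subgroup.comap_mono hAB, S, inferInstance, φ.comp (f.subgroupComap B),
    hφ.comp (f.subgroupComap_surjective_of_surjective B hf), ?_, hS⟩
  ext x
  have h1 : f.subgroupComap B x ∈ φ.ker ↔ f x ∈ A := by rw [hker]; rfl
  exact h1

/-- Push a series of `N` forward, pull one of `G ⧸ N` back, and join them at `N`. -/
theorem HasMinimaxSeries.of_extension {G : Type u} [Group G] (N : Subgroup G) [N.Normal]
    (hN : HasMinimaxSeries N) (hQ : HasMinimaxSeries (G ⧸ N)) : HasMinimaxSeries G := by
  have h1 : Relation.ReflTransGen MinimaxStep ((⊥ : Subgroup N).map N.subtype)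
      ((⊤ : Subgroup N).map N.subtype) := hN.lift (Subgroup.map N.subtype) fun _ _ h => h.map N.subtype N.subtype_injective
  have h2 : Relation.ReflTransGen MinimaxStep
      ((⊥ : Subgroup (G ⧸ N)).comap (QuotientGroup.mk' N))
      ((⊤ : Subgroup (G ⧸ N)).comap (QuotientGroup.mk' N)) := hQ.lift (Subgroup.comap (QuotientGroup.mk' N)) fun _ _ h =>
    h.comap _ (QuotientGroup.mk'_surjective N)
  rw [Subgroup.map_bot, ← MonoidHom.range_eq_map, Subgroup.range_subtype] at h1
  rw [MonoidHom.comap_bot, QuotientGroup.ker_mk', Subgroup.comap_top] at h2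
  exact h1.trans h2

theorem HasMinimaxSeries.of_section {G : Type u} [Group G] (h : IsMinimaxSection G) :
    HasMinimaxSeries G := by
  refine Relation.ReflTransGen.single ⟨bot_le, G, inferInstance, (⊤ : Subgroup G).subtype,
    fun g => ⟨⟨g, Subgroup.mem_top g⟩, rfl⟩, ?_, h⟩
  ext x
  rw [MonoidHom.mem_ker, Subgroup.mem_subgroupOf, Subgroup.mem_bot]
  rfl

/-- The relational form, with sections given by a surjection and its kernel, is convenient under
images and preimages; here it becomes an indexed chain with actual quotients. -/
theorem HasMinimaxSeries.exists_series {G : Type u} [Group G] (h : HasMinimaxSeries G) :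
    ∃ (n : ℕ) (H : ℕ → Subgroup G), H 0 = ⊥ ∧ H n = ⊤ ∧
      ∀ i < n, H i ≤ H (i + 1) ∧
        ∃ _ : ((H i).subgroupOf (H (i + 1))).Normal,
          Finite (H (i + 1) ⧸ (H i).subgroupOf (H (i + 1))) ∨
          ∃ m : ℕ, 0 < m ∧
            Nonempty ((H (i + 1) ⧸ (H i).subgroupOf (H (i + 1))) ≃* Multiplicative (ZInv m)) := by
  suffices ∀ A B : Subgroup G, Relation.ReflTransGen (MinimaxStep (G := G)) A B →
      ∃ (n : ℕ) (H : ℕ → Subgroup G), H 0 = A ∧ H n = B ∧ ∀ i < n, MinimaxStep (H i) (H (i + 1)) by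
    obtain ⟨n, H, h0, hn, hH⟩ := this _ _ h
    refine ⟨n, H, h0, hn, fun i hi => ?_⟩
    obtain ⟨hle, S, _, φ, hφ, hker, hS⟩ := hH i hi
    refine ⟨hle, ?_⟩
    have hnormal : ((H i).subgroupOf (H (i + 1))).Normal := hker ▸ φ.normal_ker
    refine ⟨hnormal, ?_⟩
    exact hS.congr ((QuotientGroup.quotientKerEquivOfSurjective φ hφ).symm.trans
      (QuotientGroup.quotientMulEquivOfEq hker))
  intro A B hAB
  induction hAB with
  | refl => exact ⟨0, fun _ => A, rfl, rfl, fun i hi => absurd hi (Nat.not_lt_zero i)⟩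
  | @tail B C _ hBC ih =>
    obtain ⟨n, H, h0, hn, hH⟩ := ih
    refine ⟨n + 1, fun i => if i ≤ n then H i else C, ?_, ?_, ?_⟩
    · simpa using h0
    · simp
    · intro i hi
      rcases Nat.lt_succ_iff_lt_or_eq.mp hi with hi | rfl
      · simpa [hi.le, Nat.succ_le_iff.mpr hi] using hH i hi
      · simpa [hn] using hBC

theorem nonempty_mulEquiv_zInv_one {G : Type u} [Group G] [IsCyclic G] [Infinite G] :
    Nonempty (G ≃* Multiplicative (ZInv 1)) := by
  obtain ⟨g, hg⟩ := IsCyclic.exists_zpow_surjective (G := G)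
  have hg0 : ¬ IsOfFinOrder g := by
    rw [← infinite_zpowers]
    have : (Subgroup.zpowers g : Set G) = Set.univ := Set.eq_univ_of_forall fun x => hg x
    rw [this]
    exact Set.infinite_univ
  have hinj : Function.Injective (zpowersHom G g) := by
    rw [injective_iff_map_eq_one]
    intro k hk
    by_contra h0
    exact hg0 (isOfFinOrder_iff_zpow_eq_one.mpr ⟨k.toAdd, h0, by simpa using hk⟩)
  let e : Multiplicative ℤ ≃* G := MulEquiv.ofBijective (zpowersHom G g)
    ⟨hinj, fun x => (hg x).imp fun k hk => by rw [zpowersHom_apply]; exact hk⟩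
  have hle : Submonoid.powers ((1 : ℕ) : ℤ) ≤ IsUnit.submonoid ℤ := by
    rw [Submonoid.powers_le]
    exact ⟨1, by simp⟩
  exact ⟨e.symm.trans (AddEquiv.toMultiplicative
    (IsLocalization.atUnits ℤ (Submonoid.powers ((1 : ℕ) : ℤ)) hle :
      ℤ ≃ₐ[ℤ] ZInv 1).toRingEquiv.toAddEquiv)⟩

theorem IsVirtuallyPolycyclic.hasMinimaxSeries {G : Type u} [Group G]
    (h : IsVirtuallyPolycyclic G) : HasMinimaxSeries G := by
  induction h with
  | of_finite G => exact .of_section (Or.inl inferInstance)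
  | of_isCyclic G =>
    rcases finite_or_infinite G with hf | hi
    · exact .of_section (Or.inl hf)
    · exact .of_section (Or.inr ⟨1, one_pos, nonempty_mulEquiv_zInv_one⟩)
  | of_extension N _ _ ihN ihQ => exact .of_extension N ihN ihQ

end Minimax

/-! ### Torsion-free groups of rank one and ℤ[1/D]. -/

section RankOne

theorem exists_smul_eq_of_isCoprime {M : Type*} [AddCommGroup M] {p : ℤ} {n : ℤ} (h : IsCoprime p n) {x y : M}
    (hxy : n • x = p • y) : ∃ z, x = p • z := by
  obtain ⟨a, b, hab⟩ := h
  refine ⟨a • x + b • y, ?_⟩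
  calc x = (a * p + b * n : ℤ) • x := by rw [hab, one_smul]
    _ = (a * p) • x + b • n • x := by rw [add_smul, mul_smul b n]
    _ = p • (a • x + b • y) := by rw [hxy]; module

variable {M : Type*} [AddCommGroup M] [IsAddTorsionFree M]

/-- A torsion-free group all of whose elements have an `m`-power multiple in one cyclic subgroup
is of this kind for some `D` by which it is divisible. -/
theorem exists_divisible_of_pow_smul_mem (m : ℕ) : 0 < m → ∀ e : M, e ≠ 0 →
    (∀ a : M, ∃ k : ℕ, ∃ n : ℤ, ((m : ℤ) ^ k) • a = n • e) →
    ∃ D : ℕ, 0 < D ∧ ∃ e' : M, e' ≠ 0 ∧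
      (∀ a : M, ∃ k : ℕ, ∃ n : ℤ, ((D : ℤ) ^ k) • a = n • e') ∧ ∀ a : M, ∃ b, a = (D : ℤ) • b := by
  induction m using Nat.strong_induction_on with
  | _ m ih =>
  intro hm e he h
  by_cases hdiv : ∀ a : M, ∃ b, a = (m : ℤ) • b
  · exact ⟨m, hm, e, he, h, hdiv⟩
  -- Divisibility by all prime factors of `m` would give divisibility by `m`. A prime `p` with `pM ≠
  -- M` is superfluous: after replacing `e` by a maximal `p`-power root, the part `m'` of `m` prime
  -- to `p` suffices.
  obtain ⟨p, hp, hpm, a₀, ha₀⟩ : ∃ p : ℕ, p.Prime ∧ p ∣ m ∧ ∃ a : M, ∀ b, a ≠ (p : ℤ) • b := by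
    by_contra hcon
    push Not at hcon
    apply hdiv
    suffices ∀ l : ℕ, l ∣ m → ∀ a : M, ∃ b, a = (l : ℤ) • b from this m dvd_rfl
    intro l
    induction l using Nat.recOnMul with
    | zero => exact fun h0 => absurd (Nat.eq_zero_of_zero_dvd h0) hm.ne'
    | one => exact fun _ a => ⟨a, by simp⟩
    | prime p hp => exact fun hpm a => hcon p hp hpm a
    | mul x y hx hy =>
      intro hxy a
      obtain ⟨b, hb⟩ := hx (dvd_of_mul_right_dvd hxy) a
      obtain ⟨c, hc⟩ := hy (dvd_of_mul_left_dvd hxy) b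
      exact ⟨c, by rw [hb, hc, smul_smul]; push_cast; rfl⟩
  have hpZ : Prime (p : ℤ) := Nat.prime_iff_prime_int.mp hp
  obtain ⟨s, m', hpm', hms⟩ := Nat.exists_eq_pow_mul_and_not_dvd hm.ne' p hp.ne_one
  have hs : s ≠ 0 := by
    rintro rfl
    rw [pow_zero, one_mul] at hms
    exact hpm' (hms ▸ hpm)
  have hm' : 0 < m' := Nat.pos_of_ne_zero (by rintro rfl; exact hpm' (dvd_zero p))
  have hlt : m' < m := by
    rw [hms]
    exact lt_mul_of_one_lt_left hm' (Nat.one_lt_pow hs hp.one_lt)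
  have hcop : ∀ j : ℕ, IsCoprime (p : ℤ) ((m' : ℤ) ^ j) := fun j => by
    have : IsCoprime (p : ℤ) (m' : ℤ) := by
      rw [Nat.isCoprime_iff_coprime]
      exact (hp.coprime_iff_not_dvd).mpr hpm'
    exact this.pow_right
  have hsplit : ∀ j : ℕ, ((m : ℤ) ^ j) = (p : ℤ) ^ (s * j) * (m' : ℤ) ^ j := fun j => by
    rw [hms]
    push_cast
    rw [mul_pow, ← pow_mul]
  have hp0 : ∀ j : ℕ, ((p : ℤ) ^ j) ≠ 0 := fun j => pow_ne_zero _ hpZ.ne_zero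
  -- If `e` were divisible by all powers of `p`, then `m' ^ j • a₀` would lie in `pM` for some `j`,
  -- and so would `a₀` by coprimality.
  have hbound : ∃ k : ℕ, ¬ ∃ b : M, e = ((p : ℤ) ^ k) • b := by
    by_contra hcon
    push Not at hcon
    obtain ⟨j, n, hjn⟩ := h a₀
    obtain ⟨b, hb⟩ := hcon (s * j + 1)
    have h1 : ((m' : ℤ) ^ j) • a₀ = (p : ℤ) • (n • b) := by
      apply zsmul_right_injective (hp0 (s * j))
      change ((p : ℤ) ^ (s * j)) • (((m' : ℤ) ^ j) • a₀) = ((p : ℤ) ^ (s * j)) • ((p : ℤ) • (n • b))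
      rw [smul_smul, ← hsplit, hjn, hb, smul_smul, smul_smul, smul_smul, pow_succ]
      congr 1
      ring
    obtain ⟨z, hz⟩ := exists_smul_eq_of_isCoprime (hcop j) h1
    exact ha₀ z hz
  classical
  obtain ⟨k, hk⟩ : ∃ k : ℕ, Nat.find hbound = k + 1 := by
    refine Nat.exists_eq_succ_of_ne_zero fun h0 => ?_
    have := Nat.find_spec hbound
    rw [h0] at this
    exact this ⟨e, by simp⟩
  obtain ⟨e', he'⟩ : ∃ b : M, e = ((p : ℤ) ^ k) • b := by
    by_contra hcon
    exact Nat.find_min hbound (by omega : k < Nat.find hbound) hcon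
  have he'p : ∀ b, e' ≠ (p : ℤ) • b := by
    rintro b rfl
    have := Nat.find_spec hbound
    rw [hk] at this
    exact this ⟨b, by rw [he', smul_smul, pow_succ]⟩
  have he'0 : e' ≠ 0 := by
    rintro rfl
    exact he (by rw [he', smul_zero])
  refine ih m' hlt hm' e' he'0 fun a => ?_
  obtain ⟨j, n, hjn⟩ := h a
  refine ⟨j, ?_⟩
  replace hjn : ((p : ℤ) ^ (s * j)) • (((m' : ℤ) ^ j) • a) = (n * (p : ℤ) ^ k) • e' := by
    rw [smul_smul, ← hsplit, hjn, he', smul_smul]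
  generalize n * (p : ℤ) ^ k = n' at hjn
  generalize s * j = i at hjn
  -- The factors `p` are cancelled one at a time: since `e'` is not in `pM`, a relation `p • x = n'
  -- • e'` forces `p ∣ n'`.
  induction i generalizing n' with
  | zero => exact ⟨n', by simpa using hjn⟩
  | succ i ihi =>
    replace hjn : (p : ℤ) • (((p : ℤ) ^ i) • (((m' : ℤ) ^ j) • a)) = n' • e' := by
      rw [← hjn, pow_succ', mul_smul]
    have hdvd : (p : ℤ) ∣ n' := by
      by_contra hnd
      obtain ⟨z, hz⟩ := exists_smul_eq_of_isCoprime (hpZ.coprime_iff_not_dvd.mpr hnd) hjn.symm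
      exact he'p z hz
    obtain ⟨n'', rfl⟩ := hdvd
    rw [mul_smul] at hjn
    exact ihi n'' (zsmul_right_injective hpZ.ne_zero hjn)

/-- Both `M` and ℤ[1/D] will be recognized as localizations of ℤ at the powers of `D`, so uniqueness
of localization provides the isomorphism. -/
theorem isLocalizedModule_toSpanSingleton {D : ℕ} (hD : 0 < D) {e : M} (he : e ≠ 0)
    (hpow : ∀ a : M, ∃ k : ℕ, ∃ n : ℤ, ((D : ℤ) ^ k) • a = n • e)
    (hdiv : ∀ a : M, ∃ b, a = (D : ℤ) • b) :
    IsLocalizedModule (Submonoid.powers (D : ℤ)) (LinearMap.toSpanSingleton ℤ M e) := by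
  have hD0 : (D : ℤ) ≠ 0 := Int.natCast_ne_zero.mpr hD.ne'
  refine ⟨?_, ?_, ?_⟩
  · rintro ⟨_, k, rfl⟩
    have : IsUnit (algebraMap ℤ (Module.End ℤ M) (D : ℤ)) := by
      rw [Module.End.isUnit_iff]
      refine ⟨zsmul_right_injective hD0, fun a => ?_⟩
      obtain ⟨b, hb⟩ := hdiv a
      exact ⟨b, hb.symm⟩
    rw [map_pow]
    exact this.pow k
  · intro a
    obtain ⟨k, n, hkn⟩ := hpow a
    exact ⟨⟨n, ⟨(D : ℤ) ^ k, k, rfl⟩⟩, hkn⟩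
  · intro x y hxy
    have hxy : x • e = y • e := hxy
    have hne : x = y := by
      by_contra hne
      refine he (zsmul_right_injective (sub_ne_zero.mpr hne) ?_)
      change (x - y) • e = (x - y) • 0
      rw [smul_zero, sub_smul, hxy, sub_self]
    exact ⟨1, by rw [hne]⟩

theorem zInv_algebraMap_injective {D : ℕ} (hD : 0 < D) :
    Function.Injective (algebraMap ℤ (ZInv D)) :=
  IsLocalization.injective (ZInv D) (M := Submonoid.powers (D : ℤ))
    (powers_le_nonZeroDivisors_of_noZeroDivisors (Int.natCast_ne_zero.mpr hD.ne'))

theorem zInv_isAddTorsionFree {D : ℕ} (hD : 0 < D) : IsAddTorsionFree (ZInv D) := by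
  have : IsDomain (ZInv D) := IsLocalization.isDomain_localization
    (powers_le_nonZeroDivisors_of_noZeroDivisors (Int.natCast_ne_zero.mpr hD.ne'))
  have : CharZero (ZInv D) := charZero_of_injective_algebraMap (zInv_algebraMap_injective hD)
  infer_instance

theorem zInv_exists_eq_smul (D : ℕ) (a : ZInv D) : ∃ b, a = (D : ℤ) • b := by
  obtain ⟨u, hu⟩ := IsLocalization.Away.algebraMap_isUnit (S := ZInv D) (D : ℤ)
  refine ⟨(↑u⁻¹ : ZInv D) * a, ?_⟩
  rw [zsmul_eq_mul, ← mul_assoc, ← eq_intCast (algebraMap ℤ (ZInv D)), ← hu, Units.mul_inv, one_mul]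

theorem zInv_exists_pow_smul_eq (D : ℕ) (a : ZInv D) :
    ∃ k : ℕ, ∃ n : ℤ, ((D : ℤ) ^ k) • a = n • (1 : ZInv D) := by
  obtain ⟨⟨n, ⟨_, k, rfl⟩⟩, h⟩ := IsLocalization.surj (Submonoid.powers (D : ℤ)) a
  refine ⟨k, n, ?_⟩
  rw [zsmul_eq_mul, zsmul_eq_mul, mul_one, mul_comm, ← eq_intCast (algebraMap ℤ (ZInv D)),
    ← eq_intCast (algebraMap ℤ (ZInv D)) n]
  exact h

theorem nonempty_addEquiv_zInv {m : ℕ} (hm : 0 < m) {e : M} (he : e ≠ 0)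
    (h : ∀ a : M, ∃ k : ℕ, ∃ n : ℤ, ((m : ℤ) ^ k) • a = n • e) :
    ∃ D : ℕ, 0 < D ∧ Nonempty (M ≃+ ZInv D) := by
  obtain ⟨D, hD, e', he', hpow, hdiv⟩ := exists_divisible_of_pow_smul_mem m hm e he h
  have h1 := isLocalizedModule_toSpanSingleton hD he' hpow hdiv
  have := zInv_isAddTorsionFree hD
  have hone : (1 : ZInv D) ≠ 0 := by
    intro h0
    have := zInv_algebraMap_injective hD ((map_one _).trans (h0.trans (map_zero _).symm))
    exact one_ne_zero this
  have h2 := isLocalizedModule_toSpanSingleton hD hone (zInv_exists_pow_smul_eq D)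
    (zInv_exists_eq_smul D)
  exact ⟨D, hD, ⟨(IsLocalizedModule.linearEquiv (Submonoid.powers (D : ℤ))
    (LinearMap.toSpanSingleton ℤ M e') (LinearMap.toSpanSingleton ℤ (ZInv D) 1)).toAddEquiv⟩⟩

end RankOne

/-! ### Abelian groups with bounded denominators. -/

section PowerBounded

/-- Up to powers of a fixed number, all elements lie in one finitely generated subgroup. -/
def IsFGUpToPowers (A : Type u) [Group A] : Prop :=
  ∃ m : ℕ, 0 < m ∧ ∃ B : Subgroup A, B.FG ∧ ∀ a : A, ∃ k : ℕ, a ^ m ^ k ∈ B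

/-- Each division by an element of infinite order lowers the length by one, until the quotient is
torsion. The exponent `l` still depends on `a`. -/
theorem exists_fg_forall_pow_mem (n : ℕ) : ∀ {A : Type u} [CommGroup A], hirschLength A ≤ n →
    ∃ S : Finset A, ∀ a : A, ∃ l : ℕ, 0 < l ∧ a ^ l ∈ Subgroup.closure (S : Set A) := by
  classical
  induction n with
  | zero =>
    intro A _ hh
    refine ⟨∅, fun a => ?_⟩
    obtain ⟨l, hl, hal⟩ := isOfFinOrder_iff_pow_eq_one.mp
      (isOfFinOrder_of_hirschLength_eq_zero (le_antisymm hh bot_le) a)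
    exact ⟨l, hl, hal ▸ Subgroup.one_mem _⟩
  | succ n ih =>
    intro A _ hh
    by_cases htors : ∀ a : A, IsOfFinOrder a
    · refine ⟨∅, fun a => ?_⟩
      obtain ⟨l, hl, hal⟩ := isOfFinOrder_iff_pow_eq_one.mp (htors a)
      exact ⟨l, hl, hal ▸ Subgroup.one_mem _⟩
    push Not at htors
    obtain ⟨e, he⟩ := htors
    have hq : hirschLength (A ⧸ Subgroup.zpowers e) ≤ n := by
      rw [hirschLength_eq_quotient_add (Subgroup.zpowers e), hirschLength_zpowers he, add_comm] at hh
      push_cast at hh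
      exact (ENat.add_le_add_iff_right ENat.one_ne_top).mp hh
    obtain ⟨S, hS⟩ := ih hq
    refine ⟨insert e (S.image Quotient.out), fun a => ?_⟩
    set C := Subgroup.closure ((insert e (S.image Quotient.out) : Finset A) : Set A) with hC
    have heC : e ∈ C := Subgroup.subset_closure (by simp)
    have hSC : Subgroup.closure (S : Set (A ⧸ Subgroup.zpowers e)) ≤
        C.map (QuotientGroup.mk' (Subgroup.zpowers e)) := by
      rw [Subgroup.closure_le]
      intro x hx
      refine ⟨Quotient.out x, Subgroup.subset_closure ?_, QuotientGroup.out_eq' x⟩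
      rw [Finset.coe_insert, Finset.coe_image]
      exact Or.inr ⟨x, hx, rfl⟩
    obtain ⟨l, hl, hal⟩ := hS (a : A ⧸ Subgroup.zpowers e)
    refine ⟨l, hl, ?_⟩
    obtain ⟨c, hc, hca⟩ := hSC hal
    have h1 : c⁻¹ * a ^ l ∈ Subgroup.zpowers e := QuotientGroup.eq.mp hca
    have h2 := C.mul_mem hc ((Subgroup.zpowers_le.mpr heC) h1)
    rwa [mul_inv_cancel_left] at h2

theorem exists_pow_mem_of_finite {G : Type u} [Group G] (B : Subgroup G) {Y : Set G}
    (hY : Y.Finite) (h : ∀ y ∈ Y, ∃ l : ℕ, 0 < l ∧ y ^ l ∈ B) :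
    ∃ m : ℕ, 0 < m ∧ ∀ y ∈ Y, y ^ m ∈ B := by
  induction Y, hY using Set.Finite.induction_on with
  | empty => exact ⟨1, one_pos, fun y hy => hy.elim⟩
  | @insert a Y _ _ ih =>
    obtain ⟨m, hm, hm'⟩ := ih fun y hy => h y (Or.inr hy)
    obtain ⟨l, hl, hl'⟩ := h a (Or.inl rfl)
    refine ⟨l * m, Nat.mul_pos hl hm, ?_⟩
    rintro y (rfl | hy)
    · rw [pow_mul]
      exact B.pow_mem hl' m
    · rw [mul_comm, pow_mul]
      exact B.pow_mem (hm' y hy) l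

/-- Choose a finitely generated `B` containing `S` with torsion quotient `A / B`. Finitely many
conjugates of generators need only one exponent `m`, so conjugation by a generator of `G` carries
`B` into `B` up to `m`-th powers. The elements with some `m ^ k`-th power in `B` thus form a normal
subgroup containing `S`. -/
theorem isFGUpToPowers_of_normalClosure {G : Type u} [Group G] [hG : Group.FG G] (A : Subgroup G)
    [hAn : A.Normal] (hc : ∀ x ∈ A, ∀ y ∈ A, x * y = y * x) (hh : hirschLength A ≠ ⊤) {S : Set G}
    (hS : S.Finite) (hSA : Subgroup.normalClosure S = A) : IsFGUpToPowers A := by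
  let _ : CommGroup A := { mul_comm := fun x y => Subtype.ext (hc x x.2 y y.2) }
  obtain ⟨n, hn⟩ := ENat.ne_top_iff_exists.mp hh
  obtain ⟨T, hT⟩ := exists_fg_forall_pow_mem n hn.ge
  obtain ⟨X, hX⟩ := Group.fg_def.mp hG
  have hSsub : S ⊆ A := hSA ▸ Subgroup.subset_normalClosure
  set T' : Set G := A.subtype '' (T : Set A) ∪ S with hT'
  have hT'fin : T'.Finite := (T.finite_toSet.image _).union hS
  set B := Subgroup.closure T' with hB
  have hT'A : T' ⊆ A := by
    rintro x (⟨y, -, rfl⟩ | hx)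
    · exact y.2
    · exact hSsub hx
  have hBA : B ≤ A := (Subgroup.closure_le _).mpr hT'A
  have hAB : ∀ a ∈ A, ∃ l : ℕ, 0 < l ∧ a ^ l ∈ B := by
    intro a ha
    obtain ⟨l, hl, hal⟩ := hT ⟨a, ha⟩
    refine ⟨l, hl, ?_⟩
    have h1 : (Subgroup.closure (T : Set A)).map A.subtype ≤ B := by
      rw [MonoidHom.map_closure]
      exact Subgroup.closure_mono Set.subset_union_left
    exact h1 ⟨_, hal, rfl⟩
  set X' : Set G := (X : Set G) ∪ (X : Set G)⁻¹ with hX'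
  have hX'fin : X'.Finite := X.finite_toSet.union X.finite_toSet.inv
  obtain ⟨m, hm, hmY⟩ := exists_pow_mem_of_finite B
    (hX'fin.image2 (fun x t => x * t * x⁻¹) hT'fin) (by
      rintro _ ⟨x, -, t, ht, rfl⟩
      exact hAB _ (hAn.conj_mem t (hT'A ht) x))
  have hconj : ∀ x ∈ X', ∀ b ∈ B, (x * b * x⁻¹) ^ m ∈ B := by
    intro x hx b hb
    have hmem : ∀ b ∈ B, x * b * x⁻¹ ∈ A := fun b hb => hAn.conj_mem b (hBA hb) x
    induction hb using Subgroup.closure_induction with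
    | mem t ht => exact hmY _ ⟨x, hx, t, ht, rfl⟩
    | one => simp [B.one_mem]
    | mul u v hu hv ihu ihv =>
      have : x * (u * v) * x⁻¹ = (x * u * x⁻¹) * (x * v * x⁻¹) := by group
      rw [this, Commute.mul_pow (hc _ (hmem u hu) _ (hmem v hv))]
      exact B.mul_mem ihu ihv
    | inv u _ ihu =>
      have : x * u⁻¹ * x⁻¹ = (x * u * x⁻¹)⁻¹ := by group
      rw [this, inv_pow]
      exact B.inv_mem ihu
  have hup : ∀ (a : G) (k l : ℕ), a ^ m ^ k ∈ B → a ^ m ^ (k + l) ∈ B := by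
    intro a k l h
    rw [pow_add, pow_mul]
    exact B.pow_mem h _
  let E : Subgroup G :=
    { carrier := {a | a ∈ A ∧ ∃ k : ℕ, a ^ m ^ k ∈ B}
      one_mem' := ⟨A.one_mem, 0, by simp [B.one_mem]⟩
      mul_mem' := by
        rintro a b ⟨ha, k, hk⟩ ⟨hb, l, hl⟩
        refine ⟨A.mul_mem ha hb, k + l, ?_⟩
        rw [Commute.mul_pow (hc a ha b hb)]
        exact B.mul_mem (hup a k l hk) (add_comm l k ▸ hup b l k hl)
      inv_mem' := by
        rintro a ⟨ha, k, hk⟩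
        exact ⟨A.inv_mem ha, k, by rw [inv_pow]; exact B.inv_mem hk⟩ }
  have hEn : E.Normal := by
    rw [← Subgroup.closure_eq E]
    refine closure_normal_of_generators hX ?_
    rintro x hx a ⟨ha, k, hk⟩
    rw [Subgroup.closure_eq E]
    have hx' : x ∈ X' := hx
    refine ⟨hAn.conj_mem a ha x, k + 1, ?_⟩
    rw [pow_succ, pow_mul, conj_pow]
    exact hconj x hx' _ hk
  have hAE : A ≤ E := by
    rw [← hSA]
    refine Subgroup.normalClosure_le_normal fun s hs => ?_
    exact ⟨hSsub hs, 0, by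
      rw [pow_zero, pow_one]
      exact Subgroup.subset_closure (Or.inr hs)⟩
  refine ⟨m, hm, B.subgroupOf A, ?_, fun a => (hAE a.2).2⟩
  rw [← Group.fg_iff_subgroup_fg]
  have : Group.FG B := (Group.fg_iff_subgroup_fg B).mpr ((Subgroup.fg_iff B).mpr ⟨T', rfl, hT'fin⟩)
  exact Group.fg_of_surjective (f := (Subgroup.subgroupOfEquivOfLe hBA).symm.toMonoidHom)
    (Subgroup.subgroupOfEquivOfLe hBA).symm.surjective

theorem TorsionFreeGroup.isAddTorsionFree {A : Type u} [CommGroup A] (h : TorsionFreeGroup A) :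
    IsAddTorsionFree (Additive A) := by
  have h2 : IsMulTorsionFree A := by
    refine ⟨fun n hn a b hab => ?_⟩
    have hab : a ^ n = b ^ n := hab
    have : (a * b⁻¹) ^ n = 1 := by rw [mul_pow, inv_pow, hab, mul_inv_cancel]
    exact mul_inv_eq_one.mp (h.eq_one (Nat.pos_of_ne_zero hn) this)
  infer_instance

theorem IsFGUpToPowers.nonempty_mulEquiv_zInv {A : Type u} [CommGroup A] (hP : IsFGUpToPowers A)
    (htf : TorsionFreeGroup A) {e : A} (he : e ≠ 1)
    (hrank : ∀ a : A, ∃ l : ℕ, 0 < l ∧ a ^ l ∈ Subgroup.zpowers e) :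
    ∃ D : ℕ, 0 < D ∧ Nonempty (A ≃* Multiplicative (ZInv D)) := by
  obtain ⟨m, hm, B, ⟨T, hT⟩, hB⟩ := hP
  obtain ⟨l, hl, hlT⟩ := exists_pow_mem_of_finite (Subgroup.zpowers e) T.finite_toSet
    fun y _ => hrank y
  have hlB : B ≤ (Subgroup.zpowers e).comap (powMonoidHom l) := by
    rw [← hT, Subgroup.closure_le]
    exact hlT
  have := htf.isAddTorsionFree
  obtain ⟨D, hD, ⟨f⟩⟩ := nonempty_addEquiv_zInv (M := Additive A) (m := m * l)
    (Nat.mul_pos hm hl) (e := Additive.ofMul e) he (by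
      intro a
      obtain ⟨k, hk⟩ := hB a.toMul
      -- The exponent `k + 1` guarantees that `(m * l) ^ (k + 1)` contains a factor `l`, needed to
      -- pass from `B` to the powers of `e`.
      have h1 : a.toMul ^ m ^ (k + 1) ∈ B := by
        rw [pow_succ, pow_mul]
        exact B.pow_mem hk m
      obtain ⟨j, hj⟩ := hlB h1
      have hj : e ^ j = (a.toMul ^ m ^ (k + 1)) ^ l := hj
      refine ⟨k + 1, j * (l : ℤ) ^ k, ?_⟩
      have h2 : a.toMul ^ ((m * l) ^ (k + 1)) = e ^ (j * (l : ℤ) ^ k) := by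
        rw [zpow_mul, hj, mul_pow, pow_succ l k, ← pow_mul, mul_comm (l ^ k) l, ← mul_assoc,
          pow_mul _ _ (l ^ k)]
        exact_mod_cast rfl
      have h3 : a.toMul ^ (((m * l : ℕ) : ℤ) ^ (k + 1)) = e ^ (j * (l : ℤ) ^ k) := by
        rw [← h2]
        exact_mod_cast zpow_natCast a.toMul ((m * l) ^ (k + 1))
      exact h3)
  exact ⟨D, hD, ⟨AddEquiv.toMultiplicativeRight f⟩⟩

theorem subgroup_fg_of_comm {A : Type u} [CommGroup A] [Group.FG A] (B : Subgroup A) : B.FG := by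
  have : Module.Finite ℤ (Additive A) := Module.Finite.iff_addGroup_fg.mpr inferInstance
  have hN : IsNoetherian ℤ (Additive A) := inferInstance
  have := hN.noetherian (AddSubgroup.toIntSubmodule (Subgroup.toAddSubgroup B))
  rw [Submodule.fg_iff_addSubgroup_fg] at this
  exact (Subgroup.fg_iff_add_fg B).mpr this

/-- `B ∩ I` is finitely generated because finitely generated abelian groups are Noetherian. -/
theorem IsFGUpToPowers.subgroup {A : Type u} [CommGroup A] (hP : IsFGUpToPowers A)
    (I : Subgroup A) : IsFGUpToPowers I := by
  obtain ⟨m, hm, B, hBfg, hB⟩ := hP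
  refine ⟨m, hm, B.subgroupOf I, ?_, fun a => hB a⟩
  have h1 : Group.FG B := (Group.fg_iff_subgroup_fg B).mpr hBfg
  have h2 : Group.FG (I.subgroupOf B) :=
    (Group.fg_iff_subgroup_fg _).mpr (subgroup_fg_of_comm (I.subgroupOf B))
  rw [← Group.fg_iff_subgroup_fg]
  let f : I.subgroupOf B →* B.subgroupOf I :=
    ((B.subtype.comp (I.subgroupOf B).subtype).codRestrict I fun x => x.2).codRestrict
      (B.subgroupOf I) fun x => (x : B).2
  exact Group.fg_of_surjective (f := f) fun x => ⟨⟨⟨x, x.2⟩, (x : I).2⟩, rfl⟩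

theorem IsFGUpToPowers.of_surjective {A Q : Type u} [Group A] [Group Q] (hP : IsFGUpToPowers A)
    (f : A →* Q) (hf : Function.Surjective f) : IsFGUpToPowers Q := by
  obtain ⟨m, hm, B, hBfg, hB⟩ := hP
  have h1 : Group.FG B := (Group.fg_iff_subgroup_fg B).mpr hBfg
  refine ⟨m, hm, B.map f, ?_, fun a => ?_⟩
  · rw [← Group.fg_iff_subgroup_fg]
    exact Group.fg_of_surjective (f.subgroupMap_surjective B)
  obtain ⟨x, rfl⟩ := hf a
  obtain ⟨k, hk⟩ := hB x
  exact ⟨k, _, hk, map_pow f x _⟩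

theorem IsFGUpToPowers.hasMinimaxSeries (n : ℕ) : ∀ {A : Type u} [CommGroup A],
    IsFGUpToPowers A → TorsionFreeGroup A → hirschLength A ≤ n → HasMinimaxSeries A := by
  induction n with
  | zero =>
    intro A _ _ htf hh
    have := htf.subsingleton_of_hirschLength (le_antisymm hh bot_le)
    exact .of_section (Or.inl inferInstance)
  | succ n ih =>
    intro A _ hP htf hh
    by_cases htriv : ∀ a : A, a = 1
    · have : Subsingleton A := subsingleton_of_forall_eq 1 htriv
      exact .of_section (Or.inl inferInstance)
    push Not at htriv
    obtain ⟨e, he⟩ := htriv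
    -- The isolator of `e`: it has rank one, and dividing by it keeps the quotient torsion-free for
    -- the induction.
    let I : Subgroup A :=
      { carrier := {a | ∃ l : ℕ, 0 < l ∧ a ^ l ∈ Subgroup.zpowers e}
        one_mem' := ⟨1, one_pos, by simp⟩
        mul_mem' := by
          rintro a b ⟨k, hk, ha⟩ ⟨l, hl, hb⟩
          refine ⟨k * l, Nat.mul_pos hk hl, ?_⟩
          rw [mul_pow]
          refine Subgroup.mul_mem _ ?_ ?_
          · rw [pow_mul]
            exact Subgroup.pow_mem _ ha l
          · rw [mul_comm, pow_mul]
            exact Subgroup.pow_mem _ hb k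
        inv_mem' := by
          rintro a ⟨k, hk, ha⟩
          exact ⟨k, hk, by rw [inv_pow]; exact Subgroup.inv_mem _ ha⟩ }
    have heI : e ∈ I := ⟨1, one_pos, by rw [pow_one]; exact Subgroup.mem_zpowers e⟩
    have hI1 : (⟨e, heI⟩ : I) ≠ 1 := fun h => he (congrArg Subtype.val h)
    refine .of_extension I (.of_section (Or.inr ?_)) ?_
    · refine (hP.subgroup I).nonempty_mulEquiv_zInv (htf.subgroup I) hI1 ?_
      rintro ⟨a, l, hl, j, hj⟩
      exact ⟨l, hl, j, Subtype.ext hj⟩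
    · refine ih (hP.of_surjective _ (QuotientGroup.mk'_surjective I)) ?_ ?_
      · intro x hx hfin
        obtain ⟨a, rfl⟩ := QuotientGroup.mk_surjective x
        obtain ⟨k, hk, hak⟩ := isOfFinOrder_iff_pow_eq_one.mp hfin
        rw [← QuotientGroup.mk_pow, QuotientGroup.eq_one_iff] at hak
        obtain ⟨l, hl, hal⟩ := hak
        apply hx
        rw [QuotientGroup.eq_one_iff]
        exact ⟨k * l, Nat.mul_pos hk hl, by rwa [pow_mul]⟩
      · have h1 := (htf.subgroup I).one_le_hirschLength hI1
        rw [hirschLength_eq_quotient_add I, add_comm] at hh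
        have h2 := (add_le_add (le_refl (hirschLength (A ⧸ I))) h1).trans hh
        push_cast at h2
        exact (ENat.add_le_add_iff_right ENat.one_ne_top).mp h2

/-- An injective homomorphism from `B` to an `m`-divisible torsion-free group extends to a group all
of whose elements have an `m`-power multiple in `B`. -/
theorem exists_injective_extension {M W : Type*} [AddCommGroup M] [AddCommGroup W]
    [IsAddTorsionFree M] [IsAddTorsionFree W] {m : ℕ} (hm : 0 < m)
    (hW : ∀ w : W, ∃ w', w = m • w') (B : AddSubgroup M) (hB : ∀ a : M, ∃ k : ℕ, m ^ k • a ∈ B)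
    (j : B →+ W) (hj : Function.Injective j) : ∃ f : M →+ W, Function.Injective f := by
  have hWk : ∀ (k : ℕ) (w : W), ∃ w', w = m ^ k • w' := by
    intro k
    induction k with
    | zero => exact fun w => ⟨w, by simp⟩
    | succ k ih =>
      intro w
      obtain ⟨w', rfl⟩ := ih w
      obtain ⟨w'', rfl⟩ := hW w'
      exact ⟨w'', by rw [pow_succ, mul_nsmul']⟩
  choose k hk using hB
  -- `f a` is `j (m ^ k a • a)` divided by `m ^ k a`. Torsion-freeness of `W` makes it independent
  -- of the exponent, which gives additivity.
  choose f hf using fun a : M => hWk (k a) (j ⟨_, hk a⟩)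
  have hup : ∀ (a : M) (l : ℕ), m ^ (k a + l) • a ∈ B := by
    intro a l
    rw [pow_add, mul_comm, mul_nsmul']
    exact B.nsmul_mem (hk a) _
  have hkey : ∀ (a : M) (l : ℕ) (hl : m ^ l • a ∈ B), m ^ l • f a = j ⟨_, hl⟩ := by
    intro a l hl
    apply nsmul_right_injective (pow_pos hm (k a)).ne'
    change m ^ k a • m ^ l • f a = m ^ k a • j ⟨_, hl⟩
    rw [← mul_nsmul', mul_comm, mul_nsmul', ← hf, ← map_nsmul, ← map_nsmul]
    congr 1
    apply Subtype.ext
    change m ^ l • m ^ k a • a = m ^ k a • m ^ l • a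
    rw [← mul_nsmul', mul_comm, mul_nsmul']
  refine ⟨AddMonoidHom.mk' f fun a b => ?_, ?_⟩
  · have ha := hup a (k b)
    have hb := hup b (k a)
    rw [add_comm] at hb
    have hab : m ^ (k a + k b) • (a + b) ∈ B := by
      rw [nsmul_add]
      exact B.add_mem ha hb
    apply nsmul_right_injective (pow_pos hm (k a + k b)).ne'
    change m ^ (k a + k b) • f (a + b) = m ^ (k a + k b) • (f a + f b)
    rw [nsmul_add, hkey _ _ ha, hkey _ _ hb, hkey _ _ hab, ← map_add]
    congr 1
    exact Subtype.ext (nsmul_add _ _ _)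
  · rw [injective_iff_map_eq_zero]
    intro a ha
    have ha : f a = 0 := ha
    have h1 := hf a
    rw [ha, nsmul_zero] at h1
    have h2 := congrArg Subtype.val (hj (h1.trans (map_zero j).symm))
    have h3 : m ^ k a • a = 0 := h2
    apply nsmul_right_injective (pow_pos hm (k a)).ne'
    change m ^ k a • a = m ^ k a • 0
    rw [h3, nsmul_zero]

/-- `B` is free of rank at most 2, so it embeds in ℤ² and hence in ℤ[1/m]²; divisibility by `m`
extends the embedding to `A`. -/
theorem IsFGUpToPowers.exists_injective_zInv_prod {A : Type u} [CommGroup A]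
    (hP : IsFGUpToPowers A) (htf : TorsionFreeGroup A) (hh : hirschLength A ≤ 2) :
    ∃ m : ℕ, 0 < m ∧ ∃ f : A →* Multiplicative (ZInv m × ZInv m), Function.Injective f := by
  obtain ⟨m, hm, B, hBfg, hB⟩ := hP
  have h0 : Group.FG B := (Group.fg_iff_subgroup_fg B).mpr hBfg
  obtain ⟨h1, h2, h3⟩ := (htf.subgroup B).lattice
  have hr : Module.finrank ℤ (Additive B) ≤ 2 := by
    exact_mod_cast h3.trans ((hirschLength_subgroup_le B).trans hh)
  let b := Module.finBasis ℤ (Additive B)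
  let c : Additive B →+ (Fin 2 →₀ ℤ) :=
    (Finsupp.mapDomain.addMonoidHom (Fin.castLE hr)).comp b.repr.toAddEquiv.toAddMonoidHom
  have hc : Function.Injective c :=
    (Finsupp.mapDomain_injective (Fin.castLE_injective hr)).comp b.repr.injective
  let ι : ℤ →+ ZInv m := (algebraMap ℤ (ZInv m)).toAddMonoidHom
  have hι : Function.Injective ι := zInv_algebraMap_injective hm
  let j : Additive B →+ ZInv m × ZInv m :=
    (ι.comp ((Finsupp.applyAddHom 0).comp c)).prod (ι.comp ((Finsupp.applyAddHom 1).comp c))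
  have hj : Function.Injective j := by
    intro x y hxy
    apply hc
    have e0 : c x 0 = c y 0 := hι (congrArg Prod.fst hxy)
    have e1 : c x 1 = c y 1 := hι (congrArg Prod.snd hxy)
    ext i
    fin_cases i
    · exact e0
    · exact e1
  have := htf.isAddTorsionFree
  have := zInv_isAddTorsionFree hm
  obtain ⟨f, hf⟩ := exists_injective_extension (M := Additive A) (W := ZInv m × ZInv m) hm
    (by
      rintro ⟨x, y⟩
      obtain ⟨x', rfl⟩ := zInv_exists_eq_smul m x
      obtain ⟨y', rfl⟩ := zInv_exists_eq_smul m y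
      exact ⟨(x', y'), by simp⟩)
    (Subgroup.toAddSubgroup B) (fun a => hB a.toMul) j hj
  exact ⟨m, hm, AddMonoidHom.toMultiplicativeRight f, hf⟩

end PowerBounded

/-! ### An abelian normal subgroup with virtually polycyclic quotient. -/

section AbelianNormalSubgroup

/-- A torsion-free group which is central-by-(locally finite) is abelian. -/
theorem TorsionFreeGroup.mul_comm_of_le_center {C : Type u} [Group C] (htf : TorsionFreeGroup C)
    (B : Subgroup C) [B.Normal] (hB : B ≤ Subgroup.center C) (h : hirschLength (C ⧸ B) = 0)
    (a b : C) : a * b = b * a := by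
  -- Two elements generate a group that is finite modulo a central subgroup, so Schur's theorem
  -- applies.
  set K := Subgroup.closure {a, b} with hK
  have hKfg : Group.FG K := by
    rw [Group.fg_iff_subgroup_fg, Subgroup.fg_iff]
    exact ⟨_, rfl, by simp⟩
  have hinj : Function.Injective (QuotientGroup.map (B.subgroupOf K) B K.subtype le_rfl) := by
    rw [injective_iff_map_eq_one]
    intro x
    induction x using QuotientGroup.induction_on with
    | H x =>
      intro hx
      rw [QuotientGroup.eq_one_iff]
      exact (QuotientGroup.eq_one_iff (x : C)).mp hx
  have h0 : hirschLength (K ⧸ B.subgroupOf K) = 0 :=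
    le_antisymm ((hirschLength_le_of_injective _ hinj).trans h.le) bot_le
  have hfin : Finite (K ⧸ B.subgroupOf K) := finite_of_hirschLength_eq_zero h0
  have hi : (B.subgroupOf K).FiniteIndex := Subgroup.finiteIndex_of_finite_quotient
  have hle : B.subgroupOf K ≤ Subgroup.center K := by
    intro x hx
    rw [Subgroup.mem_center_iff]
    exact fun g => Subtype.ext (Subgroup.mem_center_iff.mp (hB hx) g)
  have := Subgroup.finiteIndex_of_le hle
  exact congrArg Subtype.val ((htf.subgroup K).mul_comm_of_finiteIndex_center
    (⟨a, Subgroup.subset_closure (by simp)⟩ : K) ⟨b, Subgroup.subset_closure (by simp)⟩)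

theorem TorsionFreeGroup.pow_left_injective {A : Type u} [CommGroup A] (h : TorsionFreeGroup A)
    {n : ℕ} (hn : 0 < n) {a b : A} (hab : a ^ n = b ^ n) : a = b := by
  have : (a * b⁻¹) ^ n = 1 := by rw [mul_pow, inv_pow, hab, mul_inv_cancel]
  exact mul_inv_eq_one.mp (h.eq_one hn this)

/-- The translates under `F` of a finite set spanning `A` up to torsion generate an invariant
lattice of rank at most 2, on which `F` is faithful because roots in `A` are unique. The constant is
`4 ^ 2 = 16` in the bound for lattices. -/
theorem card_le_of_finite_mulAut {A : Type u} [CommGroup A] (htf : TorsionFreeGroup A)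
    (hh : hirschLength A ≤ 2) (F : Subgroup (MulAut A)) [Finite F] : Nat.card F ≤ 16 ^ 16 := by
  obtain ⟨T, hT⟩ := exists_fg_forall_pow_mem 2 hh
  set Y : Set A := Set.range fun p : F × T => (p.1 : MulAut A) (p.2 : A) with hY
  set B := Subgroup.closure Y with hB
  have hBfg : Group.FG B := by
    rw [Group.fg_iff_subgroup_fg, Subgroup.fg_iff]
    exact ⟨Y, rfl, Set.finite_range _⟩
  have hTB : Subgroup.closure (T : Set A) ≤ B :=
    Subgroup.closure_mono fun t ht => ⟨⟨1, ⟨t, ht⟩⟩, rfl⟩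
  have hinv : ∀ f : F, ∀ b ∈ B, (f : MulAut A) b ∈ B := by
    intro f
    have : B ≤ B.comap (f : MulAut A).toMonoidHom := by
      rw [hB, Subgroup.closure_le]
      rintro _ ⟨⟨g, t⟩, rfl⟩
      exact Subgroup.subset_closure ⟨⟨f * g, t⟩, rfl⟩
    exact this
  obtain ⟨h1, h2, h3⟩ := (htf.subgroup B).lattice
  have hr : Module.finrank ℤ (Additive B) ≤ 2 := by
    exact_mod_cast h3.trans ((hirschLength_subgroup_le B).trans hh)
  let res : F → (B →* B) := fun f =>
    ((f : MulAut A).toMonoidHom.comp B.subtype).codRestrict B fun b => hinv f b b.2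
  let φ : F →* Module.End ℤ (Additive B) :=
    { toFun := fun f => (MonoidHom.toAdditive (res f)).toIntLinearMap
      map_one' := by
        ext x
        rfl
      map_mul' := fun f g => by
        ext x
        rfl }
  have hφ : Function.Injective φ := by
    intro f g hfg
    apply Subtype.ext
    ext a
    obtain ⟨l, hl, hal⟩ := hT a
    apply htf.pow_left_injective hl
    rw [← map_pow, ← map_pow]
    have := LinearMap.congr_fun hfg (Additive.ofMul ⟨a ^ l, hTB hal⟩)
    exact congrArg (fun x : Additive B => (x.toMul : A)) this
  refine (card_le_of_injective_end φ hφ).trans ?_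
  have h4 : 4 ^ Module.finrank ℤ (Additive B) ≤ 16 :=
    (Nat.pow_le_pow_right (by norm_num) hr).trans (by norm_num)
  exact (Nat.pow_le_pow_left h4 _).trans (Nat.pow_le_pow_right (by norm_num) h4)

/-- A locally finite group acts on an abelian torsion-free group of Hirsch length at most `2`
through a finite group. -/
theorem finiteIndex_ker_mulAut {N A : Type u} [Group N] [CommGroup A] (htf : TorsionFreeGroup A)
    (hh : hirschLength A ≤ 2) (ρ : N →* MulAut A) (B : Subgroup N) [B.Normal] (hB : B ≤ ρ.ker)
    (h : hirschLength (N ⧸ B) = 0) : ρ.ker.FiniteIndex := by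
  have hfin : Finite ρ.range := by
    by_contra hinf
    rw [not_finite_iff_infinite] at hinf
    -- Lifts of these elements generate a group with finite image in the locally finite `N ⧸ B`,
    -- hence a finite group of automorphisms exceeding the bound.
    obtain ⟨S, hS⟩ := Infinite.exists_subset_card_eq ρ.range (16 ^ 16 + 1)
    let σ : ρ.range → N := fun x => x.2.choose
    have hσ : ∀ x : ρ.range, ρ (σ x) = x := fun x => x.2.choose_spec
    set L := Subgroup.closure (σ '' (S : Set ρ.range)) with hL
    have hLfg : Group.FG L := by
      rw [Group.fg_iff_subgroup_fg, Subgroup.fg_iff]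
      exact ⟨_, rfl, S.finite_toSet.image _⟩
    have hLB : Finite (L.map (QuotientGroup.mk' B)) := by
      have : Group.FG (L.map (QuotientGroup.mk' B)) :=
        Group.fg_of_surjective ((QuotientGroup.mk' B).subgroupMap_surjective L)
      exact finite_of_hirschLength_eq_zero
        (le_antisymm ((hirschLength_subgroup_le _).trans h.le) bot_le)
    have hmap : L.map ρ = (L.map (QuotientGroup.mk' B)).map (QuotientGroup.lift B ρ hB) := by
      rw [Subgroup.map_map]
      rfl
    have hLρ : Finite (L.map ρ) := by
      rw [hmap]
      exact Finite.of_surjective _ ((QuotientGroup.lift B ρ hB).subgroupMap_surjective _)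
    have hcard := card_le_of_finite_mulAut htf hh (L.map ρ)
    have hSL : S.card ≤ Nat.card (L.map ρ) := by
      let f : S → L.map ρ := fun x =>
        ⟨(x : ρ.range), σ x, Subgroup.subset_closure ⟨x, x.2, rfl⟩, hσ x⟩
      have hf : Function.Injective f := fun x y hxy =>
        Subtype.ext (Subtype.ext (congrArg (fun z : L.map ρ => (z : MulAut A)) hxy))
      simpa using Nat.card_le_card_of_injective f hf
    omega
  have : Finite (N ⧸ ρ.ker) := Finite.of_equiv _ (QuotientGroup.quotientKerEquivRange ρ).symm.toEquiv
  exact Subgroup.finiteIndex_of_finite_quotient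

theorem TorsionFreeGroup.exists_pow_mem_zpowers {A : Type u} [CommGroup A]
    (htf : TorsionFreeGroup A) (hh : hirschLength A ≤ 1) {e : A} (he : e ≠ 1) (a : A) :
    ∃ l : ℕ, 0 < l ∧ a ^ l ∈ Subgroup.zpowers e := by
  have h0 : hirschLength (A ⧸ Subgroup.zpowers e) = 0 := by
    rw [hirschLength_eq_quotient_add (Subgroup.zpowers e), hirschLength_zpowers (htf e he)] at hh
    have h1 : (1 : ℕ∞) + hirschLength (A ⧸ Subgroup.zpowers e) ≤ 1 + 0 := by rwa [add_zero]
    exact le_antisymm ((ENat.add_le_add_iff_left ENat.one_ne_top).mp h1) bot_le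
  obtain ⟨l, hl, hal⟩ := isOfFinOrder_iff_pow_eq_one.mp
    (isOfFinOrder_of_hirschLength_eq_zero h0 (a : A ⧸ Subgroup.zpowers e))
  exact ⟨l, hl, (QuotientGroup.eq_one_iff (N := Subgroup.zpowers e) (a ^ l)).mp hal⟩

/-- The automorphism group of a torsion-free abelian group of rank `1` is abelian. -/
theorem TorsionFreeGroup.mulAut_mul_comm {A : Type u} [CommGroup A] (htf : TorsionFreeGroup A)
    (hh : hirschLength A ≤ 1) (f g : MulAut A) : f * g = g * f := by
  ext a
  by_cases ha : a = 1
  · rw [ha, map_one, map_one]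
  obtain ⟨l, hl, p, hp⟩ := htf.exists_pow_mem_zpowers hh ha (f a)
  obtain ⟨n, hn, q, hq⟩ := htf.exists_pow_mem_zpowers hh ha (g a)
  have hp : a ^ p = f a ^ l := hp
  have hq : a ^ q = g a ^ n := hq
  -- In rank one automorphisms act as multiplication by rational numbers, here `p / l` and `q / n`;
  -- both composites send `a` to an `l * n`-th root of `a ^ (p * q)`.
  apply htf.pow_left_injective (Nat.mul_pos hl hn)
  change (f (g a)) ^ (l * n) = (g (f a)) ^ (l * n)
  have e1 : (f (g a)) ^ (l * n) = a ^ (p * q) := by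
    rw [mul_comm, pow_mul, ← map_pow, ← hq, map_zpow, ← zpow_natCast, ← zpow_mul, mul_comm q,
      zpow_mul, zpow_natCast, ← hp, ← zpow_mul]
  have e2 : (g (f a)) ^ (l * n) = a ^ (p * q) := by
    rw [pow_mul, ← map_pow, ← hp, map_zpow, ← zpow_natCast, ← zpow_mul, mul_comm p,
      zpow_mul, zpow_natCast, ← hq, ← zpow_mul, mul_comm q]
  rw [e1, e2]

theorem isVirtuallyPolycyclic_quotient_of_le {G : Type u} [Group G] {A N : Subgroup G} [A.Normal]
    [hN : N.Normal] (hAN : A ≤ N) (h1 : IsVirtuallyPolycyclic (N.map (QuotientGroup.mk' A)))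
    (h2 : IsVirtuallyPolycyclic (G ⧸ N)) : IsVirtuallyPolycyclic (G ⧸ A) := by
  have : (N.map (QuotientGroup.mk' A)).Normal := hN.map _ (QuotientGroup.mk'_surjective A)
  exact .of_extension (N.map (QuotientGroup.mk' A)) h1
    (h2.of_surjective (QuotientGroup.quotientQuotientEquivQuotient A N hAN).symm.toMonoidHom
      (QuotientGroup.quotientQuotientEquivQuotient A N hAN).symm.surjective)

theorem IsVirtuallyPolycyclic.of_ker_le {N X Y : Type u} [Group N] [Group X] [Group Y]
    (h : IsVirtuallyPolycyclic X) (f : N →* X) (hf : Function.Surjective f) (g : N →* Y)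
    (hg : Function.Surjective g) (hle : f.ker ≤ g.ker) : IsVirtuallyPolycyclic Y := by
  have h1 : Function.Surjective (QuotientGroup.lift f.ker g hle) := fun y => by
    obtain ⟨x, rfl⟩ := hg y
    exact ⟨(x : N ⧸ f.ker), rfl⟩
  exact h.of_surjective ((QuotientGroup.lift f.ker g hle).comp
    (QuotientGroup.quotientKerEquivOfSurjective f hf).symm.toMonoidHom)
    (h1.comp (QuotientGroup.quotientKerEquivOfSurjective f hf).symm.surjective)

theorem hirschLength_eq_add_subgroupOf {G : Type u} [Group G] {B N : Subgroup G} (hBN : B ≤ N)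
    [(B.subgroupOf N).Normal] :
    hirschLength N = hirschLength B + hirschLength (N ⧸ B.subgroupOf N) := by
  rw [hirschLength_eq_quotient_add (B.subgroupOf N),
    hirschLength_congr (Subgroup.subgroupOfEquivOfLe hBN)]

theorem hirschLength_quotient_eq_zero {G : Type u} [Group G] {B N : Subgroup G} (hBN : B ≤ N)
    [(B.subgroupOf N).Normal] {n : ℕ} (hB : (n : ℕ∞) ≤ hirschLength B) (hN : hirschLength N ≤ n) :
    hirschLength (N ⧸ B.subgroupOf N) = 0 := by
  rw [hirschLength_eq_add_subgroupOf hBN] at hN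
  have h1 : (n : ℕ∞) + hirschLength (N ⧸ B.subgroupOf N) ≤ n + 0 := by
    rw [add_zero]
    exact (add_le_add hB le_rfl).trans hN
  exact le_antisymm ((ENat.add_le_add_iff_left (ENat.natCast_ne_top n)).mp h1) bot_le

/-- An abelian normal subgroup of `G` which has full Hirsch length in `N` is contained, up to finite
index in `N`, in its centralizer, which is abelian. -/
theorem exists_abelian_of_hirschLength_quotient_eq_zero {G : Type u} [Group G]
    (htf : TorsionFreeGroup G) (N : Subgroup G) [hNn : N.Normal] (hN : hirschLength N ≤ 2)
    (hPF : IsVirtuallyPolycyclic (G ⧸ N)) (B : Subgroup G) [hBn : B.Normal] (hBN : B ≤ N)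
    (hBc : ∀ x ∈ B, ∀ y ∈ B, x * y = y * x) (hB0 : hirschLength (N ⧸ B.subgroupOf N) = 0) :
    ∃ A : Subgroup G, ∃ _ : A.Normal, (∀ x ∈ A, ∀ y ∈ A, x * y = y * x) ∧
      IsVirtuallyPolycyclic (G ⧸ A) := by
  let _ : CommGroup B := { mul_comm := fun x y => Subtype.ext (hBc x x.2 y y.2) }
  let ρ : G →* MulAut B := MulAut.conjNormal
  have hρ : ∀ g, g ∈ ρ.ker ↔ ∀ b ∈ B, g * b * g⁻¹ = b := by
    intro g
    rw [MonoidHom.mem_ker]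
    constructor
    · intro h b hb
      exact congrArg Subtype.val (MulEquiv.congr_fun h ⟨b, hb⟩)
    · intro h
      ext b
      exact h b b.2
  have hBρ : B ≤ ρ.ker := fun x hx => (hρ x).mpr fun b hb => by
    rw [hBc x hx b hb, mul_inv_cancel_right]
  set A := N ⊓ ρ.ker with hA
  have hAn : A.Normal := Subgroup.normal_inf_normal N ρ.ker
  have hAN : A ≤ N := inf_le_left
  have hBA : B ≤ A := le_inf hBN hBρ
  refine ⟨A, hAn, ?_, ?_⟩
  · have h0 : hirschLength (A ⧸ B.subgroupOf A) = 0 := by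
      refine le_antisymm (le_trans ?_ hB0.le) bot_le
      refine hirschLength_le_of_injective
        (QuotientGroup.map (B.subgroupOf A) (B.subgroupOf N) (Subgroup.inclusion hAN) le_rfl) ?_
      rw [injective_iff_map_eq_one]
      intro x
      induction x using QuotientGroup.induction_on with
      | H x =>
        intro hx
        rw [QuotientGroup.eq_one_iff]
        exact (QuotientGroup.eq_one_iff (Subgroup.inclusion hAN x)).mp hx
    have hcent : B.subgroupOf A ≤ Subgroup.center A := by
      intro b hb
      rw [Subgroup.mem_center_iff]
      intro g
      exact Subtype.ext (mul_inv_eq_iff_eq_mul.mp ((hρ g).mp g.2.2 b hb))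
    intro x hx y hy
    exact congrArg Subtype.val
      ((htf.subgroup A).mul_comm_of_le_center _ hcent h0 ⟨x, hx⟩ ⟨y, hy⟩)
  · refine isVirtuallyPolycyclic_quotient_of_le hAN ?_ hPF
    -- `N` acts on `B` through a finite group, so `N / A` is finite.
    have hfi := finiteIndex_ker_mulAut (htf.subgroup B) ((hirschLength_mono hBN).trans hN)
      (ρ.comp N.subtype) (B.subgroupOf N) (fun x hx => hBρ hx) hB0
    have : Finite (N ⧸ (ρ.comp N.subtype).ker) := inferInstance
    refine IsVirtuallyPolycyclic.of_ker_le (.of_finite (N ⧸ (ρ.comp N.subtype).ker))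
      (QuotientGroup.mk' _) (QuotientGroup.mk'_surjective _)
      ((QuotientGroup.mk' A).subgroupMap N) ((QuotientGroup.mk' A).subgroupMap_surjective N) ?_
    intro x hx
    rw [QuotientGroup.ker_mk'] at hx
    have hxA : (x : G) ∈ A := ⟨x.2, hx⟩
    exact Subtype.ext ((QuotientGroup.eq_one_iff (x : G)).mpr hxA)

/-- An abelian normal subgroup `B` of Hirsch length `1` whose centralizer in `N` has Hirsch length
`1` leads to an abelian normal subgroup with virtually polycyclic quotient. -/
theorem exists_abelian_of_rank_one {G : Type u} [Group G] [Group.FG G]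
    (htf : TorsionFreeGroup G) (N : Subgroup G) [hNn : N.Normal]
    (hPF : IsVirtuallyPolycyclic (G ⧸ N)) (B : Subgroup G) [hBn : B.Normal]
    (hBc : ∀ x ∈ B, ∀ y ∈ B, x * y = y * x) (hB1 : hirschLength B ≤ 1) (C : Subgroup G) [C.Normal]
    (hC : ∀ g, g ∈ C ↔ g ∈ N ∧ ∀ b ∈ B, g * b * g⁻¹ = b)
    (hC0 : hirschLength (C ⧸ B.subgroupOf C) = 0) :
    ∃ A : Subgroup G, ∃ _ : A.Normal, (∀ x ∈ A, ∀ y ∈ A, x * y = y * x) ∧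
      IsVirtuallyPolycyclic (G ⧸ A) := by
  let _ : CommGroup B := { mul_comm := fun x y => Subtype.ext (hBc x x.2 y y.2) }
  let ρ : G →* MulAut B := MulAut.conjNormal
  refine ⟨C, inferInstance, ?_, ?_⟩
  · have hcent : B.subgroupOf C ≤ Subgroup.center C := by
      intro b hb
      rw [Subgroup.mem_center_iff]
      intro g
      exact Subtype.ext (mul_inv_eq_iff_eq_mul.mp (((hC g).mp g.2).2 b hb))
    intro x hx y hy
    exact congrArg Subtype.val
      ((htf.subgroup C).mul_comm_of_le_center _ hcent hC0 ⟨x, hx⟩ ⟨y, hy⟩)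
  · refine isVirtuallyPolycyclic_quotient_of_le (fun x hx => ((hC x).mp hx).1) ?_ hPF
    -- The image of the finitely generated `G` in the abelian group `Aut B` is finitely generated
    -- abelian, and so is the image of `N`, which is `N / C`.
    let _ : CommGroup ρ.range :=
      { mul_comm := fun x y => Subtype.ext ((htf.subgroup B).mulAut_mul_comm hB1 x y) }
    have hfg : Group.FG ρ.range := inferInstance
    have hfg2 : Group.FG (N.map ρ.rangeRestrict) :=
      (Group.fg_iff_subgroup_fg _).mpr (subgroup_fg_of_comm _)
    have hPN : IsVirtuallyPolycyclic (N.map ρ.rangeRestrict) :=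
      isVirtuallyPolycyclic_of_fg_of_comm hfg2 fun a b => Subtype.ext (mul_comm (a : ρ.range) b)
    refine hPN.of_ker_le (ρ.rangeRestrict.subgroupMap N)
      (ρ.rangeRestrict.subgroupMap_surjective N)
      ((QuotientGroup.mk' C).subgroupMap N) ((QuotientGroup.mk' C).subgroupMap_surjective N) ?_
    intro x hx
    have h1 : ρ (x : G) = 1 :=
      congrArg (fun y : N.map ρ.rangeRestrict => ((y : ρ.range) : MulAut B)) (MonoidHom.mem_ker.mp hx)
    have hxC : (x : G) ∈ C := (hC x).mpr ⟨x.2, fun b hb =>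
      congrArg Subtype.val (MulEquiv.congr_fun h1 ⟨b, hb⟩)⟩
    exact Subtype.ext ((QuotientGroup.eq_one_iff (x : G)).mpr hxC)

/-- If the centralizer `C` of an abelian normal subgroup `B` of Hirsch length `1` has Hirsch
length `2`, then it contains an abelian normal subgroup of Hirsch length `2`. -/
theorem exists_abelian_of_centralizer {G : Type u} [Group G] (htf : TorsionFreeGroup G) {c : ℕ}
    (hsol : derivedSeries G c = ⊥) (B C : Subgroup G) [hBn : B.Normal] [hCn : C.Normal]
    (hBC : B ≤ C) (hcent : ∀ g ∈ C, ∀ b ∈ B, g * b = b * g) (hB1 : hirschLength B = 1)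
    (hC : hirschLength C = 2) :
    ∃ M : Subgroup G, M.Normal ∧ M ≤ C ∧ (∀ x ∈ M, ∀ y ∈ M, x * y = y * x) ∧
      2 ≤ hirschLength M := by
  -- This chain descends from `C` at `0` to `B` at `c`. The required subgroup is its last member of
  -- length at least 2.
  let M : ℕ → Subgroup G := fun i => (C ⊓ derivedSeries G i) ⊔ B
  have hMC : ∀ i, M i ≤ C := fun i => sup_le inf_le_left hBC
  have hBM : ∀ i, B ≤ M i := fun i => le_sup_right
  have hM0 : 2 ≤ hirschLength (M 0) := by
    rw [← hC]
    refine hirschLength_mono ?_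
    simp only [M, derivedSeries_zero, inf_top_eq]
    exact le_sup_left
  have hMc : ¬ 2 ≤ hirschLength (M c) := by
    have : M c = B := by simp only [M, hsol, inf_bot_eq, bot_sup_eq]
    rw [this, hB1]
    decide
  classical
  have hex : ∃ i, ¬ 2 ≤ hirschLength (M i) := ⟨c, hMc⟩
  obtain ⟨i, hi⟩ : ∃ i, Nat.find hex = i + 1 := by
    refine Nat.exists_eq_succ_of_ne_zero fun h0 => ?_
    have := Nat.find_spec hex
    rw [h0] at this
    exact this hM0
  have hi1 : ¬ 2 ≤ hirschLength (M (i + 1)) := hi ▸ Nat.find_spec hex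
  have hi2 : 2 ≤ hirschLength (M i) := by
    by_contra h
    exact Nat.find_min hex (by omega : i < Nat.find hex) h
  have hi1' : hirschLength (M (i + 1)) ≤ 1 := by
    rw [not_le] at hi1
    exact Order.le_of_lt_add_one (by rwa [one_add_one_eq_two])
  have hMn : ∀ i, (M i).Normal := fun i => by
    have : (C ⊓ derivedSeries G i).Normal := Subgroup.normal_inf_normal _ _
    exact Subgroup.sup_normal _ _
  have hMab : ∀ x ∈ M (i + 1), ∀ y ∈ M (i + 1), x * y = y * x := by
    have hn := hMn (i + 1)
    have h0 := hirschLength_quotient_eq_zero (hBM (i + 1)) (n := 1) hB1.ge hi1'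
    have hc : B.subgroupOf (M (i + 1)) ≤ Subgroup.center (M (i + 1)) := by
      intro b hb
      rw [Subgroup.mem_center_iff]
      exact fun g => Subtype.ext (hcent g (hMC _ g.2) b hb)
    intro x hx y hy
    exact congrArg Subtype.val
      ((htf.subgroup (M (i + 1))).mul_comm_of_le_center _ hc h0 ⟨x, hx⟩ ⟨y, hy⟩)
  -- A power of `w` lies in `B`, which `C` centralizes; unique roots in the abelian group `M (i +
  -- 1)` extend this to `w`.
  have hMcent : ∀ w ∈ M (i + 1), ∀ g ∈ C, g * w = w * g := by
    let _ : CommGroup (M (i + 1)) := { mul_comm := fun x y => Subtype.ext (hMab x x.2 y y.2) }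
    intro w hw g hg
    have hB0 : ∃ e ∈ B, e ≠ 1 := by
      by_contra hcon
      push Not at hcon
      have : Subsingleton B := subsingleton_of_forall_eq 1 fun x => Subtype.ext (hcon x x.2)
      rw [hirschLength_of_finite] at hB1
      exact zero_ne_one hB1
    obtain ⟨e, heB, he⟩ := hB0
    obtain ⟨l, hl, hwl⟩ := (htf.subgroup (M (i + 1))).exists_pow_mem_zpowers hi1'
      (e := ⟨e, hBM _ heB⟩) (fun h => he (congrArg Subtype.val h)) ⟨w, hw⟩
    have hwB : w ^ l ∈ B := by
      obtain ⟨j, hj⟩ := hwl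
      have hj : e ^ j = w ^ l := congrArg Subtype.val hj
      rw [← hj]
      exact B.zpow_mem heB j
    have h1 : (⟨g * w * g⁻¹, (hMn (i + 1)).conj_mem w hw g⟩ : M (i + 1)) = ⟨w, hw⟩ := by
      apply (htf.subgroup (M (i + 1))).pow_left_injective hl
      apply Subtype.ext
      change (g * w * g⁻¹) ^ l = w ^ l
      rw [conj_pow, hcent g hg _ hwB, mul_inv_cancel_right]
    exact mul_inv_eq_iff_eq_mul.mp (congrArg Subtype.val h1)
  refine ⟨M i, hMn i, hMC i, fun x hx y hy => ?_, hi2⟩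
  -- The factors from `B` are central in `C` and drop out. As `C` centralizes `M (i + 1)`, a
  -- nontrivial commutator would give `C` length at least 3.
  have hz : ⁅x, y⁆ ∈ M (i + 1) := by
    obtain ⟨u, hu, b, hb, rfl⟩ := Subgroup.mem_sup_of_normal_right.mp hx
    obtain ⟨v, hv, d, hd, rfl⟩ := Subgroup.mem_sup_of_normal_right.mp hy
    have h1 : ⁅u * b, v * d⁆ = ⁅u, v⁆ := by
      have e1 := hcent _ (hMC i hy) b hb
      have e2 := hcent _ (hMC i hx) d hd
      have e3 := hcent u hu.1 d hd
      simp only [commutatorElement_def, mul_inv_rev]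
      calc u * b * (v * d) * (b⁻¹ * u⁻¹) * (d⁻¹ * v⁻¹)
          = u * (b * (v * d)) * b⁻¹ * u⁻¹ * d⁻¹ * v⁻¹ := by group
        _ = u * v * (d * u⁻¹) * d⁻¹ * v⁻¹ := by rw [← e1]; group
        _ = u * v * u⁻¹ * v⁻¹ := by
          rw [← (show Commute u d from e3).inv_left.eq]; group
    rw [h1]
    refine Subgroup.mem_sup_left ⟨?_, ?_⟩
    · have := C.mul_mem hu.1 (hCn.conj_mem _ (C.inv_mem hu.1) v)
      simpa [commutatorElement_def, mul_assoc] using this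
    · rw [derivedSeries_succ]
      exact Subgroup.commutator_mem_commutator hu.2 hv.2
  by_contra hne
  have h3 := htf.subgroup C
  have := h3.three_le_hirschLength (x := ⟨x, hMC i hx⟩) (y := ⟨y, hMC i hy⟩)
    (fun h => hne (commutatorElement_eq_one_iff_mul_comm.mp (congrArg Subtype.val h)))
    (Subtype.ext (hMcent _ hz x (hMC i hx)).symm) (Subtype.ext (hMcent _ hz y (hMC i hy)).symm)
  rw [hC] at this
  exact absurd this (by decide)

/-- If no abelian normal subgroup of `G` in `N` has full length, the last nontrivial `N ∩ G⁽ⁱ⁾` is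
abelian of length exactly 1. Its centralizer in `N` then either has length 1, where the
automorphisms of a rank one group finish, or length 2, where it contains an abelian normal subgroup
of full length after all. -/
theorem exists_abelian_normal_virtuallyPolycyclic {G : Type u} [Group G] [Group.FG G]
    (htf : TorsionFreeGroup G) {c : ℕ} (hsol : derivedSeries G c = ⊥) (N : Subgroup G)
    [hNn : N.Normal] (hN : hirschLength N ≤ 2) (hPF : IsVirtuallyPolycyclic (G ⧸ N)) :
    ∃ A : Subgroup G, ∃ _ : A.Normal, (∀ x ∈ A, ∀ y ∈ A, x * y = y * x) ∧
      IsVirtuallyPolycyclic (G ⧸ A) := by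
  by_cases hfull : ∃ B : Subgroup G, ∃ _ : B.Normal, B ≤ N ∧
      (∀ x ∈ B, ∀ y ∈ B, x * y = y * x) ∧ hirschLength (N ⧸ B.subgroupOf N) = 0
  · obtain ⟨B, hBn, hBN, hBc, hB0⟩ := hfull
    exact exists_abelian_of_hirschLength_quotient_eq_zero htf N hN hPF B hBN hBc hB0
  push Not at hfull
  classical
  have hex : ∃ i, N ⊓ derivedSeries G i = ⊥ := ⟨c, by rw [hsol, inf_bot_eq]⟩
  by_cases hfind : Nat.find hex = 0
  · have h0 := Nat.find_spec hex
    rw [hfind, derivedSeries_zero, inf_top_eq] at h0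
    refine (hfull N hNn le_rfl ?_ ?_).elim
    · intro x hx y hy
      rw [h0, Subgroup.mem_bot] at hx hy
      rw [hx, hy]
    · exact hirschLength_quotient_eq_zero (n := 0) le_rfl bot_le (by
        subst h0
        rw [hirschLength_of_finite]
        exact le_rfl)
  obtain ⟨i, hi⟩ := Nat.exists_eq_succ_of_ne_zero hfind
  have hi1 : N ⊓ derivedSeries G (i + 1) = ⊥ := by
    have := Nat.find_spec hex
    rwa [hi] at this
  set B := N ⊓ derivedSeries G i with hB
  have hB0 : B ≠ ⊥ := Nat.find_min hex (by omega : i < Nat.find hex)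
  have hBn : B.Normal := Subgroup.normal_inf_normal _ _
  have hBN : B ≤ N := inf_le_left
  have hBc : ∀ x ∈ B, ∀ y ∈ B, x * y = y * x := by
    intro x hx y hy
    rw [← commutatorElement_eq_one_iff_mul_comm, ← Subgroup.mem_bot, ← hi1]
    refine ⟨?_, ?_⟩
    · have := N.mul_mem hx.1 (hNn.conj_mem _ (N.inv_mem hx.1) y)
      simpa [commutatorElement_def, mul_assoc] using this
    · rw [derivedSeries_succ]
      exact Subgroup.commutator_mem_commutator hx.2 hy.2
  have hBpos : 1 ≤ hirschLength B := by
    obtain ⟨e, he⟩ := Subgroup.ne_bot_iff_exists_ne_one.mp hB0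
    exact (htf.subgroup B).one_le_hirschLength he
  have hB1 : hirschLength B = 1 := by
    refine le_antisymm ?_ hBpos
    by_contra h
    have h2 : (2 : ℕ∞) ≤ hirschLength B := by
      rw [not_le] at h
      exact one_add_one_eq_two (R := ℕ∞) ▸ Order.add_one_le_of_lt h
    exact hfull B hBn hBN hBc (hirschLength_quotient_eq_zero hBN (n := 2) h2 hN)
  let ρ : G →* MulAut B := MulAut.conjNormal
  set C := N ⊓ ρ.ker with hC
  have hCn : C.Normal := Subgroup.normal_inf_normal _ _
  have hCiff : ∀ g, g ∈ C ↔ g ∈ N ∧ ∀ b ∈ B, g * b * g⁻¹ = b := by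
    intro g
    refine and_congr Iff.rfl ?_
    change g ∈ ρ.ker ↔ _
    rw [MonoidHom.mem_ker]
    constructor
    · intro h b hb
      exact congrArg Subtype.val (MulEquiv.congr_fun h ⟨b, hb⟩)
    · intro h
      ext b
      exact h b b.2
  have hBC : B ≤ C := fun x hx => (hCiff x).mpr ⟨hBN hx, fun b hb => by
    rw [hBc x hx b hb, mul_inv_cancel_right]⟩
  by_cases hC0 : hirschLength (C ⧸ B.subgroupOf C) = 0
  · exact exists_abelian_of_rank_one htf N hPF B hBc hB1.le C hCiff hC0
  have hC2 : hirschLength C = 2 := by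
    refine le_antisymm ((hirschLength_mono inf_le_left).trans hN) ?_
    rw [hirschLength_eq_add_subgroupOf hBC, hB1, ← one_add_one_eq_two]
    exact add_le_add le_rfl (Order.one_le_iff_ne_zero.mpr hC0)
  obtain ⟨M, hMn, hMC, hMc, hM2⟩ := exists_abelian_of_centralizer htf hsol B C hBC
    (fun g hg b hb => mul_inv_eq_iff_eq_mul.mp (((hCiff g).mp hg).2 b hb)) hB1 hC2
  have hMN : M ≤ N := hMC.trans inf_le_left
  exact (hfull M hMn hMN hMc (hirschLength_quotient_eq_zero hMN (n := 2) hM2 hN)).elim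

end AbelianNormalSubgroup

/-! ### The minimax series and the structure of the radical. -/

theorem mainTheorem7 (G : Type u) [Group G] (hfg : Group.FG G)
    (htf : ∀ g : G, g ≠ 1 → ¬ IsOfFinOrder g)
    (hea : IsElementaryAmenable G) (hh : hirschLength G = 3) :
    IsSolvableMinimax G ∧
      (hirschLength (hirschPlotkinRadical G) = 1 →
        ∃ D : ℕ, 0 < D ∧ Nonempty (hirschPlotkinRadical G ≃* Multiplicative (ZInv D))) ∧
      (hirschLength (hirschPlotkinRadical G) = 2 →
        ∃ m : ℕ, 0 < m ∧ ∃ f : hirschPlotkinRadical G →* Multiplicative (ZInv m × ZInv m),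
          Function.Injective f) := by
  have htf : TorsionFreeGroup G := htf
  have hsol : derivedSeries G (7 * 3) = ⊥ :=
    TorsionFreeGroup.derivedSeries_eq_bot 3 le_rfl htf hh.le
  have hinf : Infinite G := by
    by_contra hfin
    rw [not_infinite_iff_finite] at hfin
    rw [hirschLength_of_finite] at hh
    exact absurd hh (by decide)
  have htop : ∀ H : Subgroup G, hirschLength H ≠ ⊤ := fun H =>
    ne_top_of_le_ne_top (ENat.natCast_ne_top 3) ((hirschLength_subgroup_le H).trans hh.le)
  obtain ⟨A, hAn, hAc, hPF⟩ : ∃ A : Subgroup G, ∃ _ : A.Normal,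
      (∀ x ∈ A, ∀ y ∈ A, x * y = y * x) ∧ IsVirtuallyPolycyclic (G ⧸ A) := by
    obtain ⟨N, hN, V, hV, hVi, hVfg, hVc, hVt, hV1⟩ := exists_virtually_abelian_quotient (G := G)
      (by rw [hh]; exact ENat.natCast_ne_top 3)
    have hNle : hirschLength N ≤ 2 := by
      obtain ⟨v, hv⟩ := Subgroup.ne_bot_iff_exists_ne_one.mp hV1
      have h1 : 1 ≤ hirschLength (G ⧸ N) :=
        (hVt.one_le_hirschLength hv).trans (hirschLength_subgroup_le V)
      rw [hirschLength_eq_quotient_add N] at hh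
      have h2 : hirschLength N + 1 ≤ 2 + 1 :=
        (add_le_add le_rfl h1).trans (hh.le.trans (by norm_num))
      exact (ENat.add_le_add_iff_right ENat.one_ne_top).mp h2
    refine exists_abelian_normal_virtuallyPolycyclic htf hsol N hNle ?_
    have hVQ : Finite ((G ⧸ N) ⧸ V) := inferInstance
    exact .of_extension V (isVirtuallyPolycyclic_of_fg_of_comm hVfg fun a b =>
      Subtype.ext (hVc a a.2 b b.2)) (.of_finite _)
  -- Stated for a general `R` since it is used twice: for `A`, and for the radical when that is
  -- abelian.
  have hpow : ∀ (R : Subgroup G) [R.Normal], (∀ x ∈ R, ∀ y ∈ R, x * y = y * x) →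
      IsVirtuallyPolycyclic (G ⧸ R) → IsFGUpToPowers R := by
    intro R _ hRc hR
    obtain ⟨S, hS, hSR⟩ := hR.finitelyRelated G (QuotientGroup.mk' R) (QuotientGroup.mk'_surjective R)
    rw [QuotientGroup.ker_mk'] at hSR
    exact isFGUpToPowers_of_normalClosure R hRc (htop R) hS hSR
  have hAR : A ≤ hirschPlotkinRadical G := by
    refine le_sSup ⟨hAn, fun K _ => ?_⟩
    have hKc : ∀ x y : K, x * y = y * x := fun x y =>
      Subtype.ext (Subtype.ext (hAc _ x.1.2 _ y.1.2))
    let _ : CommGroup K := { mul_comm := hKc }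
    infer_instance
  -- As `A` lies in the radical, this is a quotient of `G ⧸ A`.
  have hPFR : IsVirtuallyPolycyclic (G ⧸ hirschPlotkinRadical G) :=
    hPF.of_ker_le (QuotientGroup.mk' A) (QuotientGroup.mk'_surjective A)
      (QuotientGroup.mk' (hirschPlotkinRadical G)) (QuotientGroup.mk'_surjective _)
      (by rwa [QuotientGroup.ker_mk', QuotientGroup.ker_mk'])
  refine ⟨⟨⟨⟨_, hsol⟩⟩, ?_⟩, fun h1 => ?_, fun h2 => ?_⟩
  · refine HasMinimaxSeries.exists_series (.of_extension A ?_ hPF.hasMinimaxSeries)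
    let _ : CommGroup A := { mul_comm := fun x y => Subtype.ext (hAc x x.2 y y.2) }
    exact (hpow A hAc hPF).hasMinimaxSeries 3 (htf.subgroup A)
      ((hirschLength_subgroup_le A).trans hh.le)
  · have hRc := commute_hirschPlotkinRadical htf (h1.le.trans (by decide))
    let _ : CommGroup (hirschPlotkinRadical G) :=
      { mul_comm := fun x y => Subtype.ext (hRc x x.2 y y.2) }
    have htR := htf.subgroup (hirschPlotkinRadical G)
    obtain ⟨e, he⟩ : ∃ e : hirschPlotkinRadical G, e ≠ 1 := by
      by_contra hcon
      push Not at hcon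
      have : Subsingleton (hirschPlotkinRadical G) := subsingleton_of_forall_eq 1 hcon
      rw [hirschLength_of_finite] at h1
      exact zero_ne_one h1
    exact (hpow _ hRc hPFR).nonempty_mulEquiv_zInv htR he
      (htR.exists_pow_mem_zpowers h1.le he)
  · have hRc := commute_hirschPlotkinRadical htf h2.le
    let _ : CommGroup (hirschPlotkinRadical G) :=
      { mul_comm := fun x y => Subtype.ext (hRc x x.2 y y.2) }
    exact (hpow _ hRc hPFR).exists_injective_zInv_prod (htf.subgroup _) h2.le
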